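/- **Model.** Let $G$ be a directed acyclic graph on nodes $\boldsymbol X\cup\{Y\}$, $\boldsymbol X=\{X_1,\dots,X_n\}$, $n\ge 1$, with unknown edge set $E$, in which $Y$ has no outgoing edges and $X_1$ has no incoming edges, is constantly $1$ and may be a parent of every other node. Every edge has a weight $\theta^*_{X',X}\in[0,1]$; $\theta^*_{\min}=\min_{(X',X)\in E}\theta^*_{X',X}$. The nodes $X\ne X_1$ have independent zero-mean noises $\varepsilon_X$ such that almost surely $\theta^*_X\cdot pa+\varepsilon_X\in[0,1]$ for all values $pa\in\{0,1\}^{\mathrm{Pa}(X)}$ of the parents (with $X_1=1$). In a *binary linear model* (BLM), $X\in\{0,1\}$ with $P(X=1\mid \mathrm{Pa}(X)=pa,\varepsilon_X)=\theta^*_X\cdot pa+\varepsilon_X$ (equivalently $X=1$ iff $\theta^*_X\cdot pa+\varepsilon_X\ge\gamma_X$ with independent thresholds $\gamma_X\sim U[0,1]$); in a *linear model*, $X=\theta^*_X\cdot pa+\varepsilon_X$ (so $X\in[0,1]$). Let $\kappa=\inf f_X'(v\cdot\theta)$ over all $X$, $v\in[0,1]^{\mathrm{Pa}(X)}$ and $\|\theta-\theta^*_X\|\le1$,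 where $f_X$ is the identity (so $\kappa=1$). An action is an intervention $do(S=s)$ with $S\subseteq\boldsymbol X\setminus\{X_1\}$, $s\in\{0,1\}^S$. The action set $\mathcal A$ contains the null intervention and all atomic interventions. Rounds are independent copies of the model, all nodes are observed after each round, and $$R(T)=\mathbb E\Big[\sum_{t=1}^T\big(\max_{do(S=s)\in\mathcal A}\mathbb E[Y\mid do(S=s)]-\mathbb E[Y\mid do(S_t=s_t)]\big)\Big].$$ **Algorithm BLM-LR-Unknown-SG**, with horizon $T$ and constants $c_0,c_1>0$ such that $N=c_0\sqrt T$ is a positive integer. 1. *Ancestor discovery.* For $i=2,\dots,n$ in order, play $N$ times $do(X_i=1)$ and then $N$ times $do(X_i=0)$; this takes $T_0=2(n-1)N$ rounds. For distinct $i,j\in\{2,\dots,n\}$ declare $X_i$ an ancestor of $X_j$ if the sum of the observed $X_j$ in the rounds with $do(X_i=1)$ minus that in the rounds with $do(X_i=0)$ exceeds $c_0c_1T^{3/10}$. Declare $X_1$ an ancestor of all other nodes and every $X_i$ an ancestor of $Y$, and take the transitive closure, which gives sets $\widehat{\mathrm{Anc}}(X)$. 2. *Linear regression with optimism.* Let $\delta=1/(n\sqrt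 T)$ and $\rho_t=\sqrt{n\log(1+tn)+2\log(1/\delta)}+\sqrt n$. For $t=T_0+1,\dots,T$ and every node $X$ let $$M_{t-1,X}=I+\sum_{T_0<s<t,\ X\notin S_s}V_{s,X}V_{s,X}^\top,\qquad b_{t-1,X}=\sum_{T_0<s<t,\ X\notin S_s}X^{(s)}V_{s,X},\qquad \hat\theta_{t-1,X}=M_{t-1,X}^{-1}b_{t-1,X},$$ where $X^{(s)}$ and $V_{s,X}$ are the values of $X$ and of $\widehat{\mathrm{Anc}}(X)$ in round $s$. Let $\mathcal C_{t,X}=\{\theta\in[0,1]^{\widehat{\mathrm{Anc}}(X)}:\|\theta-\hat\theta_{t-1,X}\|_{M_{t-1,X}}\le\rho_{t-1}\}$ (for linear models, intersected with the feasible weights, $\sum_{X'}\theta_{X'}\le1$). Play $do(S_t=s_t)$, where $(S_t,s_t,\tilde\theta_t)$ maximizes $\mathbb E_{\theta'}[Y\mid do(S=s)]$ over $do(S=s)\in\mathcal A$ and $\theta'_X\in\mathcal C_{t,X}$; this expectation is computed, without noise, in the model of the same kind on the estimated graph with weights $\theta'$ (in the binary case $X=1$ iff $\theta'_X\cdot pa\ge\gamma_X$).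 Ties are broken in any measurable way; if the estimated ancestor relation is cyclic or some $\mathcal C_{t,X}$ is empty, any action of $\mathcal A$ may be played. **Theorem.** On binary linear models and on linear models, BLM-LR-Unknown-SG has regret $R(T)=O\big(n^{5/2}\sqrt T\log T\big)$ for $T\ge 32\big(c_1/(\kappa\theta^*_{\min})\big)^5$, up to omitted terms of order $o(\sqrt T\log T)$. Precisely: there is a universal constant $C>0$, and for all $c_0,c_1>0$ there is a function $g(T)=o(\sqrt T\log T)$ that depends only on $c_0,c_1$, such that $$R(T)\le n^{5/2}\big(C\sqrt T\log T+g(T)\big)$$ for all $n\ge1$, all such models with $\theta^*_{\min}>0$, all $\mathcal A$, all $T\ge 32\big(c_1/(\kappa\theta^*_{\min})\big)^5$ with $c_0\sqrt T\in\mathbb N^+$, and every run of the algorithm as described. -/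

import Mathlib

open MeasureTheory

namespace CausalBandit

noncomputable section

/-- The nodes `X₁, …, Xₙ, Y`: the node `some i` is `X_{i+1}` (so `some 0` is the special node `X₁`)
and `none` is the target `Y`. -/
abbrev Node (n : ℕ) := Option (Fin n)

/-- An intervention `do(S = s)` with `s ∈ {0,1}^S`: `S` is the set of `i` with `a i ≠ none`. -/
abbrev Action (n : ℕ) := Fin n → Option Bool

/-- The values of all nodes in one round. -/
abbrev Obs (n : ℕ) := Node n → ℝ

/-- The two kinds of models: binary linear models, and linear models with values in `[0,1]`. -/
inductive Kind
  | binary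
  | linear

/-- The value of a node whose parents and noise give `p = θ · pa + ε`. In a binary linear model the
node is `1` with probability `p`, realized by a threshold `γ` that is uniform on `[0,1]`; in a
linear model its value is `p`. -/
def respond (k : Kind) (p γ : ℝ) : ℝ :=
  match k with
  | .binary => if γ ≤ p then 1 else 0
  | .linear => p

section Propagation

variable {n : ℕ} [NeZero n]

/-- The null intervention. -/
def nullAction (n : ℕ) : Action n := fun _ => none

/-- The atomic intervention `do(X = b)`. -/
def atomic (i : Fin n) (b : Bool) : Action n := Function.update (nullAction n) i (some b)

/-- The right-hand side of the structural equations with weights `w i X = θ_{X_i,X}` under the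
intervention `a`, where `u X = (ε_X, γ_X)`. -/
def step (k : Kind) (w : Fin n → Node n → ℝ) (a : Action n) (u : Node n → ℝ × ℝ)
    (x : Obs n) (X : Node n) : ℝ :=
  if X = some 0 then 1
  else match X.bind a with
    | some b => if b then 1 else 0
    | none => respond k (∑ i, w i X * x (some i) + (u X).1) (u X).2

/-- The values of the nodes under the intervention `a`. The graph has `n + 1` nodes, so if it is
acyclic then `n + 1` synchronous updates reach the unique solution of the structural equations, see
`step_propagate`. -/
def propagate (k : Kind) (w : Fin n → Node n → ℝ) (a : Action n) (u : Node n → ℝ × ℝ) : Obs n :=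
  (step k w a u)^[n + 1] 0

/-- A directed graph on `X₁, …, Xₙ, Y` in which `Y` has no outgoing edges, given by the relation
`e i X` that there is an edge from `X_i` to `X`, has no directed cycle. -/
def Acyclic (e : Fin n → Node n → Prop) : Prop :=
  ∀ i, ¬ Relation.TransGen (fun i j => e i (some j)) i i

/-- On an acyclic graph, `propagate` solves the structural equations. -/
theorem step_propagate (k : Kind) (w : Fin n → Node n → ℝ) (a : Action n)
    (u : Node n → ℝ × ℝ) (hw : Acyclic (fun i X => w i X ≠ 0)) :
    step k w a u (propagate k w a u) = propagate k w a u := by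
  classical
  set e : Fin n → Fin n → Prop := fun i j => w i (some j) ≠ 0 with he
  let r : Fin n → ℕ := fun j => (Finset.univ.filter (fun i => Relation.TransGen e i j)).card
  have hr : ∀ i j, e i j → r i < r j := by
    intro i j hij
    refine Finset.card_lt_card ⟨?_, ?_⟩
    · intro l hl
      simp only [Finset.mem_filter, Finset.mem_univ, true_and] at hl ⊢
      exact hl.tail hij
    · intro h
      have hi : i ∈ Finset.univ.filter (fun l => Relation.TransGen e l j) := by
        simp only [Finset.mem_filter, Finset.mem_univ, true_and]
        exact Relation.TransGen.single hij
      have := h hi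
      simp only [Finset.mem_filter, Finset.mem_univ, true_and] at this
      exact hw i this
  have hlt : ∀ j, r j < n := by
    intro j
    have : r j < (Finset.univ : Finset (Fin n)).card := by
      refine Finset.card_lt_card ⟨Finset.subset_univ _, ?_⟩
      intro h
      have := h (Finset.mem_univ j)
      simp only [Finset.mem_filter, Finset.mem_univ, true_and] at this
      exact hw j this
    simpa using this
  have congrStep : ∀ (x y : Obs n) (X : Node n),
      (∀ i, w i X ≠ 0 → x (some i) = y (some i)) → step k w a u x X = step k w a u y X := by
    intro x y X h
    have hs : ∑ i, w i X * x (some i) = ∑ i, w i X * y (some i) := by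
      refine Finset.sum_congr rfl fun i _ => ?_
      by_cases h0 : w i X = 0
      · simp [h0]
      · rw [h i h0]
    simp only [step, hs]
  have key : ∀ (m : ℕ) (j : Fin n), r j < m →
      (step k w a u)^[m + 1] 0 (some j) = (step k w a u)^[m] 0 (some j) := by
    intro m
    induction m with
    | zero => intro j hj; exact absurd hj (Nat.not_lt_zero _)
    | succ m ih =>
      intro j hj
      rw [Function.iterate_succ_apply' _ (m + 1), Function.iterate_succ_apply' _ m]
      refine congrStep _ _ _ fun i hi => ?_
      have h1 := hr i j hi
      have h2 := ih i (by omega)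
      rwa [Function.iterate_succ_apply' _ m] at h2
  funext X
  simp only [propagate]
  rw [Function.iterate_succ_apply' _ n]
  refine congrStep _ _ _ fun i _ => ?_
  have := key n i (hlt i)
  rwa [Function.iterate_succ_apply' _ n] at this

/-- The law of the noises and thresholds of one round: all of them are independent, the noise of
`X` has the law `noise X`, the thresholds are uniform on `[0,1]`. -/
def exoLaw (noise : Node n → Measure ℝ) : Measure (Node n → ℝ × ℝ) :=
  Measure.pi fun X => (noise X).prod (volume.restrict (Set.Icc (0 : ℝ) 1))

/-- The expected reward `𝔼[Y | do(S = s)]` for given weights and noise laws. -/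
def expReward (k : Kind) (w : Fin n → Node n → ℝ) (noise : Node n → Measure ℝ)
    (a : Action n) : ℝ :=
  ∫ u, propagate k w a u none ∂exoLaw noise

end Propagation

/-- The data of a Markovian binary linear model or linear model. `X₁` is constantly `1`, has no
parents, and may be a parent of every other node. A range condition bounds the noise from both
sides; in particular the noise is sub-Gaussian. -/
structure Model (n : ℕ) [NeZero n] where
  /-- `edge i X`: there is an edge from `X_i` to `X` (the target has no outgoing edges) -/
  edge : Fin n → Node n → Prop
  acyclic : Acyclic edge
  not_edge_first : ∀ i, ¬ edge i (some 0)
  /-- the weights `θ*_{X_i,X}`, with the convention that they vanish off the edges -/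
  weight : Fin n → Node n → ℝ
  weight_mem : ∀ i X, weight i X ∈ Set.Icc (0 : ℝ) 1
  weight_eq_zero : ∀ i X, ¬ edge i X → weight i X = 0
  /-- the law of `ε_X` -/
  noise : Node n → Measure ℝ
  isProbabilityMeasure_noise : ∀ X, IsProbabilityMeasure (noise X)
  noise_mean : ∀ X, X ≠ some 0 → ∫ e, e ∂noise X = 0
  /-- `θ*_X · pa + ε_X` lies in `[0,1]` for all values `pa` of the parents (where `X₁ = 1`) -/
  noise_range : ∀ X, X ≠ some 0 → ∀ᵐ e ∂noise X, ∀ v : Fin n → ℝ,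
    v 0 = 1 → (∀ i, v i = 0 ∨ v i = 1) → ∑ i, weight i X * v i + e ∈ Set.Icc (0 : ℝ) 1

attribute [instance] Model.isProbabilityMeasure_noise

section Bandit

variable {n : ℕ} [NeZero n]

instance (noise : Node n → Measure ℝ) [∀ X, IsProbabilityMeasure (noise X)] :
    IsProbabilityMeasure (exoLaw noise) := by
  have : IsProbabilityMeasure (volume.restrict (Set.Icc (0 : ℝ) 1)) := ⟨by simp⟩
  unfold exoLaw
  infer_instance

/-- `θ*_min`, the minimum weight of an edge. -/
def Model.thetaMin (M : Model n) : ℝ :=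
  sInf {r | ∃ i X, M.edge i X ∧ r = M.weight i X}

/-- `κ`, the infimum of `f_X'(v · θ)` over all nodes `X`, all `v ∈ [0,1]^{Pa(X)}` and all `θ` with
`‖θ - θ*_X‖ ≤ 1`, where `f_X` is the identity for the models considered here. -/
def Model.kappa (M : Model n) : ℝ :=
  sInf {r | ∃ (X : Node n) (v θ : Fin n → ℝ), (∀ i, v i ∈ Set.Icc (0 : ℝ) 1) ∧
    (∀ i, ¬ M.edge i X → θ i = 0) ∧ √(∑ i, (θ i - M.weight i X) ^ 2) ≤ 1 ∧
    r = deriv (fun z : ℝ => z) (∑ i, v i * θ i)}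

/-- Admissible action sets: `X₁` is never intervened on, and the null intervention and all atomic
interventions are available. -/
structure IsActionSet (A : Set (Action n)) : Prop where
  first : ∀ a ∈ A, a 0 = none
  null_mem : nullAction n ∈ A
  atomic_mem : ∀ i, i ≠ 0 → ∀ b, atomic i b ∈ A

/-- A policy selects the intervention in round `t` (rounds are numbered from `0`) from the
observations of the previous `t` rounds. -/
abbrev Policy (n : ℕ) := (t : ℕ) → (Fin t → Obs n) → Action n

/-- The observations of the first `t` rounds when `π` is run and `u s` collects the noises and
thresholds of round `s`. -/
def history (k : Kind) (M : Model n) (π : Policy n) (u : ℕ → Node n → ℝ × ℝ) :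
    (t : ℕ) → Fin t → Obs n
  | 0 => Fin.elim0
  | t + 1 => Fin.snoc (α := fun _ => Obs n) (history k M π u t)
      (propagate k M.weight (π t (history k M π u t)) (u t))

/-- The expected reward of an intervention in the true model. -/
def Model.reward (M : Model n) (k : Kind) (a : Action n) : ℝ :=
  expReward k M.weight M.noise a

/-- `∑_t (𝔼[Y | do(S* = s*)] - 𝔼[Y | do(S_t = s_t)])` over the first `T` rounds. -/
def pseudoRegret (k : Kind) (M : Model n) (A : Set (Action n)) (π : Policy n) (T : ℕ)
    (u : ℕ → Node n → ℝ × ℝ) : ℝ :=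
  ∑ t ∈ Finset.range T, (sSup (M.reward k '' A) - M.reward k (π t (history k M π u t)))

/-- The law of the noises and thresholds of all rounds, which are independent copies. -/
def Model.law (M : Model n) : Measure (ℕ → Node n → ℝ × ℝ) :=
  Measure.infinitePi fun _ => exoLaw M.noise

/-- The regret `R^π(T)`. -/
def regret (k : Kind) (M : Model n) (A : Set (Action n)) (π : Policy n) (T : ℕ) : ℝ :=
  ∫ u, pseudoRegret k M A π T u ∂M.law

end Bandit

section Algorithm

variable {n : ℕ} [NeZero n]

/-- The test of the ancestor discovery: `N` is the number `c₀√T` of repetitions, `x s` is the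
observation in round `s`. `X_i` was set to `1` in the rounds `2(i-1)N + k` and to `0` in the rounds
`(2(i-1)+1)N + k`, for `k < N` (here `i = 1, …, n-1` since `i = 0` stands for `X₁`). -/
def Discovered (c₀ c₁ : ℝ) (T N : ℕ) (x : ℕ → Obs n) (i j : Fin n) : Prop :=
  i ≠ 0 ∧ j ≠ 0 ∧ i ≠ j ∧
    c₀ * c₁ * (T : ℝ) ^ (3 / 10 : ℝ) <
      ∑ k ∈ Finset.range N,
        (x (2 * (i.val - 1) * N + k) (some j) - x ((2 * (i.val - 1) + 1) * N + k) (some j))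

/-- `AncHat … i X`: the node `X_i` is in the estimated set of ancestors of `X`. Every `X_i` is one
for `Y`, and `X₁` is one for all other nodes; the other pairs are obtained from the test by
transitive closure. -/
def AncHat (c₀ c₁ : ℝ) (T N : ℕ) (x : ℕ → Obs n) (i : Fin n) : Node n → Prop
  | none => True
  | some j => Relation.TransGen
      (fun i j => j ≠ 0 ∧ (i = 0 ∨ Discovered c₀ c₁ T N x i j)) i j

/-- The vector `V_{s,X}` of the values in round `s` of the nodes in `anc`. Vectors indexed by the
estimated ancestors of `X` are extended by `0` to all of `X₁, …, Xₙ`. -/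
def regressor (anc : Fin n → Prop) (x : ℕ → Obs n) (s : ℕ) : Fin n → ℝ :=
  Set.indicator {i | anc i} fun i => x s (some i)

/-- `M_{t,X}`, after `t` rounds, where `a s` is the intervention in round `s`. The rounds in which
`X` was intervened on are not used. -/
def gram (anc : Fin n → Prop) (T₀ : ℕ) (x : ℕ → Obs n) (a : ℕ → Action n) (X : Node n) (t : ℕ) :
    Matrix (Fin n) (Fin n) ℝ :=
  1 + ∑ s ∈ (Finset.Ico T₀ t).filter (fun s => X.bind (a s) = none),
    Matrix.vecMulVec (regressor anc x s) (regressor anc x s)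

/-- `b_{t,X}`. -/
def moment (anc : Fin n → Prop) (T₀ : ℕ) (x : ℕ → Obs n) (a : ℕ → Action n) (X : Node n) (t : ℕ) :
    Fin n → ℝ :=
  ∑ s ∈ (Finset.Ico T₀ t).filter (fun s => X.bind (a s) = none), x s X • regressor anc x s

/-- The estimate `M_{t,X}⁻¹ b_{t,X}` of the weights. -/
def thetaHat (anc : Fin n → Prop) (T₀ : ℕ) (x : ℕ → Obs n) (a : ℕ → Action n) (X : Node n)
    (t : ℕ) : Fin n → ℝ :=
  Matrix.mulVec (gram anc T₀ x a X t)⁻¹ (moment anc T₀ x a X t)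

/-- The radius `ρ_t`, with `δ = 1 / (n √T)`. -/
def radius (n T t : ℕ) : ℝ :=
  √(n * Real.log (1 + t * n) + 2 * Real.log (1 / (1 / (n * √(T : ℝ))))) + √(n : ℝ)

/-- The candidate weights of the round after the first `t` rounds: for every `X`, the weights
`θ X` are in the confidence ellipsoid `{θ ∈ [0,1]^{anc X} : ‖θ - θ̂_{t,X}‖_{M_{t,X}} ≤ ρ_t}`. For
linear models they are feasible, that is, the weights of some linear model with values in `[0,1]`;
for binary models every `θ` in the ellipsoid has an expected reward, through the thresholds. -/
def IsCandidate (k : Kind) (anc : Fin n → Node n → Prop) (T₀ T : ℕ) (x : ℕ → Obs n)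
    (a : ℕ → Action n) (t : ℕ) (w : Fin n → Node n → ℝ) : Prop :=
  ∀ X : Node n,
    (∀ i, w i X ∈ Set.Icc (0 : ℝ) 1) ∧ (∀ i, ¬ anc i X → w i X = 0) ∧
    (k = Kind.linear → ∑ i, w i X ≤ 1) ∧
    √((fun i => w i X - thetaHat (fun i => anc i X) T₀ x a X t i) ⬝ᵥ
        Matrix.mulVec (gram (fun i => anc i X) T₀ x a X t)
          (fun i => w i X - thetaHat (fun i => anc i X) T₀ x a X t i)) ≤ radius n T t

/-- `b` is the intervention of a maximizer of `𝔼[Y | do(S = s)]` over all interventions in `A` and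
all candidate weights (zero-mean noise does not affect this expectation, so it is left out). -/
def IsOptimistic (k : Kind) (A : Set (Action n)) (cand : (Fin n → Node n → ℝ) → Prop)
    (b : Action n) : Prop :=
  b ∈ A ∧ ∃ w, cand w ∧ ∀ b₁ ∈ A, ∀ w₁, cand w₁ →
    expReward k w₁ (fun _ => Measure.dirac 0) b₁ ≤ expReward k w (fun _ => Measure.dirac 0) b

/-- A sequence of observations that starts with the given ones. -/
def extend {t : ℕ} (h : Fin t → Obs n) (s : ℕ) : Obs n :=
  if hs : s < t then h ⟨s, hs⟩ else 0

/-- The interventions that `π` selects along a sequence of observations. -/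
def played (π : Policy n) (x : ℕ → Obs n) (s : ℕ) : Action n :=
  π s fun r => x r

/-- `π` is a run of BLM-LR-Unknown-SG with horizon `T`, constants `c₀, c₁`, `N = c₀√T` and action
set `A`. Ties in the maximization are broken in any measurable way, and if the estimated ancestor
relation is cyclic or some confidence ellipsoid is empty, so that there is nothing to maximize, then
any intervention in `A` may be chosen. -/
structure IsBLMLRUnknownSG (k : Kind) (c₀ c₁ : ℝ) (T N : ℕ) (A : Set (Action n))
    (π : Policy n) : Prop where
  mem : ∀ t h, π t h ∈ A
  measurable : ∀ t b, MeasurableSet {h | π t h = b}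
  discovery_one : ∀ i : Fin n, i ≠ 0 → ∀ l < N, ∀ h,
    π (2 * (i.val - 1) * N + l) h = atomic i true
  discovery_zero : ∀ i : Fin n, i ≠ 0 → ∀ l < N, ∀ h,
    π ((2 * (i.val - 1) + 1) * N + l) h = atomic i false
  optimistic : ∀ t, 2 * (n - 1) * N ≤ t → t < T → ∀ h : Fin t → Obs n,
    Acyclic (AncHat c₀ c₁ T N (extend h)) →
    (∃ w, IsCandidate k (AncHat c₀ c₁ T N (extend h)) (2 * (n - 1) * N) T (extend h)
      (played π (extend h)) t w) →
    IsOptimistic k A (IsCandidate k (AncHat c₀ c₁ T N (extend h)) (2 * (n - 1) * N) T (extend h)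
      (played π (extend h)) t) (π t h)

end Algorithm

end

end CausalBandit

/-! The regret of each round lies in `[0,1]`. Discovery therefore costs at most `2nN = 2n c₀√T`, and
a later round costs at most the probability that the true weights fail to be candidates, plus a
bound that holds when they are candidates. A failure costs only its own round, so no union over
rounds is needed. Conditional expectations are replaced throughout by resampling one coordinate of a
product measure (`integral_update`, `lintegral_update`).

Discovery. Averaging out the noise of a node shows that in both kinds of model the means under an
intervention solve a linear system (`Model.mean_of_bind_eq_none`). The weights are nonnegative, so
switching a parent from `0` to `1` raises the mean of its child by at least `θ*_min`, while the
means of non-descendants do not move. The lower bound on `T` makes the expected statistic of an edge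
at least twice the threshold, and Hoeffding's inequality bounds each error by `exp(-c₀c₁²T^{1/10})`.
Indirect descendants may be declared or missed: by `goodAnc_of_tests` it suffices that no edge
leaving a node other than `X₁` is missed and no non-ancestor is declared.

Confidence. If the estimated ancestors are consistent with the graph, the regressors of `X` do not
depend on the noise of `X`. With the score `S` and the Gram matrix `G`, `exp(2 S·G⁻¹S - 2 log det
G)` is then a supermartingale started at `1` (`lintegral_potential_update_le`,
`lintegral_confidencePotential_le_one`). Markov's inequality and `log det G ≤ n log(1 + tn)` put the
true weights in the ellipsoid.

Optimism. When the true weights are candidates, the optimistic value dominates the optimum, so the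
regret is at most the difference of the rewards of the played action under the chosen and the true
weights. `abs_expReward_sub_reward_le` bounds it by exchanging the structural equations one node at
a time along the graph: `Y` is affine in the value of the exchanged node, with a slope in `[-1,1]`
that does not depend on the noise of this node, so one exchange costs at most the expected gap `min
1 |(w - θ*)·x|`. Here `x` follows the true model, like the observations, so Cauchy-Schwarz bounds
the gap by the width of the ellipsoid at the regressor of the same round.

Summation. By the elliptical potential lemma `sum_width_le`, the widths of one node add up to order
`n√T log(Tn)`. The `n` nodes other than `X₁` give `n²√T log(Tn)`, and `log n ≤ 2√n` turns this into
`n^{5/2}√T log T` up to lower order terms. -/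

namespace CausalBandit

noncomputable section

/-! ### Acyclic graphs and the unique solution of structural equations -/

section Graph

variable {n : ℕ}

/-- Nodes of an acyclic graph can be ranked so that edges increase the rank. -/
theorem Acyclic.exists_rank {e : Fin n → Node n → Prop} (he : Acyclic e) :
    ∃ r : Node n → ℕ, (∀ i X, e i X → r (some i) < r X) ∧ ∀ X, r X ≤ n := by
  classical
  set f : Fin n → Fin n → Prop := fun i j => e i (some j) with hf
  let r : Fin n → ℕ := fun j => (Finset.univ.filter (fun i => Relation.TransGen f i j)).card
  have hr : ∀ i j, f i j → r i < r j := by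
    intro i j hij
    refine Finset.card_lt_card ⟨?_, ?_⟩
    · intro l hl
      simp only [Finset.mem_filter, Finset.mem_univ, true_and] at hl ⊢
      exact hl.tail hij
    · intro h
      have := h (show i ∈ _ by simpa using Relation.TransGen.single hij)
      simp only [Finset.mem_filter, Finset.mem_univ, true_and] at this
      exact he i this
  have hlt : ∀ j, r j < n := by
    intro j
    have : r j < (Finset.univ : Finset (Fin n)).card := by
      refine Finset.card_lt_card ⟨Finset.subset_univ _, ?_⟩
      intro h
      have := h (Finset.mem_univ j)
      simp only [Finset.mem_filter, Finset.mem_univ, true_and] at this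
      exact he j this
    simpa using this
  -- The rank counts proper ancestors, hence is below `n` on every `X_i`; the target, which has no
  -- children, gets `n`.
  refine ⟨fun X => X.elim n r, ?_, ?_⟩
  · rintro i (_ | j) h
    · exact hlt i
    · exact hr i j h
  · rintro (_ | j)
    · exact le_rfl
    · exact (hlt j).le

theorem Acyclic.mono {e e' : Fin n → Node n → Prop} (he : Acyclic e)
    (h : ∀ i X, e' i X → e i X) : Acyclic e' :=
  fun i hi => he i (Relation.TransGen.mono (fun a b hab => h a (some b) hab) _ _ hi)

/-- Induction along an acyclic graph, from the parents to their children. -/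
theorem Acyclic.induction {e : Fin n → Node n → Prop} (he : Acyclic e) {p : Node n → Prop}
    (h : ∀ X, (∀ i, e i X → p (some i)) → p X) (X : Node n) : p X := by
  obtain ⟨r, hr, -⟩ := he.exists_rank
  induction hX : r X using Nat.strong_induction_on generalizing X with
  | _ m ih => exact h X fun i hi => ih _ (hX ▸ hr i X hi) _ rfl

/-- Solutions of two systems of structural equations agree on a set of nodes that contains the
parents of its members if the equations agree there. -/
theorem Acyclic.solution_congr {e : Fin n → Node n → Prop} (he : Acyclic e) {D : Set (Node n)}
    (hD : ∀ X ∈ D, ∀ i, e i X → some i ∈ D) {F F' : Obs n → Obs n}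
    (hF : ∀ X ∈ D, ∀ x y : Obs n, (∀ i, e i X → x (some i) = y (some i)) → F x X = F' y X)
    {x y : Obs n} (hx : F x = x) (hy : F' y = y) : ∀ X ∈ D, x X = y X := by
  refine he.induction fun X ih hX => ?_
  rw [← hx, ← hy]
  exact hF X hX x y fun i hi => ih i hi (hD X hX i hi)

/-- On an acyclic graph, `n + 1` synchronous updates solve the structural equations. -/
theorem Acyclic.iterate_solution {e : Fin n → Node n → Prop} (he : Acyclic e)
    {F : Obs n → Obs n}
    (hF : ∀ X, ∀ x y : Obs n, (∀ i, e i X → x (some i) = y (some i)) → F x X = F y X) :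
    F (F^[n + 1] 0) = F^[n + 1] 0 := by
  obtain ⟨r, hr, hrn⟩ := he.exists_rank
  -- A node of rank `r` is stable from update `r + 1` on; ranks are at most `n`, so `n + 1` updates
  -- suffice.
  have key : ∀ (m : ℕ) (X : Node n), r X < m → F^[m + 1] 0 X = F^[m] 0 X := by
    intro m
    induction m with
    | zero => intro j hj; exact absurd hj (Nat.not_lt_zero _)
    | succ m ih =>
      intro X hX
      rw [Function.iterate_succ_apply' _ (m + 1), Function.iterate_succ_apply' _ m]
      refine hF X _ _ fun i hi => ?_
      have h2 := ih (some i) (by have := hr i X hi; omega)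
      rwa [Function.iterate_succ_apply' _ m] at h2
  funext X
  rw [← Function.iterate_succ_apply' F]
  exact key (n + 1) X (by have := hrn X; omega)

variable [NeZero n]

theorem step_congr {k : Kind} {w w' : Fin n → Node n → ℝ} {a : Action n} {u u' : Node n → ℝ × ℝ}
    {x y : Obs n} {X : Node n} (hw : ∀ i, w i X = w' i X) (hu : u X = u' X)
    (hxy : ∀ i, w i X ≠ 0 → x (some i) = y (some i)) :
    step k w a u x X = step k w' a u' y X := by
  have hs : ∑ i, w i X * x (some i) = ∑ i, w' i X * y (some i) := by
    refine Finset.sum_congr rfl fun i _ => ?_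
    by_cases h0 : w i X = 0
    · simp [h0, ← hw]
    · rw [hxy i h0, hw]
  simp only [step, hs, hu]

theorem step_first (k : Kind) (w : Fin n → Node n → ℝ) (a : Action n) (u : Node n → ℝ × ℝ)
    (x : Obs n) : step k w a u x (some 0) = 1 := by
  simp [step]

theorem step_of_bind_eq_some {k : Kind} {w : Fin n → Node n → ℝ} {a : Action n}
    {u : Node n → ℝ × ℝ} {x : Obs n} {X : Node n} {b : Bool} (hX : X ≠ some 0)
    (hb : X.bind a = some b) : step k w a u x X = if b then 1 else 0 := by
  simp [step, hX, hb]

theorem step_of_bind_eq_none {k : Kind} {w : Fin n → Node n → ℝ} {a : Action n}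
    {u : Node n → ℝ × ℝ} {x : Obs n} {X : Node n} (hX : X ≠ some 0) (hb : X.bind a = none) :
    step k w a u x X = respond k (∑ i, w i X * x (some i) + (u X).1) (u X).2 := by
  simp [step, hX, hb]

/-- Values agree on a set of nodes that contains the parents of its members if weights and noises
agree there. -/
theorem propagate_congr {k : Kind} {e : Fin n → Node n → Prop} (he : Acyclic e)
    {w w' : Fin n → Node n → ℝ} (hw : ∀ i X, ¬ e i X → w i X = 0)
    (hw' : ∀ i X, ¬ e i X → w' i X = 0) {a : Action n}
    {u u' : Node n → ℝ × ℝ} {D : Set (Node n)} (hD : ∀ X ∈ D, ∀ i, e i X → some i ∈ D)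
    (hww : ∀ X ∈ D, ∀ i, w i X = w' i X) (hu : ∀ X ∈ D, u X = u' X) :
    ∀ X ∈ D, propagate k w a u X = propagate k w' a u' X := by
  have hs : ∀ v : Fin n → Node n → ℝ, (∀ i X, ¬ e i X → v i X = 0) →
      ∀ i X, v i X ≠ 0 → e i X := fun v hv i X h => by_contra fun h' => h (hv i X h')
  refine he.solution_congr hD (F := step k w a u) (F' := step k w' a u') ?_
    (step_propagate k w a u (he.mono (hs w hw))) (step_propagate k w' a u' (he.mono (hs w' hw')))
  intro X hX x y hxy
  exact step_congr (hww X hX) (hu X hX) fun i hi => hxy i (hs w hw i X hi)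

theorem propagate_first (k : Kind) (w : Fin n → Node n → ℝ) (a : Action n)
    (u : Node n → ℝ × ℝ) : propagate k w a u (some 0) = 1 := by
  rw [propagate, Function.iterate_succ_apply']
  exact step_first ..

theorem measurable_respond (k : Kind) : Measurable fun p : ℝ × ℝ => respond k p.1 p.2 := by
  cases k
  · exact Measurable.ite (measurableSet_le measurable_snd measurable_fst) measurable_const
      measurable_const
  · exact measurable_fst

theorem measurable_step (k : Kind) (w : Fin n → Node n → ℝ) (a : Action n) :
    Measurable fun p : (Node n → ℝ × ℝ) × Obs n => step k w a p.1 p.2 := by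
  refine measurable_pi_iff.2 fun X => ?_
  by_cases hX : X = some 0
  · simp only [hX, step_first]
    exact measurable_const
  rcases hb : X.bind a with _ | b
  · simp only [step_of_bind_eq_none hX hb]
    exact (measurable_respond k).comp (by fun_prop : Measurable fun p : (Node n → ℝ × ℝ) × Obs n =>
      (∑ i, w i X * p.2 (some i) + (p.1 X).1, (p.1 X).2))
  · simp only [step_of_bind_eq_some hX hb]
    exact measurable_const

theorem measurable_propagate (k : Kind) (w : Fin n → Node n → ℝ) (a : Action n) :
    Measurable fun u : Node n → ℝ × ℝ => propagate k w a u := by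
  have : ∀ m, Measurable fun u : Node n → ℝ × ℝ => (step k w a u)^[m] 0 := by
    intro m
    induction m with
    | zero => exact measurable_const
    | succ m ih =>
      simp only [Function.iterate_succ_apply']
      exact (measurable_step k w a).comp (measurable_id.prodMk ih)
  exact this (n + 1)

end Graph

/-! ### Resampling one coordinate of a product measure -/

section Resampling

open Measure

variable {ι : Type*} [DecidableEq ι] {E : ι → Type*} [∀ i, MeasurableSpace (E i)]
  (μ : ∀ i, Measure (E i)) [∀ i, IsProbabilityMeasure (μ i)]

theorem measurable_update_pair (t : ι) :
    Measurable fun p : (∀ i, E i) × E t => Function.update p.1 t p.2 := by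
  refine measurable_pi_iff.2 fun i => ?_
  by_cases h : i = t
  · subst h
    simpa using measurable_snd
  · simp only [Function.update_of_ne h]
    fun_prop

/-- Resampling one coordinate independently preserves a product measure. -/
theorem measurePreserving_update (t : ι) :
    MeasurePreserving (fun p : (∀ i, E i) × E t => Function.update p.1 t p.2)
      ((infinitePi μ).prod (μ t)) (infinitePi μ) := by
  refine ⟨measurable_update_pair t, eq_infinitePi μ fun s A hA => ?_⟩
  rw [Measure.map_apply (measurable_update_pair t)
    (MeasurableSet.pi s.countable_toSet fun i _ => hA i)]
  -- The preimage of a box is a box again: its constraint at `t` moves from the old sample to the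
  -- fresh coordinate.
  have : (fun p : (∀ i, E i) × E t => Function.update p.1 t p.2) ⁻¹' (Set.pi s A) =
      (Set.pi (s.erase t : Finset ι) A) ×ˢ (if t ∈ s then A t else Set.univ) := by
    ext ⟨x, y⟩
    simp only [Set.mem_preimage, Set.mem_pi, Finset.mem_coe, Set.mem_prod, Finset.mem_erase]
    constructor
    · intro h
      refine ⟨fun i hi => by simpa [Function.update_of_ne hi.1] using h i hi.2, ?_⟩
      split_ifs with hts
      · simpa using h t hts
      · trivial
    · rintro ⟨h1, h2⟩ i hi
      by_cases hit : i = t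
      · subst hit
        simpa [hi] using h2
      · simpa [Function.update_of_ne hit] using h1 i ⟨hit, hi⟩
  rw [this, Measure.prod_prod, infinitePi_pi μ fun i _ => hA i]
  split_ifs with hts
  · rw [Finset.prod_erase_mul _ _ hts]
  · simp [Finset.erase_eq_of_notMem hts]

/-- Takes the place of the tower property: the inner integral is the conditional expectation given
all other coordinates. The coordinate is a node within one round, or a whole round. -/
theorem lintegral_update {f : (∀ i, E i) → ENNReal} (hf : Measurable f) (t : ι) :
    ∫⁻ u, f u ∂infinitePi μ =
      ∫⁻ u, ∫⁻ z, f (Function.update u t z) ∂μ t ∂infinitePi μ := by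
  rw [← (measurePreserving_update μ t).lintegral_comp hf]
  exact lintegral_prod _ (hf.comp (measurable_update_pair t)).aemeasurable

theorem integral_update {f : (∀ i, E i) → ℝ} (hf : Integrable f (infinitePi μ)) (t : ι) :
    ∫ u, f u ∂infinitePi μ =
      ∫ u, ∫ z, f (Function.update u t z) ∂μ t ∂infinitePi μ := by
  have h := measurePreserving_update μ t
  have h1 := integral_map h.aemeasurable (f := f) (by rw [h.map_eq]; exact hf.aestronglyMeasurable)
  rw [h.map_eq] at h1
  rw [h1]
  exact integral_prod (fun p => f (Function.update p.1 t p.2)) (h.integrable_comp_of_integrable hf)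

theorem integrable_integral_update {f : (∀ i, E i) → ℝ} (hf : Integrable f (infinitePi μ)) (t : ι) :
    Integrable (fun u => ∫ z, f (Function.update u t z) ∂μ t) (infinitePi μ) :=
  ((measurePreserving_update μ t).integrable_comp_of_integrable hf).integral_prod_left

end Resampling

/-! ### One round: the range of the values and the mean of a node given its parents -/

section OneRound

variable {n : ℕ} [NeZero n]

/-- The law of the noise and the threshold of one node. -/
def Model.nodeLaw (M : Model n) (X : Node n) : Measure (ℝ × ℝ) :=
  (M.noise X).prod (volume.restrict (Set.Icc (0 : ℝ) 1))

instance isProbabilityMeasure_unif :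
    IsProbabilityMeasure ((volume : Measure ℝ).restrict (Set.Icc (0 : ℝ) 1)) := ⟨by simp⟩

instance (M : Model n) (X : Node n) : IsProbabilityMeasure (M.nodeLaw X) := by
  unfold Model.nodeLaw
  infer_instance

theorem Model.exoLaw_eq (M : Model n) : exoLaw M.noise = Measure.infinitePi M.nodeLaw := by
  rw [Measure.infinitePi_eq_pi]
  rfl

theorem Model.weight_first (M : Model n) (i : Fin n) : M.weight i (some 0) = 0 :=
  M.weight_eq_zero i _ (M.not_edge_first i)

/-- The noise `ε` keeps a node with the weights `w` in `[0,1]` if its parents are in `[0,1]`. -/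
def InRange (w : Fin n → ℝ) (ε : ℝ) : Prop :=
  ∀ v : Fin n → ℝ, v 0 = 1 → (∀ i, v i ∈ Set.Icc (0 : ℝ) 1) → ∑ i, w i * v i + ε ∈ Set.Icc (0 : ℝ) 1

/-- With nonnegative weights the extremes over the cube with `v 0 = 1` are attained at `(1,0,…,0)`
and `(1,…,1)`. So a range condition on binary parents extends to the `[0,1]`-valued parents of
linear models. -/
theorem inRange_of_bounds {w : Fin n → ℝ} (hw : ∀ i, 0 ≤ w i) {ε : ℝ} (h0 : 0 ≤ w 0 + ε)
    (h1 : ∑ i, w i + ε ≤ 1) : InRange w ε := by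
  intro v hv0 hv
  have h2 : w 0 ≤ ∑ i, w i * v i := by
    have := Finset.single_le_sum (f := fun i => w i * v i)
      (fun i _ => mul_nonneg (hw i) (hv i).1) (Finset.mem_univ 0)
    simpa [hv0] using this
  have h3 : ∑ i, w i * v i ≤ ∑ i, w i :=
    Finset.sum_le_sum fun i _ => mul_le_of_le_one_right (hw i) (hv i).2
  exact ⟨by linarith, by linarith⟩

theorem Model.ae_noise_bounds (M : Model n) {X : Node n} (hX : X ≠ some 0) :
    ∀ᵐ ε ∂M.noise X, 0 ≤ M.weight 0 X + ε ∧ ∑ i, M.weight i X + ε ≤ 1 := by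
  filter_upwards [M.noise_range X hX] with ε h
  refine ⟨?_, ?_⟩
  · have := (h (Pi.single 0 1) (by simp) (fun i => by
      by_cases hi : i = 0
      · subst hi; simp
      · simp [hi])).1
    simpa [Pi.single_apply] using this
  · have := (h (fun _ => 1) rfl (fun _ => Or.inr rfl)).2
    simpa using this

theorem Model.ae_inRange (M : Model n) {X : Node n} (hX : X ≠ some 0) :
    ∀ᵐ ε ∂M.noise X, InRange (fun i => M.weight i X) ε := by
  filter_upwards [M.ae_noise_bounds hX] with ε h
  exact inRange_of_bounds (fun i => (M.weight_mem i X).1) h.1 h.2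

theorem Model.integrable_noise (M : Model n) {X : Node n} (hX : X ≠ some 0) :
    Integrable (fun ε : ℝ => ε) (M.noise X) := by
  refine Integrable.of_mem_Icc (-M.weight 0 X) (1 - ∑ i, M.weight i X) measurable_id.aemeasurable ?_
  filter_upwards [M.ae_noise_bounds hX] with ε h
  exact ⟨by linarith [h.1], by linarith [h.2]⟩

/-- Integrate the almost sure bound for all parents equal to `1`; the noise has mean zero. In
particular the true weights meet the feasibility condition of linear models. -/
theorem Model.sum_weight_le_one (M : Model n) (X : Node n) : ∑ i, M.weight i X ≤ 1 := by
  by_cases hX : X = some 0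
  · subst hX
    simp [M.weight_first]
  · have h : ∫ ε, (∑ i, M.weight i X + ε) ∂M.noise X ≤ ∫ _, (1 : ℝ) ∂M.noise X := by
      refine integral_mono_ae ((integrable_const _).add (M.integrable_noise hX))
        (integrable_const _) ?_
      filter_upwards [M.ae_noise_bounds hX] with ε h using h.2
    rw [integral_add (integrable_const _) (M.integrable_noise hX), M.noise_mean X hX] at h
    simpa using h

theorem Model.sum_weight_mul_mem (M : Model n) (X : Node n) {v : Fin n → ℝ}
    (hv : ∀ i, v i ∈ Set.Icc (0 : ℝ) 1) : ∑ i, M.weight i X * v i ∈ Set.Icc (0 : ℝ) 1 := by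
  refine ⟨Finset.sum_nonneg fun i _ => mul_nonneg (M.weight_mem i X).1 (hv i).1, ?_⟩
  refine le_trans (Finset.sum_le_sum fun i _ => ?_) (M.sum_weight_le_one X)
  exact mul_le_of_le_one_right (M.weight_mem i X).1 (hv i).2

theorem ae_fst_prod {α β : Type*} [MeasurableSpace α] [MeasurableSpace β] {μ : Measure α}
    {ν : Measure β} [SFinite ν] {p : α → Prop} (h : ∀ᵐ a ∂μ, p a) :
    ∀ᵐ z ∂μ.prod ν, p z.1 :=
  Measure.quasiMeasurePreserving_fst.ae h

/-- Every node that is not intervened on stays in `[0,1]` if its parents do. -/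
def Model.NoiseOk (M : Model n) (u : Node n → ℝ × ℝ) : Prop :=
  ∀ X, X ≠ some 0 → InRange (fun i => M.weight i X) (u X).1

theorem Model.ae_node_inRange (M : Model n) {X : Node n} (hX : X ≠ some 0) :
    ∀ᵐ z ∂M.nodeLaw X, InRange (fun i => M.weight i X) z.1 :=
  ae_fst_prod (M.ae_inRange hX)

theorem Model.ae_noiseOk (M : Model n) : ∀ᵐ u ∂exoLaw M.noise, M.NoiseOk u := by
  rw [M.exoLaw_eq]
  refine ae_all_iff.2 fun X => ?_
  by_cases hX : X = some 0
  · simp [hX]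
  · filter_upwards [(measurePreserving_eval_infinitePi M.nodeLaw X).quasiMeasurePreserving.ae
      (M.ae_node_inRange hX)] with u hu _ using hu

theorem respond_mem_Icc {k : Kind} {p γ : ℝ} (h : k = Kind.linear → p ∈ Set.Icc (0 : ℝ) 1) :
    respond k p γ ∈ Set.Icc (0 : ℝ) 1 := by
  cases k
  · simp only [respond]
    split_ifs <;> simp
  · exact h rfl

/-- The values are in `[0,1]`; for a binary model without any further condition. -/
theorem propagate_mem_Icc {k : Kind} {w : Fin n → Node n → ℝ}
    (hw : Acyclic fun i X => w i X ≠ 0) {a : Action n} {u : Node n → ℝ × ℝ}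
    (h : k = Kind.linear → ∀ X, X ≠ some 0 → InRange (fun i => w i X) (u X).1) (X : Node n) :
    propagate k w a u X ∈ Set.Icc (0 : ℝ) 1 := by
  classical
  set x := propagate k w a u with hx
  have hfix : step k w a u x = x := step_propagate k w a u hw
  refine hw.induction (p := fun X => x X ∈ Set.Icc (0 : ℝ) 1) (fun X ih => ?_) X
  by_cases hX : X = some 0
  · rw [hX, hx, propagate_first]
    simp
  rw [← hfix]
  rcases hb : X.bind a with _ | b
  · rw [step_of_bind_eq_none hX hb]
    refine respond_mem_Icc fun hk => ?_
    -- `InRange` speaks of vectors that lie in the cube in every coordinate, but the induction only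
    -- controls parents. Non-parents carry weight zero and may be set to `0`.
    have hsum : ∑ i, w i X * x (some i) =
        ∑ i, w i X * (if i = 0 then 1 else if w i X = 0 then 0 else x (some i)) := by
      refine Finset.sum_congr rfl fun i _ => ?_
      split_ifs with h1 h2
      · rw [h1, hx, propagate_first]
      · simp [h2]
      · rfl
    rw [hsum]
    refine h hk X hX _ (by simp) fun i => ?_
    split_ifs with h1 h2
    · simp
    · simp
    · exact ih i h2
  · rw [step_of_bind_eq_some hX hb]
    split_ifs <;> simp

theorem Model.weight_acyclic (M : Model n) : Acyclic fun i X => M.weight i X ≠ 0 :=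
  M.acyclic.mono fun i X h => by_contra fun h' => h (M.weight_eq_zero i X h')

theorem Model.step_propagate (M : Model n) (k : Kind) (a : Action n) (u : Node n → ℝ × ℝ) :
    step k M.weight a u (propagate k M.weight a u) = propagate k M.weight a u :=
  CausalBandit.step_propagate k M.weight a u M.weight_acyclic

theorem Model.propagate_mem_Icc (M : Model n) {k : Kind} {a : Action n} {u : Node n → ℝ × ℝ}
    (h : M.NoiseOk u) (X : Node n) : propagate k M.weight a u X ∈ Set.Icc (0 : ℝ) 1 :=
  CausalBandit.propagate_mem_Icc M.weight_acyclic (fun _ X hX => h X hX) X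

theorem integral_threshold {p : ℝ} (hp : 0 ≤ p) :
    ∫ γ, respond Kind.binary p γ ∂(volume.restrict (Set.Icc (0 : ℝ) 1)) = min 1 p := by
  have : (fun γ => respond Kind.binary p γ) = (Set.Iic p).indicator 1 := by
    funext γ
    simp [respond, Set.indicator_apply]
  rw [this, integral_indicator_one measurableSet_Iic, measureReal_restrict_apply measurableSet_Iic,
    Set.inter_comm, show Set.Icc (0 : ℝ) 1 ∩ Set.Iic p = Set.Icc 0 (min 1 p) by
      ext; simp [and_assoc]]
  simp [hp]

/-- Integrating the threshold first returns `c + ε` unclipped, because it lies in `[0,1]`; then the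
zero-mean noise drops out. -/
theorem integral_respond_of_noise {k : Kind} {ν : Measure ℝ} [IsProbabilityMeasure ν] {c : ℝ}
    (hc : ∀ᵐ ε ∂ν, c + ε ∈ Set.Icc (0 : ℝ) 1) (hi : Integrable (fun ε : ℝ => ε) ν)
    (h0 : ∫ ε, ε ∂ν = 0) :
    ∫ z, respond k (c + z.1) z.2 ∂ν.prod (volume.restrict (Set.Icc (0 : ℝ) 1)) = c := by
  have hm : Measurable fun z : ℝ × ℝ => respond k (c + z.1) z.2 :=
    (measurable_respond k).comp (by fun_prop : Measurable fun z : ℝ × ℝ => (c + z.1, z.2))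
  have hint : Integrable (fun z : ℝ × ℝ => respond k (c + z.1) z.2)
      (ν.prod (volume.restrict (Set.Icc (0 : ℝ) 1))) := by
    refine Integrable.of_mem_Icc 0 1 hm.aemeasurable ?_
    filter_upwards [ae_fst_prod hc] with z hz using respond_mem_Icc fun _ => hz
  rw [integral_prod _ hint]
  have : ∀ᵐ ε ∂ν, ∫ γ, respond k (c + ε) γ ∂(volume.restrict (Set.Icc (0 : ℝ) 1)) = c + ε := by
    filter_upwards [hc] with ε hε
    cases k
    · rw [integral_threshold hε.1, min_eq_right hε.2]
    · simp [respond]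
  rw [integral_congr_ae this, integral_add (integrable_const _) hi, h0]
  simp

/-- The clipping is needed because candidate weights of a binary model may sum to more than `1`. -/
theorem integral_respond_noiseless {k : Kind} {ν : Measure ℝ} [IsProbabilityMeasure ν] {p : ℝ}
    (hp : 0 ≤ p) (hk : k = Kind.linear → p ≤ 1) :
    ∫ z, respond k p z.2 ∂ν.prod (volume.restrict (Set.Icc (0 : ℝ) 1)) = min 1 p := by
  rw [integral_fun_snd (f := fun γ => respond k p γ)]
  cases k
  · simp [integral_threshold hp]
  · simp [respond, hk rfl]

theorem Model.integral_respond (M : Model n) (k : Kind) {X : Node n} (hX : X ≠ some 0)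
    {v : Fin n → ℝ} (hv0 : v 0 = 1) (hv : ∀ i, v i ∈ Set.Icc (0 : ℝ) 1) :
    ∫ z, respond k (∑ i, M.weight i X * v i + z.1) z.2 ∂M.nodeLaw X =
      ∑ i, M.weight i X * v i :=
  integral_respond_of_noise (by filter_upwards [M.ae_inRange hX] with ε h using h v hv0 hv)
    (M.integrable_noise hX) (M.noise_mean X hX)

theorem measurable_comp_respond {α : Type*} [MeasurableSpace α] (k : Kind) {p γ : α → ℝ}
    (hp : Measurable p) (hγ : Measurable γ) : Measurable fun z => respond k (p z) (γ z) :=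
  (measurable_respond k).comp (hp.prodMk hγ)

/-- Noise does not matter for the difference of the means of a node under two weight vectors. -/
theorem Model.abs_integral_respond_sub_le (M : Model n) {k : Kind} {X : Node n} (hX : X ≠ some 0)
    {v : Fin n → ℝ} (hv0 : v 0 = 1) (hv : ∀ i, v i ∈ Set.Icc (0 : ℝ) 1) {w : Fin n → ℝ}
    (hw : ∀ i, 0 ≤ w i) (hk : k = Kind.linear → ∑ i, w i ≤ 1) :
    |∫ z, (respond k (∑ i, w i * v i) z.2 - respond k (∑ i, M.weight i X * v i + z.1) z.2)
        ∂M.nodeLaw X| ≤ min 1 |∑ i, (w i - M.weight i X) * v i| := by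
  have hp : 0 ≤ ∑ i, w i * v i := Finset.sum_nonneg fun i _ => mul_nonneg (hw i) (hv i).1
  have hp1 : k = Kind.linear → ∑ i, w i * v i ≤ 1 := fun h =>
    le_trans (Finset.sum_le_sum fun i _ => mul_le_of_le_one_right (hw i) (hv i).2) (hk h)
  have hc := M.sum_weight_mul_mem X hv
  rw [integral_sub, M.integral_respond k hX hv0 hv]
  · rw [Model.nodeLaw, integral_respond_noiseless hp hp1]
    simp only [sub_mul, Finset.sum_sub_distrib]
    generalize ∑ i, w i * v i = p at *
    generalize ∑ i, M.weight i X * v i = c at *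
    obtain ⟨h1, h2⟩ := hc
    -- The true mean `c` is at most `1`, so clipping `p` at `1` only brings it closer to `c`.
    rcases le_total 1 p with h | h
    · rw [min_eq_left h, abs_of_nonneg (by linarith), abs_of_nonneg (by linarith)]
      exact le_min (by linarith) (by linarith)
    · rw [min_eq_right h]
      refine le_min ?_ le_rfl
      rw [abs_le]
      constructor <;> linarith
  · refine Integrable.of_mem_Icc 0 1
      (measurable_comp_respond k measurable_const measurable_snd).aemeasurable ?_
    exact .of_forall fun z => respond_mem_Icc fun h => ⟨hp, hp1 h⟩
  · refine Integrable.of_mem_Icc 0 1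
      (measurable_comp_respond k (by fun_prop) measurable_snd).aemeasurable ?_
    filter_upwards [M.ae_node_inRange hX] with z hz
    exact respond_mem_Icc fun _ => hz v hv0 hv

end OneRound

/-! ### Setting a node to a value, and the affine dependence of the other nodes on it -/

section Forced

variable {n : ℕ} [NeZero n]

/-- The structural equations in which the node `X₀` is set to the value `v`. -/
def forcedStep (k : Kind) (w : Fin n → Node n → ℝ) (a : Action n) (u : Node n → ℝ × ℝ)
    (X₀ : Node n) (v : ℝ) (x : Obs n) : Obs n :=
  Function.update (step k w a u x) X₀ v

/-- The values of the nodes if the node `X₀` is set to the value `v`. -/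
def forced (k : Kind) (w : Fin n → Node n → ℝ) (a : Action n) (u : Node n → ℝ × ℝ)
    (X₀ : Node n) (v : ℝ) : Obs n :=
  (forcedStep k w a u X₀ v)^[n + 1] 0

variable {k : Kind} {w w' : Fin n → Node n → ℝ} {a : Action n} {u u' : Node n → ℝ × ℝ}
  {X₀ : Node n} {v : ℝ}

theorem forcedStep_self (x : Obs n) : forcedStep k w a u X₀ v x X₀ = v := by
  simp [forcedStep]

theorem forcedStep_of_ne (x : Obs n) {X : Node n} (h : X ≠ X₀) :
    forcedStep k w a u X₀ v x X = step k w a u x X := by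
  simp [forcedStep, h]

theorem forcedStep_congr (X : Node n) (x y : Obs n) (h : ∀ i, w i X ≠ 0 → x (some i) = y (some i)) :
    forcedStep k w a u X₀ v x X = forcedStep k w a u X₀ v y X := by
  by_cases hX : X = X₀
  · subst hX
    simp only [forcedStep_self]
  · rw [forcedStep_of_ne _ hX, forcedStep_of_ne _ hX]
    exact step_congr (fun _ => rfl) rfl h

theorem forced_solution (hw : Acyclic fun i X => w i X ≠ 0) :
    forcedStep k w a u X₀ v (forced k w a u X₀ v) = forced k w a u X₀ v :=
  hw.iterate_solution forcedStep_congr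

theorem eq_forced_of_solution (hw : Acyclic fun i X => w i X ≠ 0) {x : Obs n}
    (hx : forcedStep k w a u X₀ v x = x) : x = forced k w a u X₀ v :=
  funext fun X => hw.solution_congr (D := Set.univ) (fun _ _ _ _ => trivial)
    (fun X _ => forcedStep_congr X) hx (forced_solution hw) X trivial

/-- The equation of `X₀` is overwritten, so its weights and its noise are irrelevant. This makes the
slope of the target in the value of `X₀` independent of the noise of `X₀`. -/
theorem forced_eq_of_agree (hw : ∀ X, X ≠ X₀ → ∀ i, w i X = w' i X)
    (hu : ∀ X, X ≠ X₀ → u X = u' X) : forced k w a u X₀ v = forced k w' a u' X₀ v := by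
  have : forcedStep k w a u X₀ v = forcedStep k w' a u' X₀ v := by
    funext x X
    by_cases hX : X = X₀
    · subst hX
      simp only [forcedStep_self]
    · rw [forcedStep_of_ne _ hX, forcedStep_of_ne _ hX]
      exact step_congr (hw X hX) (hu X hX) fun _ _ => rfl
  simp only [forced, this]

/-- Setting a node to its own value does not change anything. -/
theorem propagate_eq_forced (hw : Acyclic fun i X => w i X ≠ 0) :
    propagate k w a u = forced k w a u X₀ (propagate k w a u X₀) := by
  refine eq_forced_of_solution hw ?_
  conv_rhs => rw [← step_propagate k w a u hw]
  rw [forcedStep]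
  conv_lhs => arg 3; rw [← step_propagate k w a u hw]
  exact Function.update_eq_self ..

/-- The value of a node is an affine function of the value that another node is set to. -/
theorem forced_affine (hw : Acyclic fun i X => w i X ≠ 0)
    (hv : k = Kind.binary → v = 0 ∨ v = 1) (X : Node n) :
    forced k w a u X₀ v X = forced k w a u X₀ 0 X +
      v * (forced k w a u X₀ 1 X - forced k w a u X₀ 0 X) := by
  cases k with
  | binary => rcases hv rfl with rfl | rfl <;> ring
  | linear =>
    set x0 := forced Kind.linear w a u X₀ 0 with h0
    set x1 := forced Kind.linear w a u X₀ 1 with h1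
    have e0 : forcedStep Kind.linear w a u X₀ 0 x0 = x0 := forced_solution hw
    have e1 : forcedStep Kind.linear w a u X₀ 1 x1 = x1 := forced_solution hw
    -- All equations of a linear model are affine, so the affine combination of the solutions for
    -- `0` and `1` solves the system for `v`; solutions are unique.
    suffices h : (fun X => x0 X + v * (x1 X - x0 X)) = forced Kind.linear w a u X₀ v from
      (congrFun h X).symm
    refine eq_forced_of_solution hw (funext fun Z => ?_)
    have f0 := congrFun e0 Z
    have f1 := congrFun e1 Z
    by_cases hZ : Z = X₀
    · subst hZ
      rw [forcedStep_self] at f0 f1 ⊢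
      rw [← f0, ← f1]
      ring
    · rw [forcedStep_of_ne _ hZ] at f0 f1 ⊢
      rw [← f0, ← f1]
      by_cases hZ0 : Z = some 0
      · subst hZ0
        simp only [step_first]
        ring
      rcases hb : Z.bind a with _ | b
      · simp only [step_of_bind_eq_none hZ0 hb, respond, mul_add, mul_sub, Finset.sum_add_distrib,
          Finset.sum_sub_distrib, Finset.mul_sum, mul_left_comm v]
        ring
      · simp only [step_of_bind_eq_some hZ0 hb]
        ring

theorem forced_mem_Icc (hw : Acyclic fun i X => w i X ≠ 0)
    (h : k = Kind.linear → ∀ X, X ≠ some 0 → InRange (fun i => w i X) (u X).1)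
    (hX₀ : X₀ ≠ some 0) (hv : v ∈ Set.Icc (0 : ℝ) 1) (X : Node n) :
    forced k w a u X₀ v X ∈ Set.Icc (0 : ℝ) 1 := by
  classical
  set x := forced k w a u X₀ v with hx
  have hfix : forcedStep k w a u X₀ v x = x := forced_solution hw
  have hx0 : x (some 0) = 1 := by
    rw [← hfix, forcedStep_of_ne _ (Ne.symm hX₀), step_first]
  refine hw.induction (p := fun X => x X ∈ Set.Icc (0 : ℝ) 1) (fun X ih => ?_) X
  rw [← hfix]
  by_cases hXX : X = X₀
  · rw [hXX, forcedStep_self]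
    exact hv
  rw [forcedStep_of_ne _ hXX]
  by_cases hX : X = some 0
  · rw [hX, step_first]
    simp
  rcases hb : X.bind a with _ | b
  · rw [step_of_bind_eq_none hX hb]
    refine respond_mem_Icc fun hk => ?_
    have hsum : ∑ i, w i X * x (some i) =
        ∑ i, w i X * (if i = 0 then 1 else if w i X = 0 then 0 else x (some i)) := by
      refine Finset.sum_congr rfl fun i _ => ?_
      split_ifs with h1 h2
      · rw [h1, hx0]
      · simp [h2]
      · rfl
    rw [hsum]
    refine h hk X hX _ (by simp) fun i => ?_
    split_ifs with h1 h2
    · simp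
    · simp
    · exact ih i h2
  · rw [step_of_bind_eq_some hX hb]
    split_ifs <;> simp

end Forced

/-! ### Comparing rewards by exchanging the equations node by node -/

section Hybrid

variable {n : ℕ} [NeZero n]

open Classical in
/-- The weights `w` at the nodes in `D` and the weights `w'` elsewhere. -/
def hybridWeight (D : Set (Node n)) (w w' : Fin n → Node n → ℝ) : Fin n → Node n → ℝ :=
  fun i X => if X ∈ D then w i X else w' i X

open Classical in
/-- Noise only at the nodes in `D`. -/
def hybridExo (D : Set (Node n)) (u : Node n → ℝ × ℝ) : Node n → ℝ × ℝ :=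
  fun X => if X ∈ D then u X else (0, (u X).2)

/-- The distance between the equation of `X` with the weights `w` and in the true model, at the
values `x` of the nodes. -/
def Model.gap (M : Model n) (a : Action n) (w : Fin n → Node n → ℝ) (X : Node n) (x : Obs n) : ℝ :=
  if X ≠ some 0 ∧ X.bind a = none then min 1 |∑ i, (w i X - M.weight i X) * x (some i)| else 0

/-- Weights on an acyclic graph `e` for which the model of kind `k` is defined without noise. -/
structure Admissible (k : Kind) (e : Fin n → Node n → Prop) (w : Fin n → Node n → ℝ) : Prop where
  mem : ∀ i X, w i X ∈ Set.Icc (0 : ℝ) 1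
  eq_zero : ∀ i X, ¬ e i X → w i X = 0
  sum_le : k = Kind.linear → ∀ X, ∑ i, w i X ≤ 1

theorem Model.gap_nonneg (M : Model n) (a : Action n) (w : Fin n → Node n → ℝ) (X : Node n)
    (x : Obs n) : 0 ≤ M.gap a w X x := by
  unfold Model.gap
  split_ifs
  · positivity
  · exact le_rfl

theorem Model.gap_le_one (M : Model n) (a : Action n) (w : Fin n → Node n → ℝ) (X : Node n)
    (x : Obs n) : M.gap a w X x ≤ 1 := by
  unfold Model.gap
  split_ifs
  · exact min_le_left _ _
  · exact zero_le_one

theorem Model.measurable_gap (M : Model n) (a : Action n) (w : Fin n → Node n → ℝ) (X : Node n) :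
    Measurable (M.gap a w X) := by
  unfold Model.gap
  split_ifs
  · exact measurable_const.min (Measurable.abs (by fun_prop))
  · exact measurable_const

theorem Model.integrable_gap (M : Model n) (k : Kind) (a b : Action n) (w : Fin n → Node n → ℝ)
    (X : Node n) :
    Integrable (fun u => M.gap a w X (propagate k M.weight b u)) (exoLaw M.noise) :=
  Integrable.of_mem_Icc 0 1 ((M.measurable_gap a w X).comp
    (measurable_propagate k M.weight b)).aemeasurable
    (.of_forall fun _ => ⟨M.gap_nonneg .., M.gap_le_one ..⟩)

theorem measurable_hybridExo {m : ℕ} (D : Set (Node m)) : Measurable (hybridExo D) := by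
  refine measurable_pi_iff.2 fun X => ?_
  unfold hybridExo
  split_ifs
  · fun_prop
  · fun_prop

theorem Admissible.inRange {k : Kind} {e : Fin n → Node n → Prop} {w : Fin n → Node n → ℝ}
    (h : Admissible k e w) (hk : k = Kind.linear) (X : Node n) : InRange (fun i => w i X) 0 :=
  inRange_of_bounds (fun i => (h.mem i X).1) (by simpa using (h.mem 0 X).1)
    (by simpa using h.sum_le hk X)

variable {k : Kind} {M : Model n} {e : Fin n → Node n → Prop} {w : Fin n → Node n → ℝ}
  {D : Set (Node n)} {a : Action n}

theorem hybridWeight_eq_zero (hM : ∀ i X, M.edge i X → e i X) (hw : Admissible k e w)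
    (i : Fin n) (X : Node n) (h : ¬ e i X) : hybridWeight D M.weight w i X = 0 := by
  unfold hybridWeight
  split_ifs
  · exact M.weight_eq_zero i X fun h' => h (hM i X h')
  · exact hw.eq_zero i X h

theorem hybrid_acyclic (he : Acyclic e) (hM : ∀ i X, M.edge i X → e i X)
    (hw : Admissible k e w) : Acyclic fun i X => hybridWeight D M.weight w i X ≠ 0 :=
  he.mono fun i X h => by_contra fun h' => h (hybridWeight_eq_zero hM hw i X h')

theorem hybrid_inRange (hw : Admissible k e w) {u : Node n → ℝ × ℝ} (hu : M.NoiseOk u)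
    (hk : k = Kind.linear) (X : Node n) (hX : X ≠ some 0) :
    InRange (fun i => hybridWeight D M.weight w i X) (hybridExo D u X).1 := by
  unfold hybridWeight hybridExo
  by_cases h : X ∈ D
  · simpa only [h, if_true] using hu X hX
  · simpa only [h, if_false] using hw.inRange hk X

/-- `D` contains the parents of its members, so values in `D` are produced by true equations only.
Hence the gaps are evaluated in the true model, where data are observed. -/
theorem hybrid_eq_true (he : Acyclic e) (hM : ∀ i X, M.edge i X → e i X)
    (hw : Admissible k e w) (hD : ∀ X ∈ D, ∀ i, e i X → some i ∈ D) (u : Node n → ℝ × ℝ) :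
    ∀ X ∈ D, propagate k (hybridWeight D M.weight w) a (hybridExo D u) X =
      propagate k M.weight a u X :=
  propagate_congr he (hybridWeight_eq_zero hM hw)
    (fun i X h => M.weight_eq_zero i X fun h' => h (hM i X h')) hD
    (fun X hX i => by simp [hybridWeight, hX]) (fun X hX => by simp [hybridExo, hX])

theorem respond_eq_zero_or_one (p γ : ℝ) :
    respond Kind.binary p γ = 0 ∨ respond Kind.binary p γ = 1 := by
  simp only [respond]
  split_ifs <;> simp

/-- Replacing the equation of one node changes the mean of the target by at most the expected gap
at this node. -/
theorem abs_integral_hybrid_sub_le (he : Acyclic e) (hM : ∀ i X, M.edge i X → e i X)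
    (hw : Admissible k e w) (hD : ∀ X ∈ D, ∀ i, e i X → some i ∈ D) {X : Node n} (hX : X ∉ D)
    (hXD : ∀ i, e i X → some i ∈ D) :
    |∫ u, propagate k (hybridWeight D M.weight w) a (hybridExo D u) none ∂exoLaw M.noise -
      ∫ u, propagate k (hybridWeight (insert X D) M.weight w) a (hybridExo (insert X D) u) none
        ∂exoLaw M.noise| ≤ ∫ u, M.gap a w X (propagate k M.weight a u) ∂exoLaw M.noise := by
  classical
  set D' := insert X D with hD'
  set h : (Node n → ℝ × ℝ) → Obs n :=
    fun u => propagate k (hybridWeight D M.weight w) a (hybridExo D u) with hh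
  set h' : (Node n → ℝ × ℝ) → Obs n :=
    fun u => propagate k (hybridWeight D' M.weight w) a (hybridExo D' u) with hh'
  have hDD' : ∀ Z ≠ X, (Z ∈ D' ↔ Z ∈ D) := fun Z hZ => by simp [hD', hZ]
  have wD : ∀ Z, Z ≠ X → ∀ i, hybridWeight D M.weight w i Z = hybridWeight D' M.weight w i Z :=
    fun Z hZ i => by simp only [hybridWeight, hDD' Z hZ]
  have uD : ∀ u, ∀ Z, Z ≠ X → hybridExo D u Z = hybridExo D' u Z :=
    fun u Z hZ => by simp only [hybridExo, hDD' Z hZ]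
  -- The node `X₁` and nodes intervened on ignore their weights and noise; for them the two hybrids
  -- coincide.
  by_cases hcase : X ≠ some 0 ∧ X.bind a = none
  swap
  · have : h = h' := by
      funext u
      have : step k (hybridWeight D M.weight w) a (hybridExo D u) =
          step k (hybridWeight D' M.weight w) a (hybridExo D' u) := by
        funext x Z
        by_cases hZ : Z = X
        · subst hZ
          by_cases h0 : Z = some 0
          · subst h0
            simp only [step_first]
          · rcases hb : Z.bind a with _ | b
            · exact absurd ⟨h0, hb⟩ hcase
            · simp only [step_of_bind_eq_some h0 hb]
        · exact step_congr (wD Z hZ) (uD u Z hZ) fun _ _ => rfl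
      simp only [hh, hh', propagate, this]
    change |∫ u, h u none ∂_ - ∫ u, h' u none ∂_| ≤ _
    rw [this, sub_self, abs_zero]
    exact integral_nonneg fun u => M.gap_nonneg ..
  obtain ⟨hX0, hXa⟩ := hcase
  have hac := hybrid_acyclic (D := D) he hM hw
  have hac' := hybrid_acyclic (D := D') he hM hw
  have hhm : Measurable h :=
    (measurable_propagate k _ a).comp (measurable_hybridExo D)
  have hhm' : Measurable h' :=
    (measurable_propagate k _ a).comp (measurable_hybridExo D')
  have hok := M.ae_noiseOk
  have hmem : ∀ u, M.NoiseOk u → ∀ Z, h u Z ∈ Set.Icc (0 : ℝ) 1 := fun u hu Z =>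
    propagate_mem_Icc hac (hybrid_inRange hw hu) Z
  have hmem' : ∀ u, M.NoiseOk u → ∀ Z, h' u Z ∈ Set.Icc (0 : ℝ) 1 := fun u hu Z =>
    propagate_mem_Icc hac' (hybrid_inRange hw hu) Z
  have hint : Integrable (fun u => h u none) (exoLaw M.noise) :=
    Integrable.of_mem_Icc 0 1 ((measurable_pi_iff.1 hhm none).aemeasurable)
      (by filter_upwards [hok] with u hu using hmem u hu none)
  have hint' : Integrable (fun u => h' u none) (exoLaw M.noise) :=
    Integrable.of_mem_Icc 0 1 ((measurable_pi_iff.1 hhm' none).aemeasurable)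
      (by filter_upwards [hok] with u hu using hmem' u hu none)
  rw [← integral_sub hint hint']
  -- The slope of the target in the value of `X`. The two hybrids differ only in the equation of
  -- `X`, so the slope is common to both.
  set W : (Node n → ℝ × ℝ) → ℝ := fun u =>
    forced k (hybridWeight D M.weight w) a (hybridExo D u) X 1 none -
      forced k (hybridWeight D M.weight w) a (hybridExo D u) X 0 none with hW
  set x : (Node n → ℝ × ℝ) → Obs n := fun u => propagate k M.weight a u with hx
  have hpar : ∀ u, ∑ i, w i X * h u (some i) = ∑ i, w i X * x u (some i) := fun u =>
    Finset.sum_congr rfl fun i _ => by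
      by_cases hi : e i X
      · rw [show h u (some i) = x u (some i) from hybrid_eq_true he hM hw hD u _ (hXD i hi)]
      · rw [hw.eq_zero i X hi, zero_mul, zero_mul]
  have hpar' : ∀ u, h' u X = respond k (∑ i, M.weight i X * x u (some i) + (u X).1) (u X).2 := by
    intro u
    have hD'c : ∀ Z ∈ D', ∀ i, e i Z → some i ∈ D' := by
      intro Z hZ i hi
      rcases hZ with rfl | hZ
      · exact Or.inr (hXD i hi)
      · exact Or.inr (hD Z hZ i hi)
    rw [show h' u X = x u X from hybrid_eq_true he hM hw hD'c u X (Or.inl rfl),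
      show x u X = step k M.weight a u (x u) X from (congrFun (M.step_propagate k a u) X).symm,
      step_of_bind_eq_none hX0 hXa]
  have hvalX : ∀ u, h u X = respond k (∑ i, w i X * x u (some i)) (u X).2 := by
    intro u
    rw [← hpar]
    simp only [hh]
    conv_lhs => rw [← step_propagate k _ a _ hac]
    rw [step_of_bind_eq_none hX0 hXa]
    simp [hybridWeight, hybridExo, hX]
  have hdiff : ∀ u, h u none - h' u none = W u *
      (respond k (∑ i, w i X * x u (some i)) (u X).2 -
        respond k (∑ i, M.weight i X * x u (some i) + (u X).1) (u X).2) := by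
    intro u
    have h1 : h u none = forced k (hybridWeight D M.weight w) a (hybridExo D u) X (h u X) none :=
      congrFun (propagate_eq_forced hac) none
    have h2 : h' u none = forced k (hybridWeight D M.weight w) a (hybridExo D u) X (h' u X) none := by
      rw [forced_eq_of_agree wD (uD u)]
      exact congrFun (propagate_eq_forced hac') none
    rw [h1, h2, hvalX, hpar']
    rw [forced_affine hac (v := respond k (∑ i, w i X * x u (some i)) (u X).2),
      forced_affine hac
        (v := respond k (∑ i, M.weight i X * x u (some i) + (u X).1) (u X).2)]
    · simp only [hW]; ring
    · rintro rfl; exact respond_eq_zero_or_one _ _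
    · rintro rfl; exact respond_eq_zero_or_one _ _
  have hupW : ∀ u z, W (Function.update u X z) = W u := by
    intro u z
    have : ∀ Z, Z ≠ X → hybridExo D (Function.update u X z) Z = hybridExo D u Z :=
      fun Z hZ => by simp [hybridExo, hZ]
    simp only [hW]
    rw [forced_eq_of_agree (fun _ _ _ => rfl) this, forced_eq_of_agree (fun _ _ _ => rfl) this]
  have hupx : ∀ u z i, e i X → x (Function.update u X z) (some i) = x u (some i) := by
    intro u z i hi
    refine propagate_congr (D := D) he
      (fun i X h => M.weight_eq_zero i X fun h' => h (hM i X h'))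
      (fun i X h => M.weight_eq_zero i X fun h' => h (hM i X h')) hD (fun _ _ _ => rfl)
      (fun Z hZ => ?_) _ (hXD i hi)
    rw [Function.update_of_ne]
    rintro rfl
    exact hX hZ
  have hups : ∀ u z (c : Fin n → ℝ), (∀ i, ¬ e i X → c i = 0) →
      ∑ i, c i * x (Function.update u X z) (some i) = ∑ i, c i * x u (some i) :=
    fun u z c hc => Finset.sum_congr rfl fun i _ => by
      by_cases hi : e i X
      · rw [hupx u z i hi]
      · rw [hc i hi, zero_mul, zero_mul]
  have hwz : ∀ i, ¬ e i X → w i X = 0 := fun i => hw.eq_zero i X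
  have hMz : ∀ i, ¬ e i X → M.weight i X = 0 := fun i hi =>
    M.weight_eq_zero i X fun h' => hi (hM i X h')
  -- Resampling the noise and threshold of `X` moves neither the slope nor the parents of `X`. The
  -- inner integral is thus the slope times a difference of means of `X` with its parents fixed.
  have hres := integral_update M.nodeLaw (f := fun u => h u none - h' u none)
    (by rw [← M.exoLaw_eq]; exact hint.sub hint') X
  rw [← M.exoLaw_eq] at hres
  rw [hres]
  rw [← Real.norm_eq_abs]
  refine (norm_integral_le_integral_norm _).trans ?_
  refine integral_mono_of_nonneg (.of_forall fun _ => norm_nonneg _) (M.integrable_gap k a a w X) ?_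
  filter_upwards [hok] with u hu
  have hbound := M.abs_integral_respond_sub_le (k := k) hX0 (v := fun i => x u (some i))
    (propagate_first ..) (fun i => M.propagate_mem_Icc hu _) (w := fun i => w i X)
    (fun i => (hw.mem i X).1) (fun hk => hw.sum_le hk X)
  simp only [hdiff, hupW, hups u _ _ hwz, hups u _ _ hMz, Function.update_self]
  rw [integral_const_mul, Real.norm_eq_abs, abs_mul]
  have hW1 : |W u| ≤ 1 := by
    have h1 := forced_mem_Icc hac (hybrid_inRange (D := D) hw hu) hX0 (v := 1) (by simp)
      (a := a) none
    have h0 := forced_mem_Icc hac (hybrid_inRange (D := D) hw hu) hX0 (v := 0) (by simp)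
      (a := a) none
    rw [abs_le]
    constructor <;> simp only [hW] <;> linarith [h1.1, h1.2, h0.1, h0.2]
  refine (mul_le_of_le_one_left (abs_nonneg _) hW1).trans ?_
  rw [Model.gap, if_pos ⟨hX0, hXa⟩]
  exact hbound

/-- Expectations under the noiseless model can be computed with the noise of the true model. -/
theorem expReward_dirac_eq (k : Kind) (M : Model n) (w : Fin n → Node n → ℝ) (a : Action n) :
    expReward k w (fun _ => Measure.dirac 0) a =
      ∫ u, propagate k w a (hybridExo ∅ u) none ∂exoLaw M.noise := by
  have hmap : exoLaw (fun _ : Node n => Measure.dirac (0 : ℝ)) =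
      Measure.map (hybridExo ∅) (exoLaw M.noise) := by
    have h1 : (hybridExo ∅ : (Node n → ℝ × ℝ) → _) = fun u X => (0, (u X).2) := by
      funext u X
      simp [hybridExo]
    have h2 : ∀ X, Measure.map (fun p : ℝ × ℝ => ((0 : ℝ), p.2)) (M.nodeLaw X) =
        (Measure.dirac (0 : ℝ)).prod (volume.restrict (Set.Icc (0 : ℝ) 1)) := by
      intro X
      have : (fun p : ℝ × ℝ => ((0 : ℝ), p.2)) = Prod.map (fun _ => 0) id := by
        funext p; rfl
      rw [this, Model.nodeLaw, ← Measure.map_prod_map _ _ measurable_const measurable_id,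
        Measure.map_const, Measure.map_id]
      simp
    have h3 : ∀ X, IsProbabilityMeasure
        (Measure.map (fun p : ℝ × ℝ => ((0 : ℝ), p.2)) (M.nodeLaw X)) := fun X =>
      Measure.isProbabilityMeasure_map (by fun_prop)
    have h4 := Measure.pi_map_pi (μ := M.nodeLaw) (f := fun _ (p : ℝ × ℝ) => ((0 : ℝ), p.2))
      fun X => by fun_prop
    simp only [h2] at h4
    rw [h1]
    exact h4.symm
  rw [expReward, hmap, integral_map (measurable_hybridExo ∅).aemeasurable]
  exact ((measurable_pi_iff.1 (measurable_propagate k w a)) none).aestronglyMeasurable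

/-- The difference of the expected rewards under the weights `w` and in the true model is at most
the sum of the expected gaps of all nodes. -/
theorem abs_expReward_sub_reward_le (he : Acyclic e) (hM : ∀ i X, M.edge i X → e i X)
    (hw : Admissible k e w) (a : Action n) :
    |expReward k w (fun _ => Measure.dirac 0) a - M.reward k a| ≤
      ∫ u, ∑ X, M.gap a w X (propagate k M.weight a u) ∂exoLaw M.noise := by
  classical
  -- `S` holds the nodes that follow the candidate equations, and its complement is closed under
  -- parents. Moving a node of minimal rank out of `S` preserves this; an empty `S` is the true
  -- model.
  have key : ∀ S : Finset (Node n), (∀ X ∉ S, ∀ i, e i X → some i ∉ S) →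
      |∫ u, propagate k (hybridWeight (Sᶜ : Set (Node n)) M.weight w) a
        (hybridExo (Sᶜ : Set (Node n)) u) none ∂exoLaw M.noise - M.reward k a| ≤
      ∑ X ∈ S, ∫ u, M.gap a w X (propagate k M.weight a u) ∂exoLaw M.noise := by
    intro S
    induction hS : S.card generalizing S with
    | zero =>
      intro _
      obtain rfl := Finset.card_eq_zero.1 hS
      have h1 : hybridWeight (Set.univ : Set (Node n)) M.weight w = M.weight := by
        funext i X; simp [hybridWeight]
      have h2 : ∀ u, hybridExo (Set.univ : Set (Node n)) u = u := by
        intro u; funext X; simp [hybridExo]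
      simp [h1, h2, Model.reward, expReward]
    | succ m ih =>
      intro hc
      obtain ⟨r, hr, -⟩ := he.exists_rank
      obtain ⟨X, hXS, hX⟩ := S.exists_min_image r (Finset.card_pos.1 (by omega))
      have hpar : ∀ i, e i X → some i ∉ S := fun i hi hiS => by
        have := hX _ hiS
        have := hr i X hi
        omega
      have h1 := ih (S.erase X) (by rw [Finset.card_erase_of_mem hXS, hS]; rfl) (by
        intro Z hZ i hi
        simp only [Finset.mem_erase, not_and] at hZ ⊢
        intro _
        by_cases hZX : Z = X
        · subst hZX
          exact hpar i hi
        · exact hc Z (hZ hZX) i hi)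
      have h2 := abs_integral_hybrid_sub_le (a := a) (D := ((S : Set (Node n))ᶜ)) (X := X) he hM hw
        (fun Z hZ i hi => hc Z hZ i hi) (fun h => h hXS) hpar
      have h3 : insert X ((S : Set (Node n))ᶜ) = (((S.erase X : Finset (Node n)) : Set (Node n))ᶜ) := by
        ext Z
        by_cases hZX : Z = X <;> simp [hZX]
      rw [h3] at h2
      rw [← Finset.add_sum_erase _ _ hXS]
      exact (abs_sub_le _ _ _).trans (add_le_add h2 h1)
  have h := key Finset.univ (by simp)
  rw [← integral_finsetSum _ fun X _ => M.integrable_gap k a a w X] at h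
  have h1 : hybridWeight (∅ : Set (Node n)) M.weight w = w := by
    funext i X; simp [hybridWeight]
  rw [expReward_dirac_eq k M]
  simpa [h1] using h

theorem Model.admissible (M : Model n) (k : Kind) {e : Fin n → Node n → Prop}
    (hM : ∀ i X, M.edge i X → e i X) : Admissible k e M.weight :=
  ⟨M.weight_mem, fun i X h => M.weight_eq_zero i X fun h' => h (hM i X h'),
    fun _ => M.sum_weight_le_one⟩

/-- The comparison applied to the true weights themselves, for which every gap vanishes. It matches
the noiseless objective of the algorithm with the true reward. -/
theorem Model.expReward_dirac (M : Model n) (k : Kind) (a : Action n) :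
    expReward k M.weight (fun _ => Measure.dirac 0) a = M.reward k a := by
  have h := abs_expReward_sub_reward_le M.acyclic (fun _ _ h => h)
    (M.admissible k fun _ _ h => h) a
  have h0 : ∀ X x, M.gap a M.weight X x = 0 := fun X x => by simp [Model.gap]
  simp only [h0, Finset.sum_const_zero, integral_zero] at h
  exact sub_eq_zero.1 (abs_nonpos_iff.1 h)

theorem Model.reward_mem_Icc (M : Model n) (k : Kind) (a : Action n) :
    M.reward k a ∈ Set.Icc (0 : ℝ) 1 := by
  have hmem : ∀ᵐ u ∂exoLaw M.noise, propagate k M.weight a u none ∈ Set.Icc (0 : ℝ) 1 := by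
    filter_upwards [M.ae_noiseOk] with u hu using M.propagate_mem_Icc hu none
  refine ⟨integral_nonneg_of_ae (by filter_upwards [hmem] with u hu using hu.1), ?_⟩
  have h := integral_mono_ae (Integrable.of_mem_Icc 0 1
    (measurable_pi_iff.1 (measurable_propagate k M.weight a) none).aemeasurable hmem)
    (integrable_const (1 : ℝ)) (by filter_upwards [hmem] with u hu using hu.2)
  rw [integral_const, probReal_univ, one_smul] at h
  exact h

end Hybrid

/-! ### Rank one updates of positive definite matrices and the self-normalized potential -/

section RankOne

open Matrix

variable {ι : Type*} [Fintype ι]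

theorem dotProduct_mulVec_comm_of_isHermitian {P : Matrix ι ι ℝ} (hP : P.IsHermitian) (x y : ι → ℝ) :
    x ⬝ᵥ P *ᵥ y = y ⬝ᵥ P *ᵥ x := by
  have : Pᵀ = P := by simpa [IsHermitian, conjTranspose_eq_transpose_of_trivial] using hP
  rw [dotProduct_mulVec, ← mulVec_transpose, this, dotProduct_comm]

theorem posSemidef_vecMulVec_self (v : ι → ℝ) : (vecMulVec v v).PosSemidef := by
  simpa using posSemidef_vecMulVec_self_star v

variable [DecidableEq ι]

theorem dotProduct_inv_mulVec_nonneg {M : Matrix ι ι ℝ} (hM : M.PosDef) (x : ι → ℝ) :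
    0 ≤ x ⬝ᵥ M⁻¹ *ᵥ x := by
  simpa using hM.inv.posSemidef.dotProduct_mulVec_nonneg x

/-- The Sherman-Morrison formula, checked by multiplying out. -/
theorem inv_add_vecMulVec {M : Matrix ι ι ℝ} (hM : M.PosDef) (v : ι → ℝ) :
    (M + vecMulVec v v)⁻¹ =
      M⁻¹ - (1 / (1 + v ⬝ᵥ M⁻¹ *ᵥ v)) • vecMulVec (M⁻¹ *ᵥ v) (M⁻¹ *ᵥ v) := by
  have hu : IsUnit M.det := hM.det_pos.ne'.isUnit
  have hm := dotProduct_inv_mulVec_nonneg hM v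
  have hT : (M⁻¹)ᵀ = M⁻¹ := by
    simpa [IsHermitian, conjTranspose_eq_transpose_of_trivial] using hM.inv.isHermitian
  refine inv_eq_right_inv ?_
  have h1 : M *ᵥ (M⁻¹ *ᵥ v) = v := by rw [mulVec_mulVec, mul_nonsing_inv _ hu, one_mulVec]
  have h2 : v ᵥ* M⁻¹ = M⁻¹ *ᵥ v := by rw [← mulVec_transpose, hT]
  rw [Matrix.add_mul, Matrix.mul_sub, Matrix.mul_sub, mul_nonsing_inv _ hu, mul_smul_comm,
    mul_smul_comm, mul_vecMulVec, h1, vecMulVec_mul, h2, vecMulVec_mul_vecMulVec]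
  ext i j
  simp only [Matrix.add_apply, Matrix.sub_apply, Matrix.smul_apply, vecMulVec_apply, Pi.smul_apply, smul_eq_mul]
  field_simp
  ring

theorem dotProduct_inv_add_vecMulVec {M : Matrix ι ι ℝ} (hM : M.PosDef) (v x : ι → ℝ) :
    x ⬝ᵥ (M + vecMulVec v v)⁻¹ *ᵥ x =
      x ⬝ᵥ M⁻¹ *ᵥ x - (v ⬝ᵥ M⁻¹ *ᵥ x) ^ 2 / (1 + v ⬝ᵥ M⁻¹ *ᵥ v) := by
  have hx : (M⁻¹ *ᵥ v) ⬝ᵥ x = v ⬝ᵥ M⁻¹ *ᵥ x := by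
    rw [dotProduct_comm, dotProduct_mulVec_comm_of_isHermitian hM.inv.isHermitian]
  rw [inv_add_vecMulVec hM, sub_mulVec, smul_mulVec, vecMulVec_mulVec, dotProduct_sub,
    dotProduct_smul, hx, op_smul_eq_smul, dotProduct_smul, dotProduct_comm x (M⁻¹ *ᵥ v), hx]
  simp only [smul_eq_mul]
  ring

/-- The matrix determinant lemma. The same factor drives both the supermartingale and the elliptical
potential. -/
theorem det_add_vecMulVec {M : Matrix ι ι ℝ} (hM : M.PosDef) (v : ι → ℝ) :
    (M + vecMulVec v v).det = M.det * (1 + v ⬝ᵥ M⁻¹ *ᵥ v) := by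
  rw [vecMulVec_eq Unit, det_add_replicateCol_mul_replicateRow hM.det_pos.ne'.isUnit,
    det_unique (n := Unit), Matrix.mul_assoc, ← replicateCol_mulVec]
  simp

/-- The change of `‖S‖²` in the norm of `M⁻¹` when `v vᵀ` is added to `M` and `η v` to `S`. -/
theorem dotProduct_inv_update {M : Matrix ι ι ℝ} (hM : M.PosDef) (v S : ι → ℝ) (η : ℝ) :
    (S + η • v) ⬝ᵥ (M + vecMulVec v v)⁻¹ *ᵥ (S + η • v) = S ⬝ᵥ M⁻¹ *ᵥ S +
      (2 * η * (v ⬝ᵥ M⁻¹ *ᵥ S) + η ^ 2 * (v ⬝ᵥ M⁻¹ *ᵥ v) - (v ⬝ᵥ M⁻¹ *ᵥ S) ^ 2) /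
        (1 + v ⬝ᵥ M⁻¹ *ᵥ v) := by
  have hm := dotProduct_inv_mulVec_nonneg hM v
  rw [dotProduct_inv_add_vecMulVec hM]
  simp only [mulVec_add, mulVec_smul, dotProduct_add, add_dotProduct, smul_dotProduct,
    dotProduct_smul, smul_eq_mul]
  rw [dotProduct_mulVec_comm_of_isHermitian hM.inv.isHermitian S v]
  field_simp
  ring

/-- The **Cauchy-Schwarz inequality** for the norms of `M` and `M⁻¹`. -/
theorem dotProduct_sq_le {M : Matrix ι ι ℝ} (hM : M.PosDef) (x y : ι → ℝ) :
    (x ⬝ᵥ y) ^ 2 ≤ (x ⬝ᵥ M *ᵥ x) * (y ⬝ᵥ M⁻¹ *ᵥ y) := by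
  have hu : IsUnit M.det := hM.det_pos.ne'.isUnit
  have h1 : M *ᵥ (M⁻¹ *ᵥ y) = y := by rw [mulVec_mulVec, mul_nonsing_inv _ hu, one_mulVec]
  have h := LinearMap.BilinForm.apply_mul_apply_le_of_forall_zero_le (Matrix.toBilin' M)
    (fun z => by
      rw [Matrix.toBilin'_apply']
      simpa using hM.posSemidef.dotProduct_mulVec_nonneg z) x (M⁻¹ *ᵥ y)
  simp only [Matrix.toBilin'_apply', h1] at h
  rw [dotProduct_mulVec_comm_of_isHermitian hM.isHermitian (M⁻¹ *ᵥ y) x, h1,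
    dotProduct_comm (M⁻¹ *ᵥ y) y] at h
  simpa [sq] using h

/-- The triangle inequality of the seminorm of `P`, from Cauchy-Schwarz. It serves both for the Gram
matrix and for its inverse. -/
theorem sqrt_dotProduct_sub_le {P : Matrix ι ι ℝ} (hP : P.PosSemidef) (x y : ι → ℝ) :
    √((x - y) ⬝ᵥ P *ᵥ (x - y)) ≤ √(x ⬝ᵥ P *ᵥ x) + √(y ⬝ᵥ P *ᵥ y) := by
  have hn : ∀ z, 0 ≤ z ⬝ᵥ P *ᵥ z := fun z => by simpa using hP.dotProduct_mulVec_nonneg z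
  have h := LinearMap.BilinForm.apply_mul_apply_le_of_forall_zero_le (Matrix.toBilin' P)
    (fun z => by rw [Matrix.toBilin'_apply']; exact hn z) x y
  simp only [Matrix.toBilin'_apply'] at h
  rw [dotProduct_mulVec_comm_of_isHermitian hP.isHermitian y x] at h
  have h2 : |x ⬝ᵥ P *ᵥ y| ≤ √(x ⬝ᵥ P *ᵥ x) * √(y ⬝ᵥ P *ᵥ y) := by
    rw [← Real.sqrt_mul (hn x)]
    exact Real.abs_le_sqrt (by rw [sq]; exact h)
  refine Real.sqrt_le_iff.2 ⟨by positivity, ?_⟩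
  simp only [mulVec_sub, dotProduct_sub, sub_dotProduct]
  rw [dotProduct_mulVec_comm_of_isHermitian hP.isHermitian y x, add_sq, Real.sq_sqrt (hn x),
    Real.sq_sqrt (hn y)]
  nlinarith [neg_abs_le (x ⬝ᵥ P *ᵥ y)]

/-- The identity matrix plus finitely many rank one matrices. -/
theorem posDef_one_add_sum {α : Type*} (s : Finset α) (V : α → ι → ℝ) :
    (1 + ∑ r ∈ s, vecMulVec (V r) (V r) : Matrix ι ι ℝ).PosDef :=
  PosDef.one.add_posSemidef (posSemidef_sum s fun r _ => posSemidef_vecMulVec_self (V r))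

theorem dotProduct_one_add_sum {α : Type*} (s : Finset α) (V : α → ι → ℝ) (x : ι → ℝ) :
    x ⬝ᵥ (1 + ∑ r ∈ s, vecMulVec (V r) (V r) : Matrix ι ι ℝ) *ᵥ x =
      x ⬝ᵥ x + ∑ r ∈ s, (V r ⬝ᵥ x) ^ 2 := by
  rw [add_mulVec, one_mulVec, dotProduct_add, sum_mulVec, dotProduct_sum]
  congr 1
  refine Finset.sum_congr rfl fun r _ => ?_
  rw [vecMulVec_mulVec, op_smul_eq_smul, dotProduct_smul, dotProduct_comm x, smul_eq_mul, sq]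

/-- With `z = M⁻¹x` one has `x·z ≥ z·z`, and then `|x - z|² ≥ 0` gives the claim. It controls the
bias caused by the regularizing identity matrix. -/
theorem dotProduct_inv_one_add_sum_le {α : Type*} (s : Finset α) (V : α → ι → ℝ) (x : ι → ℝ) :
    x ⬝ᵥ (1 + ∑ r ∈ s, vecMulVec (V r) (V r) : Matrix ι ι ℝ)⁻¹ *ᵥ x ≤ x ⬝ᵥ x := by
  set M : Matrix ι ι ℝ := 1 + ∑ r ∈ s, vecMulVec (V r) (V r) with hMdef
  have hM : M.PosDef := posDef_one_add_sum s V
  set z := M⁻¹ *ᵥ x with hz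
  have hMz : M *ᵥ z = x := by
    rw [hz, mulVec_mulVec, mul_nonsing_inv _ hM.det_pos.ne'.isUnit, one_mulVec]
  have h1 : x ⬝ᵥ z = z ⬝ᵥ z + ∑ r ∈ s, (V r ⬝ᵥ z) ^ 2 := by
    rw [← dotProduct_one_add_sum s V z, ← hMdef, hMz, dotProduct_comm]
  have h2 : 0 ≤ ∑ r ∈ s, (V r ⬝ᵥ z) ^ 2 := Finset.sum_nonneg fun _ _ => sq_nonneg _
  have h3 : 0 ≤ (x - z) ⬝ᵥ (x - z) := by
    simpa using dotProduct_star_self_nonneg (x - z)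
  simp only [dotProduct_sub, sub_dotProduct] at h3
  rw [dotProduct_comm z x] at h3
  linarith

/-- The trace is at most `c` times the dimension. Summing the tangent bound `log λ ≤ log c + λ/c -
1` over the eigenvalues cancels the linear terms. -/
theorem log_det_one_add_sum_le {α : Type*} (s : Finset α) (V : α → ι → ℝ)
    (hV : ∀ r ∈ s, ∀ i, V r i ∈ Set.Icc (0 : ℝ) 1) {c : ℝ} (hc : 1 ≤ c)
    (hs : 1 + (s.card : ℝ) ≤ c) :
    Real.log (1 + ∑ r ∈ s, vecMulVec (V r) (V r) : Matrix ι ι ℝ).det ≤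
      Fintype.card ι * Real.log c := by
  set M : Matrix ι ι ℝ := 1 + ∑ r ∈ s, vecMulVec (V r) (V r) with hMdef
  have hM : M.PosDef := posDef_one_add_sum s V
  have htr : M.trace ≤ Fintype.card ι * c := by
    rw [hMdef, trace_add, trace_one, trace_sum]
    have : ∑ r ∈ s, (vecMulVec (V r) (V r)).trace ≤ ∑ r ∈ s, (Fintype.card ι : ℝ) := by
      refine Finset.sum_le_sum fun r hr => ?_
      rw [trace_vecMulVec]
      have : V r ⬝ᵥ V r ≤ ∑ _i : ι, (1 : ℝ) := Finset.sum_le_sum fun i _ =>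
        mul_le_one₀ (hV r hr i).2 (hV r hr i).1 (hV r hr i).2
      simpa using this
    rw [Finset.sum_const, nsmul_eq_mul] at this
    nlinarith [(Nat.cast_nonneg (Fintype.card ι) : (0 : ℝ) ≤ Fintype.card ι)]
  rw [hM.isHermitian.trace_eq_sum_eigenvalues] at htr
  rw [hM.isHermitian.det_eq_prod_eigenvalues]
  simp only [RCLike.ofReal_real_eq_id, id_eq] at htr ⊢
  rw [Real.log_prod fun i _ => (hM.eigenvalues_pos i).ne']
  have hc0 : 0 < c := by linarith
  have h : ∀ i, Real.log (hM.isHermitian.eigenvalues i) ≤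
      Real.log c + (hM.isHermitian.eigenvalues i / c - 1) := by
    intro i
    have := Real.log_le_sub_one_of_pos (div_pos (hM.eigenvalues_pos i) hc0)
    rw [Real.log_div (hM.eigenvalues_pos i).ne' hc0.ne'] at this
    linarith
  refine (Finset.sum_le_sum fun i _ => h i).trans ?_
  rw [Finset.sum_add_distrib, Finset.sum_sub_distrib, ← Finset.sum_div]
  have := (div_le_iff₀ hc0).2 htr
  simp only [Finset.sum_const, Finset.card_univ, nsmul_eq_mul, mul_one]
  linarith

theorem div_le_log_one_add {m : ℝ} (hm : 0 ≤ m) : m / (1 + m) ≤ Real.log (1 + m) := by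
  have := Real.one_sub_inv_le_log_of_pos (show 0 < 1 + m by linarith)
  refine le_trans (le_of_eq ?_) this
  field_simp
  ring

theorem min_one_le_two_log {m : ℝ} (hm : 0 ≤ m) : min 1 m ≤ 2 * Real.log (1 + m) := by
  have h := div_le_log_one_add hm
  have h2 : min 1 m / 2 ≤ m / (1 + m) := by
    rw [div_le_div_iff₀ two_pos (by linarith)]
    rcases le_total 1 m with h1 | h1
    · rw [min_eq_left h1]; linarith
    · rw [min_eq_right h1]; nlinarith
  linarith

/-- The exponential supermartingale of the self-normalized process. -/
def potential (M : Matrix ι ι ℝ) (S : ι → ℝ) : ℝ :=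
  Real.exp (2 * (S ⬝ᵥ M⁻¹ *ᵥ S) - 2 * Real.log M.det)

open ProbabilityTheory in
-- With `m = v·M⁻¹v` and `p = v·M⁻¹S`, the exponent changes by `2(2ηp + η²m - p²)/(1+m) - 2
-- log(1+m)`. The term in `η²` is paid for by the determinant, as `|η| ≤ 1` and `m/(1+m) ≤
-- log(1+m)`. The term linear in `η` is paid for by `-2p²/(1+m)` through Hoeffding's lemma.
theorem lintegral_potential_update_le {Ω : Type*} [MeasurableSpace Ω] {ν : Measure Ω}
    [IsProbabilityMeasure ν] {η : Ω → ℝ} (hη : AEMeasurable η ν) {c : ℝ} (hc : c ∈ Set.Icc (0 : ℝ) 1)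
    (hb : ∀ᵐ ω ∂ν, η ω ∈ Set.Icc (0 - c) (1 - c)) (h0 : ∫ ω, η ω ∂ν = 0)
    {M : Matrix ι ι ℝ} (hM : M.PosDef) (v S : ι → ℝ) :
    ∫⁻ ω, ENNReal.ofReal (potential (M + vecMulVec v v) (S + η ω • v)) ∂ν ≤
      ENNReal.ofReal (potential M S) := by
  have hsg := hasSubgaussianMGF_of_mem_Icc_of_integral_eq_zero hη hb h0
  set m := v ⬝ᵥ M⁻¹ *ᵥ v with hm
  set p := v ⬝ᵥ M⁻¹ *ᵥ S with hp
  have hm0 : 0 ≤ m := dotProduct_inv_mulVec_nonneg hM v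
  set l := 4 * p / (1 + m) with hl
  have hpt : ∀ᵐ ω ∂ν, potential (M + vecMulVec v v) (S + η ω • v) ≤
      potential M S * Real.exp (-(2 * p ^ 2 / (1 + m))) * Real.exp (l * η ω) := by
    filter_upwards [hb] with ω hω
    have hη1 : η ω ^ 2 ≤ 1 := by
      rw [sq_le_one_iff_abs_le_one, abs_le]
      constructor <;> linarith [hω.1, hω.2, hc.1, hc.2]
    rw [potential, potential, dotProduct_inv_update hM, det_add_vecMulVec hM, ← hm, ← hp,
      Real.log_mul hM.det_pos.ne' (by positivity), ← Real.exp_add, ← Real.exp_add,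
      Real.exp_le_exp]
    have h1 := div_le_log_one_add hm0
    have h2 : η ω ^ 2 * m / (1 + m) ≤ m / (1 + m) := by
      gcongr
      nlinarith
    have h3 : (2 * η ω * p + η ω ^ 2 * m - p ^ 2) / (1 + m) =
        l * η ω / 2 + η ω ^ 2 * m / (1 + m) - p ^ 2 / (1 + m) := by
      rw [hl]; field_simp; ring
    have h4 : 2 * p ^ 2 / (1 + m) = 2 * (p ^ 2 / (1 + m)) := by ring
    rw [h3, h4]
    linarith
  have hmgf := hsg.mgf_le l
  rw [mgf] at hmgf
  calc ∫⁻ ω, ENNReal.ofReal (potential (M + vecMulVec v v) (S + η ω • v)) ∂ν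
      ≤ ∫⁻ ω, ENNReal.ofReal (potential M S * Real.exp (-(2 * p ^ 2 / (1 + m))) *
          Real.exp (l * η ω)) ∂ν :=
        lintegral_mono_ae (by filter_upwards [hpt] with ω h using ENNReal.ofReal_le_ofReal h)
    _ = ENNReal.ofReal (∫ ω, potential M S * Real.exp (-(2 * p ^ 2 / (1 + m))) *
          Real.exp (l * η ω) ∂ν) := by
        rw [ofReal_integral_eq_lintegral_ofReal ((hsg.integrable_exp_mul l).const_mul _)]
        exact .of_forall fun ω => by
          simp only [Pi.zero_apply]
          unfold potential
          positivity
    _ ≤ ENNReal.ofReal (potential M S) := by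
        refine ENNReal.ofReal_le_ofReal ?_
        rw [integral_const_mul]
        have hpos : 0 ≤ potential M S := (Real.exp_pos _).le
        have hle : Real.exp (-(2 * p ^ 2 / (1 + m))) * ∫ ω, Real.exp (l * η ω) ∂ν ≤ 1 := by
          refine (mul_le_mul_of_nonneg_left hmgf (Real.exp_pos _).le).trans ?_
          rw [← Real.exp_add, Real.exp_le_one_iff]
          -- The noise ranges over an interval of length `1`, so its moment generating function at
          -- `l` is at most `exp(l²/8) = exp(2p²/(1+m)²)`.
          have hq : ((((‖(1 - c) - (0 - c)‖₊ / 2) ^ 2 : NNReal)) : ℝ) = 1 / 4 := by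
            rw [show (1 - c) - (0 - c) = 1 by ring]
            norm_num
          rw [hq, hl]
          have : (4 * p / (1 + m)) ^ 2 ≤ 16 * (p ^ 2 / (1 + m)) := by
            rw [div_pow, ← mul_div_assoc, div_le_div_iff₀ (by positivity) (by positivity)]
            nlinarith [mul_nonneg (sq_nonneg p) (mul_nonneg hm0 (by linarith : 0 ≤ 1 + m))]
          have h4 : 2 * p ^ 2 / (1 + m) = 2 * (p ^ 2 / (1 + m)) := by ring
          rw [h4]
          linarith
        rw [mul_assoc]
        exact mul_le_of_le_one_right hpos hle

end RankOne

/-! ### Measurability of quantities selected by a finite-valued map -/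

section FiniteChoice

variable {Ω A β : Type*} [MeasurableSpace Ω] [MeasurableSpace β] [Finite A]

theorem measurable_finite_choice {a : Ω → A} (ha : ∀ b, MeasurableSet {ω | a ω = b})
    {f : A → Ω → β} (hf : ∀ b, Measurable (f b)) : Measurable fun ω => f (a ω) ω := by
  intro S hS
  have : (fun ω => f (a ω) ω) ⁻¹' S = ⋃ b, {ω | a ω = b} ∩ f b ⁻¹' S := by
    ext ω
    simp
  rw [this]
  exact MeasurableSet.iUnion fun b => (ha b).inter (hf b hS)

theorem measurableSet_finite_choice {a : Ω → A} (ha : ∀ b, MeasurableSet {ω | a ω = b})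
    {p : A → Ω → Prop} (hp : ∀ b, MeasurableSet {ω | p b ω}) :
    MeasurableSet {ω | p (a ω) ω} := by
  have : {ω | p (a ω) ω} = ⋃ b, {ω | a ω = b} ∩ {ω | p b ω} := by
    ext ω
    simp
  rw [this]
  exact MeasurableSet.iUnion fun b => (ha b).inter (hp b)

end FiniteChoice

/-! ### Measurability of determinants, inverses and potentials -/

section MatrixMeasurability

open Matrix

variable {Ω ι : Type*} [MeasurableSpace Ω] [Fintype ι] [DecidableEq ι]

theorem measurable_det_of_entries {P : Ω → Matrix ι ι ℝ} (hP : ∀ i j, Measurable fun ω => P ω i j) :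
    Measurable fun ω => (P ω).det := by
  simp only [det_apply]
  exact Finset.measurable_fun_sum _ fun σ _ =>
    (Finset.measurable_fun_prod _ fun i _ => hP _ _).const_smul _

theorem measurable_inv_of_entries {P : Ω → Matrix ι ι ℝ} (hP : ∀ i j, Measurable fun ω => P ω i j)
    (i j : ι) : Measurable fun ω => (P ω)⁻¹ i j := by
  simp only [inv_def, Ring.inverse_eq_inv', Matrix.smul_apply, adjugate_apply, smul_eq_mul]
  refine (measurable_det_of_entries hP).inv.mul (measurable_det_of_entries fun a b => ?_)
  by_cases h : a = j
  · subst h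
    simp only [updateRow_self]
    exact measurable_const
  · simp only [updateRow_ne h]
    exact hP a b

theorem measurable_dotProduct_inv {P : Ω → Matrix ι ι ℝ} (hP : ∀ i j, Measurable fun ω => P ω i j)
    {S : Ω → ι → ℝ} (hS : ∀ i, Measurable fun ω => S ω i) :
    Measurable fun ω => S ω ⬝ᵥ (P ω)⁻¹ *ᵥ S ω := by
  simp only [dotProduct, mulVec]
  exact Finset.measurable_fun_sum _ fun i _ => (hS i).mul
    (Finset.measurable_fun_sum _ fun j _ => (measurable_inv_of_entries hP i j).mul (hS j))

theorem measurable_potential {P : Ω → Matrix ι ι ℝ} (hP : ∀ i j, Measurable fun ω => P ω i j)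
    {S : Ω → ι → ℝ} (hS : ∀ i, Measurable fun ω => S ω i) :
    Measurable fun ω => potential (P ω) (S ω) :=
  (((measurable_dotProduct_inv hP hS).const_mul 2).sub
    ((measurable_det_of_entries hP).log.const_mul 2)).exp

end MatrixMeasurability

/-! ### Recursions of the regression data and their dependence on the past only -/

section Regression

variable {n : ℕ} {π : Policy n}

theorem played_congr {x x' : ℕ → Obs n} {t : ℕ} (h : ∀ s < t, x s = x' s) :
    played π x t = played π x' t := by
  simp only [played]
  congr 1
  funext r
  exact h r r.2

theorem regressor_congr {anc : Fin n → Prop} {x x' : ℕ → Obs n} {s : ℕ} (h : x s = x' s) :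
    regressor anc x s = regressor anc x' s := by
  simp only [regressor, h]

/-- The rounds in which `X` is regressed on its estimated ancestors. -/
def rounds (T₀ : ℕ) (a : ℕ → Action n) (X : Node n) (t : ℕ) : Finset ℕ :=
  (Finset.Ico T₀ t).filter fun s => X.bind (a s) = none

theorem rounds_congr {x x' : ℕ → Obs n} {T₀ t : ℕ} {X : Node n} (h : ∀ s < t, x s = x' s) :
    rounds T₀ (played π x) X t = rounds T₀ (played π x') X t := by
  refine Finset.filter_congr fun s hs => ?_
  rw [played_congr fun r hr => h r (hr.trans (Finset.mem_Ico.1 hs).2)]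

theorem lt_of_mem_rounds {a : ℕ → Action n} {T₀ t s : ℕ} {X : Node n}
    (hs : s ∈ rounds T₀ a X t) : s < t :=
  (Finset.mem_Ico.1 (Finset.mem_filter.1 hs).1).2

theorem rounds_succ {a : ℕ → Action n} {T₀ t : ℕ} {X : Node n} (ht : T₀ ≤ t) :
    rounds T₀ a X (t + 1) =
      if X.bind (a t) = none then insert t (rounds T₀ a X t) else rounds T₀ a X t := by
  have : Finset.Ico T₀ (t + 1) = insert t (Finset.Ico T₀ t) := by
    ext s
    simp only [Finset.mem_Ico, Finset.mem_insert]
    omega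
  rw [rounds, this, Finset.filter_insert]
  rfl

theorem self_notMem_rounds {a : ℕ → Action n} {T₀ t : ℕ} {X : Node n} :
    t ∉ rounds T₀ a X t := fun h => lt_irrefl _ (lt_of_mem_rounds h)

theorem gram_eq (anc : Fin n → Prop) (T₀ : ℕ) (x : ℕ → Obs n) (a : ℕ → Action n) (X : Node n)
    (t : ℕ) : gram anc T₀ x a X t = 1 + ∑ s ∈ rounds T₀ a X t,
      Matrix.vecMulVec (regressor anc x s) (regressor anc x s) := rfl

theorem posDef_gram (anc : Fin n → Prop) (T₀ : ℕ) (x : ℕ → Obs n) (a : ℕ → Action n) (X : Node n)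
    (t : ℕ) : (gram anc T₀ x a X t).PosDef :=
  posDef_one_add_sum _ _

theorem gram_succ {anc : Fin n → Prop} {T₀ : ℕ} {x : ℕ → Obs n} {a : ℕ → Action n} {X : Node n}
    {t : ℕ} (ht : T₀ ≤ t) (h : X.bind (a t) = none) :
    gram anc T₀ x a X (t + 1) = gram anc T₀ x a X t +
      Matrix.vecMulVec (regressor anc x t) (regressor anc x t) := by
  rw [gram_eq, gram_eq, rounds_succ ht, if_pos h, Finset.sum_insert self_notMem_rounds]
  abel

theorem gram_succ_of_ne {anc : Fin n → Prop} {T₀ : ℕ} {x : ℕ → Obs n} {a : ℕ → Action n}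
    {X : Node n} {t : ℕ} (ht : T₀ ≤ t) (h : X.bind (a t) ≠ none) :
    gram anc T₀ x a X (t + 1) = gram anc T₀ x a X t := by
  rw [gram_eq, gram_eq, rounds_succ ht, if_neg h]

theorem gram_congr {anc : Fin n → Prop} {T₀ : ℕ} {x x' : ℕ → Obs n} {X : Node n} {t : ℕ}
    (h : ∀ s < t, x s = x' s) :
    gram anc T₀ x (played π x) X t = gram anc T₀ x' (played π x') X t := by
  rw [gram_eq, gram_eq, rounds_congr h]
  congr 1
  exact Finset.sum_congr rfl fun s hs => by rw [regressor_congr (h s (lt_of_mem_rounds hs))]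

theorem moment_congr {anc : Fin n → Prop} {T₀ : ℕ} {x x' : ℕ → Obs n} {X : Node n} {t : ℕ}
    (h : ∀ s < t, x s = x' s) :
    moment anc T₀ x (played π x) X t = moment anc T₀ x' (played π x') X t := by
  change ∑ s ∈ rounds T₀ (played π x) X t, _ = ∑ s ∈ rounds T₀ (played π x') X t, _
  rw [rounds_congr h]
  exact Finset.sum_congr rfl fun s hs => by
    rw [regressor_congr (h s (lt_of_mem_rounds hs)), h s (lt_of_mem_rounds hs)]

end Regression

/-! ### The observed trajectory: dependence on the past and measurability -/

section Trajectory

variable {n : ℕ} [NeZero n]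

/-- The observation in round `t`. -/
def obs (k : Kind) (M : Model n) (π : Policy n) (u : ℕ → Node n → ℝ × ℝ) (t : ℕ) : Obs n :=
  propagate k M.weight (π t (history k M π u t)) (u t)

variable {k : Kind} {M : Model n} {π : Policy n}

theorem history_eq (u : ℕ → Node n → ℝ × ℝ) (t : ℕ) :
    history k M π u t = fun r : Fin t => obs k M π u r := by
  induction t with
  | zero => funext r; exact r.elim0
  | succ t ih =>
    funext r
    refine Fin.lastCases ?_ (fun r => ?_) r
    · simp [history, obs]
    · simp [history, ih]

theorem played_obs (u : ℕ → Node n → ℝ × ℝ) (t : ℕ) :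
    played π (obs k M π u) t = π t (history k M π u t) := by
  rw [played, history_eq]

theorem history_congr {u u' : ℕ → Node n → ℝ × ℝ} {t : ℕ} (h : ∀ s < t, u s = u' s) :
    history k M π u t = history k M π u' t := by
  induction t with
  | zero => rfl
  | succ t ih =>
    simp only [history, ih fun s hs => h s (by omega), h t (by omega)]

theorem history_update (u : ℕ → Node n → ℝ × ℝ) (t : ℕ) (z : Node n → ℝ × ℝ) :
    history k M π (Function.update u t z) t = history k M π u t :=
  history_congr fun s hs => by rw [Function.update_of_ne hs.ne]

theorem obs_update_of_lt (u : ℕ → Node n → ℝ × ℝ) {s t : ℕ} (z : Node n → ℝ × ℝ) (hs : s < t) :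
    obs k M π (Function.update u t z) s = obs k M π u s := by
  have : history k M π (Function.update u t z) s = history k M π u s :=
    history_congr fun r hr => by rw [Function.update_of_ne (by omega)]
  rw [obs, obs, this, Function.update_of_ne hs.ne]

theorem obs_update_self (u : ℕ → Node n → ℝ × ℝ) (t : ℕ) (z : Node n → ℝ × ℝ) :
    obs k M π (Function.update u t z) t =
      propagate k M.weight (played π (obs k M π u) t) z := by
  rw [obs, history_update, Function.update_self, played_obs]

theorem measurable_obs (hπ : ∀ t b, MeasurableSet {h | π t h = b}) (t : ℕ) :
    Measurable fun u => obs k M π u t := by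
  induction t using Nat.strong_induction_on with
  | _ t ih =>
    have hh : Measurable fun u => history k M π u t := by
      simp only [history_eq]
      exact measurable_pi_iff.2 fun r => ih r r.2
    exact measurable_finite_choice (a := fun u => π t (history k M π u t))
      (fun b => hh (hπ t b)) (f := fun b u => propagate k M.weight b (u t))
      fun b => (measurable_propagate k M.weight b).comp (measurable_pi_apply t)

theorem measurableSet_played (hπ : ∀ t b, MeasurableSet {h | π t h = b}) (t : ℕ) (b : Action n) :
    MeasurableSet {u | played π (obs k M π u) t = b} := by
  have hh : Measurable fun u (r : Fin t) => obs k M π u r :=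
    measurable_pi_iff.2 fun r => measurable_obs hπ r
  exact hh (hπ t b)

theorem measurableSet_discovered (hπ : ∀ t b, MeasurableSet {h | π t h = b}) (c₀ c₁ : ℝ)
    (T N : ℕ) (i j : Fin n) :
    MeasurableSet {u | Discovered c₀ c₁ T N (obs k M π u) i j} := by
  simp only [Discovered, Set.ofPred_and]
  refine .inter (.const _) (.inter (.const _) (.inter (.const _) ?_))
  refine measurableSet_lt measurable_const (Finset.measurable_fun_sum _ fun r _ => ?_)
  exact (measurable_pi_iff.1 (measurable_obs hπ _) _).sub
    (measurable_pi_iff.1 (measurable_obs hπ _) _)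

theorem measurableSet_ancHat (hπ : ∀ t b, MeasurableSet {h | π t h = b}) (c₀ c₁ : ℝ)
    (T N : ℕ) (d : Fin n → Node n → Prop) :
    MeasurableSet {u | AncHat c₀ c₁ T N (obs k M π u) = d} := by
  -- The estimated relation is a fixed function of the finitely many test outcomes, so only the
  -- tests need to be measurable.
  let F : (Fin n → Fin n → Prop) → Fin n → Node n → Prop := fun r i X =>
    X.elim True fun j => Relation.TransGen (fun i j => j ≠ 0 ∧ (i = 0 ∨ r i j)) i j
  have hF : ∀ x, AncHat c₀ c₁ T N x = F (Discovered c₀ c₁ T N x) := by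
    intro x
    funext i X
    cases X <;> rfl
  simp only [hF]
  refine measurableSet_finite_choice (a := fun u => Discovered c₀ c₁ T N (obs k M π u))
    (fun r => ?_) (p := fun r _ => F r = d) fun r => .const _
  have : {u | Discovered c₀ c₁ T N (obs k M π u) = r} =
      ⋂ i, ⋂ j, {u | Discovered c₀ c₁ T N (obs k M π u) i j ↔ r i j} := by
    ext u
    simp [funext_iff]
  rw [this]
  exact .iInter fun i => .iInter fun j =>
    (measurableSet_discovered hπ c₀ c₁ T N i j).iff (.const _)

/-- Both blocks of `X_i` end within the discovery phase. The estimated ancestors are therefore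
already fixed when the regression starts. -/
theorem discovered_congr {c₀ c₁ : ℝ} {T N : ℕ} {x x' : ℕ → Obs n}
    (h : ∀ s < 2 * (n - 1) * N, x s = x' s) :
    Discovered c₀ c₁ T N x = Discovered c₀ c₁ T N x' := by
  funext i j
  unfold Discovered
  by_cases hi : i = 0
  · simp [hi]
  have hi1 : 1 ≤ i.val := Nat.one_le_iff_ne_zero.2 fun h => hi (Fin.ext h)
  have hi2 : i.val ≤ n - 1 := by have := i.2; omega
  have : ∑ l ∈ Finset.range N, (x (2 * (i.val - 1) * N + l) (some j) -
        x ((2 * (i.val - 1) + 1) * N + l) (some j)) =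
      ∑ l ∈ Finset.range N, (x' (2 * (i.val - 1) * N + l) (some j) -
        x' ((2 * (i.val - 1) + 1) * N + l) (some j)) := by
    refine Finset.sum_congr rfl fun l hl => ?_
    have hl := Finset.mem_range.1 hl
    have h1 : (2 * (i.val - 1) + 2) * N ≤ 2 * (n - 1) * N := Nat.mul_le_mul_right _ (by omega)
    have h2 : (2 * (i.val - 1) + 2) * N = 2 * (i.val - 1) * N + N + N := by ring
    have h3 : (2 * (i.val - 1) + 1) * N = 2 * (i.val - 1) * N + N := by ring
    rw [h _ (by omega), h _ (by omega)]
  rw [this]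

theorem ancHat_congr {c₀ c₁ : ℝ} {T N : ℕ} {x x' : ℕ → Obs n}
    (h : ∀ s < 2 * (n - 1) * N, x s = x' s) : AncHat c₀ c₁ T N x = AncHat c₀ c₁ T N x' := by
  funext i X
  cases X
  · rfl
  · simp only [AncHat, discovered_congr h]

/-- The sum of the noises in the regression of `X`, multiplied by the regressors. -/
def score (M : Model n) (anc : Fin n → Prop) (T₀ : ℕ) (x : ℕ → Obs n) (a : ℕ → Action n)
    (X : Node n) (t : ℕ) : Fin n → ℝ :=
  ∑ s ∈ rounds T₀ a X t, (x s X - ∑ i, M.weight i X * x s (some i)) • regressor anc x s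

theorem score_congr {anc : Fin n → Prop} {T₀ : ℕ} {x x' : ℕ → Obs n} {X : Node n} {t : ℕ}
    (h : ∀ s < t, x s = x' s) :
    score M anc T₀ x (played π x) X t = score M anc T₀ x' (played π x') X t := by
  rw [score, score, rounds_congr h]
  exact Finset.sum_congr rfl fun s hs => by
    rw [regressor_congr (h s (lt_of_mem_rounds hs)), h s (lt_of_mem_rounds hs)]

theorem score_succ {anc : Fin n → Prop} {T₀ : ℕ} {x : ℕ → Obs n} {a : ℕ → Action n} {X : Node n}
    {t : ℕ} (ht : T₀ ≤ t) (h : X.bind (a t) = none) :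
    score M anc T₀ x a X (t + 1) = score M anc T₀ x a X t +
      (x t X - ∑ i, M.weight i X * x t (some i)) • regressor anc x t := by
  rw [score, score, rounds_succ ht, if_pos h, Finset.sum_insert self_notMem_rounds]
  abel

theorem score_succ_of_ne {anc : Fin n → Prop} {T₀ : ℕ} {x : ℕ → Obs n} {a : ℕ → Action n}
    {X : Node n} {t : ℕ} (ht : T₀ ≤ t) (h : X.bind (a t) ≠ none) :
    score M anc T₀ x a X (t + 1) = score M anc T₀ x a X t := by
  rw [score, score, rounds_succ ht, if_neg h]

theorem measurable_regressor (hπ : ∀ t b, MeasurableSet {h | π t h = b}) (anc : Fin n → Prop)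
    (s : ℕ) (i : Fin n) : Measurable fun u => regressor anc (obs k M π u) s i := by
  by_cases hi : anc i
  · simp only [regressor, Set.indicator_of_mem (show i ∈ {i | anc i} from hi)]
    exact measurable_pi_iff.1 (measurable_obs hπ s) _
  · simp only [regressor, Set.indicator_of_notMem (show i ∉ {i | anc i} from hi)]
    exact measurable_const

theorem measurableSet_bind_played (hπ : ∀ t b, MeasurableSet {h | π t h = b}) (X : Node n)
    (t : ℕ) : MeasurableSet {u | X.bind (played π (obs k M π u) t) = none} :=
  measurableSet_finite_choice (measurableSet_played hπ t) (p := fun b _ => X.bind b = none)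
    fun _ => .const _

theorem measurable_gram (hπ : ∀ t b, MeasurableSet {h | π t h = b}) (anc : Fin n → Prop)
    (T₀ : ℕ) (X : Node n) (t : ℕ) (i j : Fin n) :
    Measurable fun u => gram anc T₀ (obs k M π u) (played π (obs k M π u)) X t i j := by
  simp only [gram_eq, Matrix.add_apply, Matrix.sum_apply]
  simp only [rounds, Finset.sum_filter]
  refine measurable_const.add (Finset.measurable_fun_sum _ fun s _ => ?_)
  exact Measurable.ite (measurableSet_bind_played hπ X s)
    ((measurable_regressor hπ anc s i).mul (measurable_regressor hπ anc s j)) measurable_const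

theorem measurable_score (hπ : ∀ t b, MeasurableSet {h | π t h = b}) (anc : Fin n → Prop)
    (T₀ : ℕ) (X : Node n) (t : ℕ) (i : Fin n) :
    Measurable fun u => score M anc T₀ (obs k M π u) (played π (obs k M π u)) X t i := by
  simp only [score, rounds, Finset.sum_apply, Finset.sum_filter]
  refine Finset.measurable_fun_sum _ fun s _ => ?_
  refine Measurable.ite (measurableSet_bind_played hπ X s) ?_ measurable_const
  have hobs := measurable_pi_iff.1 (measurable_obs (k := k) (M := M) hπ s)
  exact ((hobs X).sub (Finset.measurable_fun_sum _ fun i _ => (hobs _).const_mul _)).mul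
    (measurable_regressor hπ anc s i)

end Trajectory

/-! ### The self-normalized bound and the confidence ellipsoids -/

section Confidence

variable {n : ℕ} [NeZero n]

/-- Estimated ancestors that are consistent with the edges of the model. -/
structure GoodAnc (M : Model n) (d : Fin n → Node n → Prop) : Prop where
  edge : ∀ i X, M.edge i X → d i X
  acyclic : Acyclic d
  trans : ∀ i j X, d i (some j) → d j X → d i X
  not_first : ∀ i, ¬ d i (some 0)

variable {k : Kind} {M : Model n} {d : Fin n → Node n → Prop} {π : Policy n}

theorem GoodAnc.weight_eq_zero (hd : GoodAnc M d) {i : Fin n} {X : Node n} (h : ¬ d i X) :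
    M.weight i X = 0 :=
  M.weight_eq_zero i X fun h' => h (hd.edge i X h')

/-- The estimated ancestors of `X` do not depend on the noise and the threshold of `X`. -/
theorem GoodAnc.propagate_update (hd : GoodAnc M d) (a : Action n) (u : Node n → ℝ × ℝ)
    {X : Node n} (y : ℝ × ℝ) {i : Fin n} (hi : d i X) :
    propagate k M.weight a (Function.update u X y) (some i) = propagate k M.weight a u (some i) := by
  -- The estimated ancestors of `X` are closed under estimated parents by transitivity, and `X` is
  -- not among them by acyclicity.
  refine propagate_congr (D := {Z | ∃ j, Z = some j ∧ d j X}) hd.acyclic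
    (fun _ _ => hd.weight_eq_zero) (fun _ _ => hd.weight_eq_zero) ?_ (fun _ _ _ => rfl) ?_ _
    ⟨i, rfl, hi⟩
  · rintro Z ⟨j, rfl, hj⟩ l hl
    exact ⟨l, rfl, hd.trans l j X hl hj⟩
  · rintro Z ⟨j, rfl, hj⟩
    refine Function.update_of_ne ?_ _ _
    rintro rfl
    exact hd.acyclic j (.single hj)

/-- One round of a regression does not increase the expected potential if the regressors do not
depend on the noise and the threshold of the regressed node. -/
theorem lintegral_potential_resample_le {X : Node n} (hX : X ≠ some 0)
    {V : (Node n → ℝ × ℝ) → Fin n → ℝ} (hVm : ∀ i, Measurable fun z => V z i)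
    (hVup : ∀ z y, V (Function.update z X y) = V z)
    {x : (Node n → ℝ × ℝ) → Fin n → ℝ} (hxm : ∀ i, Measurable fun z => x z i)
    (hxup : ∀ z y, ∑ i, M.weight i X * x (Function.update z X y) i = ∑ i, M.weight i X * x z i)
    (hx0 : ∀ z, x z 0 = 1) (hx : ∀ᵐ z ∂exoLaw M.noise, ∀ i, x z i ∈ Set.Icc (0 : ℝ) 1)
    {P : Matrix (Fin n) (Fin n) ℝ} (hP : P.PosDef) (S : Fin n → ℝ) :
    ∫⁻ z, ENNReal.ofReal (potential (P + Matrix.vecMulVec (V z) (V z))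
      (S + (respond k (∑ i, M.weight i X * x z i + (z X).1) (z X).2 -
          ∑ i, M.weight i X * x z i) • V z)) ∂exoLaw M.noise ≤
      ENNReal.ofReal (potential P S) := by
  have hcm : Measurable fun z => ∑ i, M.weight i X * x z i :=
    Finset.measurable_fun_sum _ fun i _ => (hxm _).const_mul _
  have hrm : Measurable fun z : Node n → ℝ × ℝ =>
      respond k (∑ i, M.weight i X * x z i + (z X).1) (z X).2 :=
    measurable_comp_respond k (hcm.add (by fun_prop)) (by fun_prop)
  have hmeas : Measurable fun z => ENNReal.ofReal (potential (P + Matrix.vecMulVec (V z) (V z))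
      (S + (respond k (∑ i, M.weight i X * x z i + (z X).1) (z X).2 -
          ∑ i, M.weight i X * x z i) • V z)) :=
    (measurable_potential (fun i j => measurable_const.add ((hVm i).mul (hVm j)))
      (fun i => measurable_const.add ((hrm.sub hcm).mul (hVm i)))).ennreal_ofReal
  have h := lintegral_update M.nodeLaw hmeas X
  rw [← M.exoLaw_eq] at h
  rw [h]
  refine (lintegral_mono_ae (g := fun _ => ENNReal.ofReal (potential P S)) ?_).trans (by simp)
  filter_upwards [hx] with z hz
  simp only [hVup, hxup, Function.update_self]
  have hrm' : Measurable fun y : ℝ × ℝ => respond k (∑ i, M.weight i X * x z i + y.1) y.2 :=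
    measurable_comp_respond k (by fun_prop) measurable_snd
  have hrange : ∀ᵐ y ∂M.nodeLaw X,
      respond k (∑ i, M.weight i X * x z i + y.1) y.2 ∈ Set.Icc (0 : ℝ) 1 := by
    filter_upwards [M.ae_node_inRange hX] with y hy
    exact respond_mem_Icc fun _ => hy (x z) (hx0 z) hz
  refine lintegral_potential_update_le (hrm'.sub_const _).aemeasurable
    (M.sum_weight_mul_mem X hz) ?_ ?_ hP _ _
  · filter_upwards [hrange] with y hy
    exact ⟨sub_le_sub_right hy.1 _, sub_le_sub_right hy.2 _⟩
  · rw [integral_sub (Integrable.of_mem_Icc 0 1 hrm'.aemeasurable hrange)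
      (integrable_const _), M.integral_respond k hX (hx0 z) hz]
    simp

theorem measurable_indicator_anc (anc : Fin n → Prop) (k : Kind) (M : Model n) (a : Action n)
    (i : Fin n) : Measurable fun z : Node n → ℝ × ℝ =>
      Set.indicator {i | anc i} (fun i => propagate k M.weight a z (some i)) i := by
  by_cases hi : anc i
  · simp only [Set.indicator_of_mem (show i ∈ {i | anc i} from hi)]
    exact measurable_pi_iff.1 (measurable_propagate k M.weight a) _
  · simp only [Set.indicator_of_notMem (show i ∉ {i | anc i} from hi)]
    exact measurable_const

/-- The regressors are observed in the same round as `X`, yet neither they nor the mean of `X`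
depend on the noise of `X`. It can thus be averaged out with everything else fixed. -/
theorem lintegral_round_potential_le (hd : GoodAnc M d) {X : Node n} (hX : X ≠ some 0)
    {a : Action n} (ha : X.bind a = none) {P : Matrix (Fin n) (Fin n) ℝ} (hP : P.PosDef)
    (S : Fin n → ℝ) :
    ∫⁻ z, ENNReal.ofReal (potential
      (P + Matrix.vecMulVec
        (Set.indicator {i | d i X} fun i => propagate k M.weight a z (some i))
        (Set.indicator {i | d i X} fun i => propagate k M.weight a z (some i)))
      (S + (propagate k M.weight a z X -
          ∑ i, M.weight i X * propagate k M.weight a z (some i)) •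
        (Set.indicator {i | d i X} fun i => propagate k M.weight a z (some i)))) ∂exoLaw M.noise ≤
      ENNReal.ofReal (potential P S) := by
  have hxX : ∀ z, propagate k M.weight a z X =
      respond k (∑ i, M.weight i X * propagate k M.weight a z (some i) + (z X).1) (z X).2 := by
    intro z
    rw [← step_of_bind_eq_none (w := M.weight) hX ha]
    exact (congrFun (M.step_propagate k a z) X).symm
  simp only [hxX]
  refine lintegral_potential_resample_le hX (measurable_indicator_anc _ k M a) ?_
    (x := fun z i => propagate k M.weight a z (some i))
    (fun i => measurable_pi_iff.1 (measurable_propagate k M.weight a) _) ?_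
    (fun z => propagate_first ..) ?_ hP S
  · intro z y
    funext i
    by_cases hi : d i X
    · simp only [Set.indicator_of_mem (show i ∈ {i | d i X} from hi)]
      exact hd.propagate_update a z y hi
    · simp only [Set.indicator_of_notMem (show i ∉ {i | d i X} from hi)]
  · intro z y
    refine Finset.sum_congr rfl fun i _ => ?_
    by_cases hi : d i X
    · rw [hd.propagate_update a z y hi]
    · rw [hd.weight_eq_zero hi, zero_mul, zero_mul]
  · filter_upwards [M.ae_noiseOk] with z hz i using M.propagate_mem_Icc hz _

open Classical in
/-- The potential of the regression of `X`, on the event that the estimated ancestors are good. -/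
def confidencePotential (k : Kind) (M : Model n) (π : Policy n) (c₀ c₁ : ℝ) (T N : ℕ)
    (X : Node n) (t : ℕ) (u : ℕ → Node n → ℝ × ℝ) : ENNReal :=
  if GoodAnc M (AncHat c₀ c₁ T N (obs k M π u)) then
    ENNReal.ofReal (potential
      (gram (fun i => AncHat c₀ c₁ T N (obs k M π u) i X) (2 * (n - 1) * N) (obs k M π u)
        (played π (obs k M π u)) X t)
      (score M (fun i => AncHat c₀ c₁ T N (obs k M π u) i X) (2 * (n - 1) * N) (obs k M π u)
        (played π (obs k M π u)) X t))
  else 0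

variable {c₀ c₁ : ℝ} {T N : ℕ}

theorem measurable_confidencePotential (hπ : ∀ t b, MeasurableSet {h | π t h = b}) (X : Node n)
    (t : ℕ) : Measurable (confidencePotential k M π c₀ c₁ T N X t) := by
  classical
  refine measurable_finite_choice (measurableSet_ancHat (k := k) (M := M) hπ c₀ c₁ T N)
    (f := fun d u => if GoodAnc M d then ENNReal.ofReal (potential
      (gram (fun i => d i X) (2 * (n - 1) * N) (obs k M π u) (played π (obs k M π u)) X t)
      (score M (fun i => d i X) (2 * (n - 1) * N) (obs k M π u) (played π (obs k M π u)) X t))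
      else 0) fun d => ?_
  split_ifs
  · exact (measurable_potential (measurable_gram hπ _ _ X t)
      (measurable_score hπ _ _ X t)).ennreal_ofReal
  · exact measurable_const

/-- The supermartingale property, by resampling round `t` as a whole: past data, the action and the
estimated ancestors stay fixed. Rounds in which `X` is intervened on leave the potential unchanged.
-/
theorem lintegral_confidencePotential_le_one (hπ : ∀ t b, MeasurableSet {h | π t h = b})
    {X : Node n} (hX : X ≠ some 0) {t : ℕ} (ht : 2 * (n - 1) * N ≤ t) :
    ∫⁻ u, confidencePotential k M π c₀ c₁ T N X t u ∂M.law ≤ 1 := by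
  have : IsProbabilityMeasure M.law := by unfold Model.law; infer_instance
  induction t, ht using Nat.le_induction with
  | base =>
    have : ∀ u, confidencePotential k M π c₀ c₁ T N X (2 * (n - 1) * N) u ≤ 1 := by
      intro u
      rw [confidencePotential]
      split_ifs
      · simp [gram, score, rounds, potential]
      · exact zero_le_one
    refine (lintegral_mono this).trans ?_
    simp
  | succ t ht ih =>
    refine le_trans ?_ ih
    rw [Model.law, lintegral_update _ (measurable_confidencePotential hπ X (t + 1)) t]
    refine lintegral_mono fun u => ?_
    have hagree : ∀ z, ∀ s < t, obs k M π (Function.update u t z) s = obs k M π u s :=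
      fun z s hs => obs_update_of_lt u z hs
    have hanc : ∀ z, AncHat c₀ c₁ T N (obs k M π (Function.update u t z)) =
        AncHat c₀ c₁ T N (obs k M π u) := fun z =>
      ancHat_congr fun s hs => hagree z s (hs.trans_le ht)
    have hplay : ∀ z, played π (obs k M π (Function.update u t z)) t =
        played π (obs k M π u) t := fun z => played_congr (hagree z)
    by_cases hd : GoodAnc M (AncHat c₀ c₁ T N (obs k M π u))
    swap
    · have : ∀ z, confidencePotential k M π c₀ c₁ T N X (t + 1) (Function.update u t z) = 0 :=
        fun z => by rw [confidencePotential, if_neg (by rwa [hanc z])]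
      simp [this]
    have hpot : ∀ z, confidencePotential k M π c₀ c₁ T N X (t + 1) (Function.update u t z) =
        ENNReal.ofReal (potential
          (gram (fun i => AncHat c₀ c₁ T N (obs k M π u) i X) (2 * (n - 1) * N)
            (obs k M π (Function.update u t z)) (played π (obs k M π (Function.update u t z))) X
            (t + 1))
          (score M (fun i => AncHat c₀ c₁ T N (obs k M π u) i X) (2 * (n - 1) * N)
            (obs k M π (Function.update u t z)) (played π (obs k M π (Function.update u t z))) X
            (t + 1))) :=
      fun z => by rw [confidencePotential, if_pos (by rwa [hanc z]), hanc z]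
    simp only [hpot]
    rw [confidencePotential, if_pos hd]
    by_cases ha : X.bind (played π (obs k M π u) t) = none
    · have ha' : ∀ z, X.bind (played π (obs k M π (Function.update u t z)) t) = none :=
        fun z => by rw [hplay, ha]
      simp only [gram_succ ht (ha' _), score_succ ht (ha' _), gram_congr (hagree _),
        score_congr (hagree _), regressor, obs_update_self]
      exact lintegral_round_potential_le hd hX ha (posDef_gram _ _ _ _ _ _) _
    · have ha' : ∀ z, X.bind (played π (obs k M π (Function.update u t z)) t) ≠ none :=
        fun z => by rw [hplay]; exact ha
      simp only [gram_succ_of_ne ht (ha' _), score_succ_of_ne ht (ha' _), gram_congr (hagree _),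
        score_congr (hagree _)]
      simp

instance (M : Model n) : IsProbabilityMeasure M.law := by
  unfold Model.law
  infer_instance

theorem ae_forall_noiseOk (M : Model n) : ∀ᵐ u ∂M.law, ∀ t, M.NoiseOk (u t) :=
  ae_all_iff.2 fun t => (measurePreserving_eval_infinitePi (fun _ => exoLaw M.noise)
    t).quasiMeasurePreserving.ae M.ae_noiseOk

theorem obs_mem_Icc {u : ℕ → Node n → ℝ × ℝ} (hu : ∀ t, M.NoiseOk (u t)) (t : ℕ) (X : Node n) :
    obs k M π u t X ∈ Set.Icc (0 : ℝ) 1 :=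
  M.propagate_mem_Icc (hu t) X

theorem regressor_mem_Icc {u : ℕ → Node n → ℝ × ℝ} (hu : ∀ t, M.NoiseOk (u t))
    (anc : Fin n → Prop) (t : ℕ) (i : Fin n) :
    regressor anc (obs k M π u) t i ∈ Set.Icc (0 : ℝ) 1 := by
  by_cases hi : anc i
  · simp only [regressor, Set.indicator_of_mem (show i ∈ {i | anc i} from hi)]
    exact obs_mem_Icc hu _ _
  · simp [regressor, Set.indicator_of_notMem (show i ∉ {i | anc i} from hi)]

theorem log_det_gram_le {u : ℕ → Node n → ℝ × ℝ} (hu : ∀ t, M.NoiseOk (u t))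
    (anc : Fin n → Prop) (T₀ : ℕ) (X : Node n) (t : ℕ) :
    Real.log (gram anc T₀ (obs k M π u) (played π (obs k M π u)) X t).det ≤
      n * Real.log (1 + t * n) := by
  have hcard : (rounds T₀ (played π (obs k M π u)) X t).card ≤ t := by
    refine (Finset.card_filter_le _ _).trans ?_
    simp
  have hn : (1 : ℝ) ≤ n := by exact_mod_cast NeZero.one_le
  have ht : (0 : ℝ) ≤ t := t.cast_nonneg
  have hcard' : ((rounds T₀ (played π (obs k M π u)) X t).card : ℝ) ≤ t := by exact_mod_cast hcard
  have := log_det_one_add_sum_le (rounds T₀ (played π (obs k M π u)) X t)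
    (regressor anc (obs k M π u)) (fun s _ i => regressor_mem_Icc hu anc s i)
    (c := 1 + t * n) (by nlinarith) (by nlinarith)
  simpa [gram_eq] using this

/-- The squared norm of the score is small, for a fixed time and node. -/
theorem measure_score_gt_le (hπ : ∀ t b, MeasurableSet {h | π t h = b})
    {X : Node n} (hX : X ≠ some 0) {t : ℕ} (ht : 2 * (n - 1) * N ≤ t) (L : ℝ) :
    M.law {u | GoodAnc M (AncHat c₀ c₁ T N (obs k M π u)) ∧ n * Real.log (1 + t * n) + 2 * L <
      score M (fun i => AncHat c₀ c₁ T N (obs k M π u) i X) (2 * (n - 1) * N) (obs k M π u)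
        (played π (obs k M π u)) X t ⬝ᵥ
      Matrix.mulVec (gram (fun i => AncHat c₀ c₁ T N (obs k M π u) i X) (2 * (n - 1) * N)
        (obs k M π u) (played π (obs k M π u)) X t)⁻¹
      (score M (fun i => AncHat c₀ c₁ T N (obs k M π u) i X) (2 * (n - 1) * N) (obs k M π u)
        (played π (obs k M π u)) X t)} ≤ ENNReal.ofReal (Real.exp (-(4 * L))) := by
  have h1 := mul_meas_ge_le_lintegral (μ := M.law)
    (measurable_confidencePotential (k := k) (M := M) (c₀ := c₀) (c₁ := c₁) (T := T) (N := N)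
      hπ X t) (ENNReal.ofReal (Real.exp (4 * L)))
  have h2 := h1.trans (lintegral_confidencePotential_le_one hπ hX ht)
  have h3 : M.law {u | ENNReal.ofReal (Real.exp (4 * L)) ≤
      confidencePotential k M π c₀ c₁ T N X t u} ≤ ENNReal.ofReal (Real.exp (-(4 * L))) := by
    rw [Real.exp_neg, ENNReal.ofReal_inv_of_pos (Real.exp_pos _)]
    rw [mul_comm] at h2
    exact ENNReal.le_inv_iff_mul_le.2 h2
  refine (measure_mono_ae ?_).trans h3
  filter_upwards [ae_forall_noiseOk M] with u hu
  rintro ⟨hd, hq⟩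
  have hdet := log_det_gram_le (k := k) (π := π) hu
    (fun i => AncHat c₀ c₁ T N (obs k M π u) i X) (2 * (n - 1) * N) X t
  -- On this event twice the squared norm exceeds `2n log(1+tn) + 4L`. The determinant takes away at
  -- most `2n log(1+tn)`, which leaves the Markov threshold `exp(4L)`.
  change _ ≤ confidencePotential k M π c₀ c₁ T N X t u
  rw [confidencePotential, if_pos hd]
  refine ENNReal.ofReal_le_ofReal ?_
  rw [potential, Real.exp_le_exp]
  linarith

/-- The true weights are candidates if the scores are small. -/
theorem isCandidate_weight (hd : GoodAnc M d) {x : ℕ → Obs n} {a : ℕ → Action n} {T₀ t : ℕ}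
    (hR : 0 ≤ n * Real.log (1 + t * n) + 2 * Real.log (1 / (1 / (n * √(T : ℝ)))))
    (hq : ∀ X, X ≠ some 0 → score M (fun i => d i X) T₀ x a X t ⬝ᵥ
      Matrix.mulVec (gram (fun i => d i X) T₀ x a X t)⁻¹ (score M (fun i => d i X) T₀ x a X t) ≤
        n * Real.log (1 + t * n) + 2 * Real.log (1 / (1 / (n * √(T : ℝ))))) :
    IsCandidate k d T₀ T x a t M.weight := by
  intro X
  refine ⟨fun i => M.weight_mem i X, fun i hi => hd.weight_eq_zero hi,
    fun _ => M.sum_weight_le_one X, ?_⟩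
  set anc : Fin n → Prop := fun i => d i X with hanc
  set G := gram anc T₀ x a X t with hG
  set S := score M anc T₀ x a X t with hS
  set w : Fin n → ℝ := fun i => M.weight i X with hw
  have hpd : G.PosDef := posDef_gram _ _ _ _ _ _
  have hu : IsUnit G.det := hpd.det_pos.ne'.isUnit
  have hqX : S ⬝ᵥ Matrix.mulVec G⁻¹ S ≤
      n * Real.log (1 + t * n) + 2 * Real.log (1 / (1 / (n * √(T : ℝ)))) := by
    by_cases hX : X = some 0
    -- The node `X₁` has no estimated ancestors, so all its regressors vanish.
    · have hS0 : S = 0 := by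
        refine Finset.sum_eq_zero fun s _ => ?_
        have : regressor anc x s = 0 := by
          have hemp : {i | anc i} = ∅ := by
            ext i
            simpa [hanc, hX] using hd.not_first i
          simp only [regressor, hemp, Set.indicator_empty]
          rfl
        rw [this, smul_zero]
      rw [hS0]
      simpa using hR
    · exact hq X hX
  -- From `b = S + (G - 1)w` the error is `w - θ̂ = G⁻¹(w - S)`. Its `G`-norm is the `G⁻¹`-norm of
  -- `w - S`: the part `S` gives the first summand of the radius, the regularization bias `w` gives
  -- `√n`.
  have hmoment : moment anc T₀ x a X t = S + (Matrix.mulVec G w - w) := by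
    have h1 : Matrix.mulVec G w - w =
        ∑ s ∈ rounds T₀ a X t, (∑ i, M.weight i X * x s (some i)) • regressor anc x s := by
      rw [hG, gram_eq, Matrix.add_mulVec, Matrix.one_mulVec, add_sub_cancel_left, Matrix.sum_mulVec]
      refine Finset.sum_congr rfl fun s _ => ?_
      rw [Matrix.vecMulVec_mulVec, op_smul_eq_smul]
      congr 1
      refine Finset.sum_congr rfl fun i _ => ?_
      by_cases hi : d i X
      · rw [regressor, Set.indicator_of_mem (show i ∈ {i | anc i} from hi), mul_comm]
      · rw [hw]
        simp only
        rw [hd.weight_eq_zero hi, zero_mul, mul_zero]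
    rw [h1, hS, score, ← Finset.sum_add_distrib]
    refine Finset.sum_congr rfl fun s _ => ?_
    rw [← add_smul, sub_add_cancel]
  have hdiff : (fun i => M.weight i X - thetaHat anc T₀ x a X t i) =
      Matrix.mulVec G⁻¹ (w - S) := by
    have h2 : Matrix.mulVec G⁻¹ (Matrix.mulVec G w) = w := by
      rw [Matrix.mulVec_mulVec, Matrix.nonsing_inv_mul _ hu, Matrix.one_mulVec]
    change w - thetaHat anc T₀ x a X t = _
    rw [thetaHat, ← hG, hmoment, Matrix.mulVec_add, Matrix.mulVec_sub, Matrix.mulVec_sub, h2]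
    abel
  rw [hdiff, Matrix.mulVec_mulVec, Matrix.mul_nonsing_inv _ hu, Matrix.one_mulVec,
    dotProduct_comm]
  have h3 := sqrt_dotProduct_sub_le hpd.inv.posSemidef w S
  have h4 : w ⬝ᵥ Matrix.mulVec G⁻¹ w ≤ n := by
    refine (dotProduct_inv_one_add_sum_le _ _ _).trans ?_
    have : w ⬝ᵥ w ≤ ∑ _i : Fin n, (1 : ℝ) := Finset.sum_le_sum fun i _ =>
      mul_le_one₀ (M.weight_mem i X).2 (M.weight_mem i X).1 (M.weight_mem i X).2
    simpa using this
  rw [radius]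
  have h5 := Real.sqrt_le_sqrt h4
  have h6 := Real.sqrt_le_sqrt hqX
  linarith

end Confidence

/-! ### Ancestor discovery: means under atomic interventions and Hoeffding's inequality -/

section Discovery

variable {n : ℕ} [NeZero n]

theorem Model.propagate_update_parent (M : Model n) (k : Kind) (a : Action n)
    (u : Node n → ℝ × ℝ) {X : Node n} (y : ℝ × ℝ) {i : Fin n} (hi : M.edge i X) :
    propagate k M.weight a (Function.update u X y) (some i) = propagate k M.weight a u (some i) := by
  obtain ⟨r, hr, -⟩ := M.acyclic.exists_rank
  refine propagate_congr (D := {Z | r Z < r X}) M.acyclic M.weight_eq_zero M.weight_eq_zero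
    (fun Z hZ j hj => (hr j Z hj).trans hZ) (fun _ _ _ => rfl) (fun Z hZ => ?_) _ (hr i X hi)
  refine Function.update_of_ne ?_ _ _
  intro h
  rw [h] at hZ
  exact lt_irrefl (r X) hZ

/-- The mean of a node under an intervention. -/
def Model.mean (M : Model n) (k : Kind) (a : Action n) (X : Node n) : ℝ :=
  ∫ u, propagate k M.weight a u X ∂exoLaw M.noise

theorem Model.ae_propagate_mem (M : Model n) (k : Kind) (a : Action n) (X : Node n) :
    ∀ᵐ u ∂exoLaw M.noise, propagate k M.weight a u X ∈ Set.Icc (0 : ℝ) 1 := by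
  filter_upwards [M.ae_noiseOk] with u hu using M.propagate_mem_Icc hu X

theorem Model.measurable_value (M : Model n) (k : Kind) (a : Action n) (X : Node n) :
    Measurable fun u => propagate k M.weight a u X :=
  measurable_pi_iff.1 (measurable_propagate k M.weight a) X

theorem Model.integrable_value (M : Model n) (k : Kind) (a : Action n) (X : Node n) :
    Integrable (fun u => propagate k M.weight a u X) (exoLaw M.noise) :=
  Integrable.of_mem_Icc 0 1 (M.measurable_value k a X).aemeasurable (M.ae_propagate_mem k a X)

theorem Model.mean_first (M : Model n) (k : Kind) (a : Action n) : M.mean k a (some 0) = 1 := by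
  simp [Model.mean, propagate_first]

theorem Model.mean_of_bind_eq_some (M : Model n) (k : Kind) {a : Action n} {X : Node n}
    (hX : X ≠ some 0) {b : Bool} (hb : X.bind a = some b) :
    M.mean k a X = if b then 1 else 0 := by
  have : ∀ u, propagate k M.weight a u X = if b then 1 else 0 := fun u => by
    rw [← step_of_bind_eq_some (w := M.weight) (k := k) hX hb]
    exact (congrFun (M.step_propagate k a u) X).symm
  simp [Model.mean, this]

/-- After averaging out the noise and threshold of `X`, what remains is linear in the parents, so
their correlations do not matter and the two kinds have the same means. -/
theorem Model.mean_of_bind_eq_none (M : Model n) (k : Kind) {a : Action n} {X : Node n}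
    (hX : X ≠ some 0) (hb : X.bind a = none) :
    M.mean k a X = ∑ i, M.weight i X * M.mean k a (some i) := by
  have hval : ∀ u, propagate k M.weight a u X =
      respond k (∑ i, M.weight i X * propagate k M.weight a u (some i) + (u X).1) (u X).2 := by
    intro u
    rw [← step_of_bind_eq_none (w := M.weight) hX hb]
    exact (congrFun (M.step_propagate k a u) X).symm
  have hup : ∀ u y, ∑ i, M.weight i X * propagate k M.weight a (Function.update u X y) (some i) =
      ∑ i, M.weight i X * propagate k M.weight a u (some i) := by
    intro u y
    refine Finset.sum_congr rfl fun i _ => ?_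
    by_cases hi : M.edge i X
    · rw [M.propagate_update_parent k a u y hi]
    · rw [M.weight_eq_zero i X hi, zero_mul, zero_mul]
  have h := integral_update M.nodeLaw (f := fun u => propagate k M.weight a u X)
    (by rw [← M.exoLaw_eq]; exact M.integrable_value k a X) X
  rw [← M.exoLaw_eq] at h
  have h2 : ∀ᵐ u ∂exoLaw M.noise,
      ∫ z, propagate k M.weight a (Function.update u X z) X ∂M.nodeLaw X =
        ∑ i, M.weight i X * propagate k M.weight a u (some i) := by
    filter_upwards [M.ae_noiseOk] with u hu
    simp only [hval, hup, Function.update_self]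
    exact M.integral_respond k hX (propagate_first ..) fun i => M.propagate_mem_Icc hu _
  rw [Model.mean, h, integral_congr_ae h2, integral_finsetSum _ fun i _ =>
    (M.integrable_value k a _).const_mul _]
  simp only [integral_const_mul, Model.mean]

theorem bind_atomic_self {m : ℕ} (i : Fin m) (b : Bool) : (some i).bind (atomic i b) = some b := by
  simp [atomic]

theorem bind_atomic_of_ne {m : ℕ} {i : Fin m} {X : Node m} (h : X ≠ some i) (b : Bool) :
    X.bind (atomic i b) = none := by
  cases X with
  | none => rfl
  | some j =>
    have : j ≠ i := fun h' => h (by rw [h'])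
    simp [atomic, nullAction, this]

theorem Model.mean_atomic_mono (M : Model n) (k : Kind) (i : Fin n) (X : Node n) :
    M.mean k (atomic i false) X ≤ M.mean k (atomic i true) X := by
  refine M.acyclic.induction (p := fun X => M.mean k (atomic i false) X ≤
    M.mean k (atomic i true) X) (fun X ih => ?_) X
  by_cases hX : X = some 0
  · rw [hX, mean_first, mean_first]
  by_cases hXi : X = some i
  · subst hXi
    rw [M.mean_of_bind_eq_some k hX (bind_atomic_self i _),
      M.mean_of_bind_eq_some k hX (bind_atomic_self i _)]
    simp
  · rw [M.mean_of_bind_eq_none k hX (bind_atomic_of_ne hXi _),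
      M.mean_of_bind_eq_none k hX (bind_atomic_of_ne hXi _)]
    refine Finset.sum_le_sum fun l _ => ?_
    by_cases hl : M.edge l X
    · exact mul_le_mul_of_nonneg_left (ih l hl) (M.weight_mem l X).1
    · rw [M.weight_eq_zero l X hl, zero_mul, zero_mul]

/-- The summand of `X_i` contributes exactly its weight, since the mean of `X_i` jumps from `0` to
`1`; by monotonicity the other summands are nonnegative. -/
theorem Model.weight_le_mean_sub (M : Model n) (k : Kind) {i : Fin n} (hi : i ≠ 0) {X : Node n}
    (hX : X ≠ some 0) (hXi : X ≠ some i) :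
    M.weight i X ≤ M.mean k (atomic i true) X - M.mean k (atomic i false) X := by
  rw [M.mean_of_bind_eq_none k hX (bind_atomic_of_ne hXi _),
    M.mean_of_bind_eq_none k hX (bind_atomic_of_ne hXi _), ← Finset.sum_sub_distrib]
  have h := Finset.single_le_sum (f := fun l => M.weight l X * M.mean k (atomic i true) (some l) -
    M.weight l X * M.mean k (atomic i false) (some l)) (fun l _ => by
      rw [← mul_sub]
      exact mul_nonneg (M.weight_mem l X).1 (sub_nonneg.2 (M.mean_atomic_mono k i _)))
    (Finset.mem_univ i)
  have hi0 : (some i : Node n) ≠ some 0 := fun h => hi (Option.some.inj h)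
  simp only [M.mean_of_bind_eq_some k hi0 (bind_atomic_self i _)] at h
  simpa using h

/-- Parents of a node that is neither `X_i` nor a descendant of it have the same property, so the
equality propagates along the graph. -/
theorem Model.mean_atomic_eq (M : Model n) (k : Kind) {i : Fin n} (X : Node n) :
    (∀ j, X = some j → j ≠ i ∧ ¬ Relation.TransGen (fun i j => M.edge i (some j)) i j) →
      X ≠ none → M.mean k (atomic i true) X = M.mean k (atomic i false) X := by
  refine M.acyclic.induction (p := fun X => (∀ j, X = some j → j ≠ i ∧
    ¬ Relation.TransGen (fun i j => M.edge i (some j)) i j) → X ≠ none →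
    M.mean k (atomic i true) X = M.mean k (atomic i false) X) (fun X ih hX hXn => ?_) X
  obtain ⟨j, rfl⟩ := Option.ne_none_iff_exists'.1 hXn
  obtain ⟨hji, hj⟩ := hX j rfl
  by_cases h0 : (some j : Node n) = some 0
  · rw [h0, mean_first, mean_first]
  have hne : (some j : Node n) ≠ some i := fun h => hji (Option.some.inj h)
  rw [M.mean_of_bind_eq_none k h0 (bind_atomic_of_ne hne _),
    M.mean_of_bind_eq_none k h0 (bind_atomic_of_ne hne _)]
  refine Finset.sum_congr rfl fun l _ => ?_
  by_cases hl : M.edge l (some j)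
  · rw [ih l hl ?_ (Option.some_ne_none l)]
    rintro _ ⟨⟩
    refine ⟨?_, fun h => hj (h.tail hl)⟩
    rintro rfl
    exact hj (.single hl)
  · rw [M.weight_eq_zero l _ hl, zero_mul, zero_mul]

open ProbabilityTheory in
/-- **Hoeffding's inequality** for functions of the exogenous variables of consecutive rounds. -/
theorem hoeffding_rounds (M : Model n) {g : ℕ → (Node n → ℝ × ℝ) → ℝ}
    (hg : ∀ s, Measurable (g s)) {lo : ℕ → ℝ}
    (hb : ∀ s, ∀ᵐ z ∂exoLaw M.noise, g s z ∈ Set.Icc (lo s) (lo s + 1)) (a m : ℕ) {ε : ℝ}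
    (hε : 0 ≤ ε) :
    M.law.real {u | ε ≤ ∑ s ∈ Finset.range m, (g s (u (a + s)) - ∫ z, g s z ∂exoLaw M.noise)} ≤
      Real.exp (-(2 * ε ^ 2 / m)) := by
  have hind : iIndepFun (fun s (u : ℕ → Node n → ℝ × ℝ) =>
      g s (u (a + s)) - ∫ z, g s z ∂exoLaw M.noise) M.law := by
    have h1 := iIndepFun_infinitePi (P := fun _ : ℕ => exoLaw M.noise)
      (X := fun s z => g (s - a) z - ∫ z, g (s - a) z ∂exoLaw M.noise)
      fun s => (hg _).sub_const _
    have h2 := h1.precomp (g := fun s => a + s) (fun s t h => by simpa using h)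
    simpa [Model.law] using h2
  have hsub : ∀ s, HasSubgaussianMGF (fun u : ℕ → Node n → ℝ × ℝ =>
      g s (u (a + s)) - ∫ z, g s z ∂exoLaw M.noise) ((‖(lo s + 1) - lo s‖₊ / 2) ^ 2) M.law := by
    intro s
    have h1 := hasSubgaussianMGF_of_mem_Icc (hg s).aemeasurable (hb s)
    have hmp : Measure.map (fun u : ℕ → Node n → ℝ × ℝ => u (a + s)) M.law = exoLaw M.noise :=
      (measurePreserving_eval_infinitePi (fun _ => exoLaw M.noise) (a + s)).map_eq
    rw [← hmp] at h1
    have h2 := HasSubgaussianMGF.of_map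
      (measurable_pi_apply (a + s) : Measurable fun u : ℕ → Node n → ℝ × ℝ => u (a + s)).aemeasurable h1
    rwa [hmp] at h2
  have h := HasSubgaussianMGF.measure_sum_range_ge_le_of_iIndepFun hind (c := 1 / 4) (n := m)
    (fun s _ => by
      have := hsub s
      rwa [add_sub_cancel_left, nnnorm_one, show ((1 : NNReal) / 2) ^ 2 = 1 / 4 by
        rw [div_pow]; norm_num] at this) hε
  refine h.trans (le_of_eq ?_)
  congr 1
  by_cases hm : (m : ℝ) = 0
  · simp [hm]
  · push_cast
    field_simp
    norm_num

variable {c₀ c₁ : ℝ} {T N : ℕ} {A : Set (Action n)} {k : Kind} {π : Policy n} {M : Model n}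

/-- The two blocks of `X_i` are adjacent, so the statistic is a single signed sum over `2N`
consecutive independent rounds. -/
theorem discovery_sum_eq (hπ : IsBLMLRUnknownSG k c₀ c₁ T N A π) {i : Fin n} (hi : i ≠ 0)
    (j : Fin n) (u : ℕ → Node n → ℝ × ℝ) :
    ∑ l ∈ Finset.range N, (obs k M π u (2 * (i.val - 1) * N + l) (some j) -
        obs k M π u ((2 * (i.val - 1) + 1) * N + l) (some j)) =
      ∑ s ∈ Finset.range (N + N), (if s < N then
        propagate k M.weight (atomic i true) (u (2 * (i.val - 1) * N + s)) (some j)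
        else -propagate k M.weight (atomic i false) (u (2 * (i.val - 1) * N + s)) (some j)) := by
  rw [Finset.sum_range_add, ← Finset.sum_add_distrib]
  refine Finset.sum_congr rfl fun l hl => ?_
  have hl := Finset.mem_range.1 hl
  rw [if_pos hl, if_neg (by omega), obs, obs, hπ.discovery_one i hi l hl,
    hπ.discovery_zero i hi l hl]
  have : (2 * (i.val - 1) + 1) * N + l = 2 * (i.val - 1) * N + (N + l) := by ring
  rw [this]
  ring

/-- The signed observation of `X_j` in the two blocks of `X_i`. -/
def signedValue (k : Kind) (M : Model n) (i : Fin n) (X : Node n) (N : ℕ) (σ : ℝ) (s : ℕ)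
    (z : Node n → ℝ × ℝ) : ℝ :=
  if s < N then σ * propagate k M.weight (atomic i true) z X
  else -σ * propagate k M.weight (atomic i false) z X

theorem sum_integral_signedValue (i : Fin n) (X : Node n) (σ : ℝ) :
    ∑ s ∈ Finset.range (N + N), ∫ z, signedValue k M i X N σ s z ∂exoLaw M.noise =
      σ * (N * (M.mean k (atomic i true) X - M.mean k (atomic i false) X)) := by
  have h1 : ∀ s ∈ Finset.range N, ∫ z, signedValue k M i X N σ s z ∂exoLaw M.noise =
      σ * M.mean k (atomic i true) X := fun s hs => by
    simp only [signedValue, if_pos (Finset.mem_range.1 hs), integral_const_mul]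
    rfl
  have h2 : ∀ s ∈ Finset.range N, ∫ z, signedValue k M i X N σ (N + s) z ∂exoLaw M.noise =
      -σ * M.mean k (atomic i false) X := fun s hs => by
    simp only [signedValue, if_neg (show ¬ N + s < N by omega), integral_const_mul]
    rfl
  rw [Finset.sum_range_add, Finset.sum_congr rfl h1, Finset.sum_congr rfl h2]
  simp only [Finset.sum_const, Finset.card_range, nsmul_eq_mul]
  ring

/-- Hoeffding's inequality with `2N` summands of range `1`, which gives `exp(-2ε²/(2N))`. The sign
`σ` covers both tails. -/
theorem measure_signed_ge_le (M : Model n) (k : Kind) (i : Fin n) (X : Node n) (N a : ℕ) {σ : ℝ}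
    (hσ : σ = 1 ∨ σ = -1) {ε : ℝ} (hε : 0 ≤ ε) :
    M.law.real {u | ε ≤ ∑ s ∈ Finset.range (N + N), signedValue k M i X N σ s (u (a + s)) -
      σ * (N * (M.mean k (atomic i true) X - M.mean k (atomic i false) X))} ≤
      Real.exp (-(ε ^ 2 / N)) := by
  have h := hoeffding_rounds M (g := signedValue k M i X N σ)
    (lo := fun s => if s < N ↔ σ = 1 then 0 else -1) (fun s => ?_) (fun s => ?_) a (N + N) hε
  · simp only [Finset.sum_sub_distrib, sum_integral_signedValue] at h
    refine h.trans (le_of_eq ?_)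
    congr 2
    by_cases hN : (N : ℝ) = 0
    · simp [hN]
    · push_cast
      field_simp
      ring
  · unfold signedValue
    split_ifs
    · exact (M.measurable_value k _ X).const_mul _
    · exact (M.measurable_value k _ X).const_mul _
  · filter_upwards [M.ae_propagate_mem k (atomic i true) X,
      M.ae_propagate_mem k (atomic i false) X] with z h1 h0
    by_cases hs : s < N <;> rcases hσ with rfl | rfl <;>
      simp only [signedValue, hs, if_true, if_false, true_iff, false_iff, not_true,
        show ¬ ((-1 : ℝ) = 1) by norm_num, Set.mem_Icc] <;>
      constructor <;> linarith [h1.1, h1.2, h0.1, h0.2]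

/-- The test is wrong for the pair `X_i`, `X_j`. -/
def WrongTest (M : Model n) (D : Fin n → Fin n → Prop) (i j : Fin n) : Prop :=
  (M.edge i (some j) ∧ i ≠ 0 ∧ ¬ D i j) ∨
    (¬ Relation.TransGen (fun i j => M.edge i (some j)) i j ∧ D i j)

/-- Declared pairs are true ancestor pairs, and `X₁` is never a descendant, so a cycle of the
estimate would be a cycle of the true graph. Edges are all declared, and the closure supplies
transitivity. -/
theorem goodAnc_of_tests (x : ℕ → Obs n)
    (h : ∀ i j, ¬ WrongTest M (Discovered c₀ c₁ T N x) i j) :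
    GoodAnc M (AncHat c₀ c₁ T N x) := by
  set R : Fin n → Fin n → Prop := fun i j => j ≠ 0 ∧ (i = 0 ∨ Discovered c₀ c₁ T N x i j) with hR
  have hsome : ∀ i j, AncHat c₀ c₁ T N x i (some j) = Relation.TransGen R i j := fun _ _ => rfl
  have htarget : ∀ i j, Relation.TransGen R i j → j ≠ 0 := by
    intro i j hij
    cases hij with
    | single h => exact h.1
    | tail _ h => exact h.1
  have hanc : ∀ i j, Relation.TransGen R i j → i ≠ 0 →
      Relation.TransGen (fun i j => M.edge i (some j)) i j := by
    have hstep : ∀ i j, R i j → i ≠ 0 → Relation.TransGen (fun i j => M.edge i (some j)) i j := by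
      intro i j hij hi
      have hD := hij.2.resolve_left hi
      by_contra hT
      exact h i j (Or.inr ⟨hT, hD⟩)
    intro i j hij hi
    induction hij with
    | single h => exact hstep _ _ h hi
    | tail h h' ih => exact ih.trans (hstep _ _ h' (htarget _ _ h))
  constructor
  · rintro i (_ | j) hij
    · trivial
    · rw [hsome]
      refine .single ⟨?_, ?_⟩
      · rintro rfl
        exact M.not_edge_first i hij
      · by_contra hcon
        push Not at hcon
        exact h i j (Or.inl ⟨hij, hcon.1, hcon.2⟩)
  · intro i hi
    simp only [hsome] at hi
    have hi' : Relation.TransGen R i i := by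
      rwa [Relation.transGen_eq_self (r := Relation.TransGen R)] at hi
    exact M.acyclic i (hanc i i hi' (htarget i i hi'))
  · rintro i j (_ | l) hij hjl
    · trivial
    · exact Relation.TransGen.trans hij hjl
  · intro i hi
    exact htarget i 0 hi rfl

theorem Model.kappa_eq_one (M : Model n) : M.kappa = 1 := by
  have : {r | ∃ (X : Node n) (v θ : Fin n → ℝ), (∀ i, v i ∈ Set.Icc (0 : ℝ) 1) ∧
    (∀ i, ¬ M.edge i X → θ i = 0) ∧ √(∑ i, (θ i - M.weight i X) ^ 2) ≤ 1 ∧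
    r = deriv (fun z : ℝ => z) (∑ i, v i * θ i)} = {1} := by
    ext r
    simp only [Set.mem_ofPred_eq, Set.mem_singleton_iff, deriv_id'']
    constructor
    · rintro ⟨_, _, _, _, _, _, h⟩
      exact h
    · intro h
      exact ⟨none, 0, fun i => M.weight i none, by simp, fun i => M.weight_eq_zero i none,
        by simp, h⟩
  rw [Model.kappa, this, csInf_singleton]

theorem Model.thetaMin_le (M : Model n) {i : Fin n} {X : Node n} (h : M.edge i X) :
    M.thetaMin ≤ M.weight i X := by
  refine csInf_le ⟨0, ?_⟩ ⟨i, X, h, rfl⟩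
  rintro _ ⟨i, X, _, rfl⟩
  exact (M.weight_mem i X).1

/-- The statistic has mean at least `2τ` for an edge and `0` for a non-descendant, so either error
forces a deviation of at least the threshold `τ`. The remaining pairs cannot be wrong. -/
theorem measure_wrongTest_le (hπ : IsBLMLRUnknownSG k c₀ c₁ T N A π) (hc₀ : 0 < c₀)
    (hc₁ : 0 < c₁)
    (hτ : 2 * (c₀ * c₁ * (T : ℝ) ^ (3 / 10 : ℝ)) ≤ N * M.thetaMin) (i j : Fin n) :
    M.law.real {u | WrongTest M (Discovered c₀ c₁ T N (obs k M π u)) i j} ≤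
      Real.exp (-((c₀ * c₁ * (T : ℝ) ^ (3 / 10 : ℝ)) ^ 2 / N)) := by
  set τ := c₀ * c₁ * (T : ℝ) ^ (3 / 10 : ℝ) with hτd
  have hτ0 : 0 ≤ τ := by positivity
  have hsum : ∀ (hi : i ≠ 0) (σ : ℝ) u, ∑ s ∈ Finset.range (N + N),
      signedValue k M i (some j) N σ s (u (2 * (i.val - 1) * N + s)) =
      σ * ∑ l ∈ Finset.range N, (obs k M π u (2 * (i.val - 1) * N + l) (some j) -
        obs k M π u ((2 * (i.val - 1) + 1) * N + l) (some j)) := by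
    intro hi σ u
    rw [discovery_sum_eq hπ hi, Finset.mul_sum]
    refine Finset.sum_congr rfl fun s _ => ?_
    unfold signedValue
    split_ifs <;> ring
  by_cases hE : M.edge i (some j) ∧ i ≠ 0
  · obtain ⟨hE, hi⟩ := hE
    have hj : (some j : Node n) ≠ some 0 := fun h => M.not_edge_first i (h ▸ hE)
    have hij : (some j : Node n) ≠ some i := fun h => M.acyclic i (.single (h ▸ hE))
    have hT : Relation.TransGen (fun i j => M.edge i (some j)) i j := .single hE
    refine le_trans (measureReal_mono ?_ (measure_ne_top _ _))
      (measure_signed_ge_le M k i (some j) N (2 * (i.val - 1) * N) (Or.inr rfl) hτ0)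
    rintro u (⟨-, -, hD⟩ | ⟨h, -⟩)
    · have hle : ∑ l ∈ Finset.range N, (obs k M π u (2 * (i.val - 1) * N + l) (some j) -
          obs k M π u ((2 * (i.val - 1) + 1) * N + l) (some j)) ≤ τ := by
        by_contra hcon
        exact hD ⟨hi, fun h => hj (by rw [h]), fun h => hij (by rw [h]), not_le.1 hcon⟩
      rw [Set.mem_ofPred_eq, hsum hi]
      have h1 := M.weight_le_mean_sub k hi hj hij
      have h2 := M.thetaMin_le hE
      have h3 : (N : ℝ) * M.thetaMin ≤ N * (M.mean k (atomic i true) (some j) -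
          M.mean k (atomic i false) (some j)) :=
        mul_le_mul_of_nonneg_left (h2.trans h1) N.cast_nonneg
      linarith
    · exact absurd hT h
  · by_cases hT : ¬ Relation.TransGen (fun i j => M.edge i (some j)) i j ∧ i ≠ 0 ∧ j ≠ i
    · obtain ⟨hT, hi, hji⟩ := hT
      refine le_trans (measureReal_mono ?_ (measure_ne_top _ _))
        (measure_signed_ge_le M k i (some j) N (2 * (i.val - 1) * N) (Or.inl rfl) hτ0)
      rintro u (⟨h, h', -⟩ | ⟨-, hD⟩)
      · exact absurd ⟨h, h'⟩ hE
      · rw [Set.mem_ofPred_eq, hsum hi]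
        have hmean := M.mean_atomic_eq k (i := i) (some j)
          (by rintro _ ⟨⟩; exact ⟨hji, hT⟩) (Option.some_ne_none j)
        rw [hmean, sub_self, mul_zero, mul_zero, one_mul, sub_zero]
        exact hD.2.2.2.le
    · have hempty : {u | WrongTest M (Discovered c₀ c₁ T N (obs k M π u)) i j} = ∅ := by
        refine Set.eq_empty_iff_forall_notMem.2 fun u hu => ?_
        rcases hu with ⟨h, h', -⟩ | ⟨h, hD⟩
        · exact hE ⟨h, h'⟩
        · exact hT ⟨h, hD.1, fun h => hD.2.2.1 h.symm⟩
      rw [hempty, measureReal_empty]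
      exact (Real.exp_pos _).le

/-- The discovery phase fails with small probability. -/
theorem measure_not_goodAnc_le (hπ : IsBLMLRUnknownSG k c₀ c₁ T N A π) (hc₀ : 0 < c₀)
    (hc₁ : 0 < c₁) (hN : (N : ℝ) = c₀ * √(T : ℝ)) (hN0 : 0 < N) (hθ : 0 < M.thetaMin)
    (hT : 32 * (c₁ / (M.kappa * M.thetaMin)) ^ 5 ≤ (T : ℝ)) :
    M.law.real {u | ¬ GoodAnc M (AncHat c₀ c₁ T N (obs k M π u))} ≤
      n ^ 2 * Real.exp (-(c₀ * c₁ ^ 2 * (T : ℝ) ^ (1 / 10 : ℝ))) := by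
  set p := (T : ℝ) ^ (1 / 10 : ℝ) with hp
  have hTpos : (0 : ℝ) ≤ T := T.cast_nonneg
  have hp0 : 0 ≤ p := Real.rpow_nonneg hTpos _
  have hp3 : (T : ℝ) ^ (3 / 10 : ℝ) = p ^ 3 := by
    rw [hp, ← Real.rpow_mul_natCast hTpos]; norm_num
  have hp5 : √(T : ℝ) = p ^ 5 := by
    rw [Real.sqrt_eq_rpow, hp, ← Real.rpow_mul_natCast hTpos]; norm_num
  have hp10 : (T : ℝ) = p ^ 10 := by
    rw [hp, ← Real.rpow_mul_natCast hTpos]; norm_num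
  have hNpos : (0 : ℝ) < N := by exact_mod_cast hN0
  have hppos : 0 < p := by
    rcases hp0.lt_or_eq with h | h
    · exact h
    · rw [hN, hp5, ← h] at hNpos
      simp at hNpos
  rw [M.kappa_eq_one, one_mul, hp10] at hT
  -- In terms of `p = T^{1/10}` the threshold is `c₀c₁p³` and `N = c₀p⁵`. The assumption on `T` is
  -- the fifth power of this inequality, as `32 = 2⁵`.
  have h2 : 2 * c₁ / M.thetaMin ≤ p ^ 2 := by
    refine le_of_pow_le_pow_left₀ (n := 5) (by norm_num) (by positivity) ?_
    calc (2 * c₁ / M.thetaMin) ^ 5 = 32 * (c₁ / M.thetaMin) ^ 5 := by ring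
      _ ≤ p ^ 10 := hT
      _ = (p ^ 2) ^ 5 := by ring
  rw [div_le_iff₀ hθ] at h2
  have hτ : 2 * (c₀ * c₁ * (T : ℝ) ^ (3 / 10 : ℝ)) ≤ N * M.thetaMin := by
    rw [hp3, hN, hp5]
    calc 2 * (c₀ * c₁ * p ^ 3) = c₀ * p ^ 3 * (2 * c₁) := by ring
      _ ≤ c₀ * p ^ 3 * (p ^ 2 * M.thetaMin) := by gcongr
      _ = c₀ * p ^ 5 * M.thetaMin := by ring
  have hexp : (c₀ * c₁ * (T : ℝ) ^ (3 / 10 : ℝ)) ^ 2 / N = c₀ * c₁ ^ 2 * p := by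
    rw [hp3, hN, hp5]
    field_simp
  have hsub : {u | ¬ GoodAnc M (AncHat c₀ c₁ T N (obs k M π u))} ⊆
      ⋃ q : Fin n × Fin n, {u | WrongTest M (Discovered c₀ c₁ T N (obs k M π u)) q.1 q.2} := by
    intro u hu
    by_contra hcon
    refine hu (goodAnc_of_tests _ fun i j h => hcon ?_)
    exact Set.mem_iUnion.2 ⟨(i, j), h⟩
  refine (measureReal_mono hsub (measure_ne_top _ _)).trans ?_
  refine (measureReal_iUnion_fintype_le _).trans ?_
  refine (Finset.sum_le_sum fun q _ => measure_wrongTest_le hπ hc₀ hc₁ hτ q.1 q.2).trans ?_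
  rw [hexp]
  simp [sq]

end Discovery

/-! ### Geometry of the confidence ellipsoid -/

section Ellipsoid

open Matrix

variable {n T : ℕ} {k : Kind} {π : Policy n} {d : Fin n → Node n → Prop}

theorem isCandidate_congr {x x' : ℕ → Obs n} {T₀ t : ℕ} (h : ∀ s < t, x s = x' s)
    {w : Fin n → Node n → ℝ} :
    IsCandidate k d T₀ T x (played π x) t w ↔ IsCandidate k d T₀ T x' (played π x') t w := by
  simp only [IsCandidate, thetaHat, gram_congr h, moment_congr h]

theorem radius_nonneg (n T t : ℕ) : 0 ≤ radius n T t := by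
  unfold radius
  positivity

theorem one_le_radius (n T t : ℕ) (hn : 1 ≤ n) : 1 ≤ radius n T t := by
  have : (1 : ℝ) ≤ √(n : ℝ) := Real.one_le_sqrt.2 (by exact_mod_cast hn)
  unfold radius
  linarith [Real.sqrt_nonneg (n * Real.log (1 + t * n) +
    2 * Real.log (1 / (1 / (n * √(T : ℝ)))))]

theorem radius_mono (n T : ℕ) {s t : ℕ} (h : s ≤ t) : radius n T s ≤ radius n T t := by
  unfold radius
  gcongr

/-- Both weight vectors are within one radius of the centre, hence the factor `2`; Cauchy-Schwarz
pairs the Gram norm with its dual. Weights vanish off the estimated ancestors, so only the regressor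
part of `y` counts. -/
theorem abs_sum_le_of_isCandidate {T₀ t : ℕ} {x : ℕ → Obs n} {a : ℕ → Action n}
    {w w' : Fin n → Node n → ℝ} (hw : IsCandidate k d T₀ T x a t w)
    (hw' : IsCandidate k d T₀ T x a t w') (X : Node n) (y : Obs n) :
    |∑ i, (w i X - w' i X) * y (some i)| ≤ 2 * radius n T t *
      √((Set.indicator {i | d i X} fun i => y (some i)) ⬝ᵥ
        (gram (fun i => d i X) T₀ x a X t)⁻¹ *ᵥ (Set.indicator {i | d i X} fun i => y (some i))) := by
  set G := gram (fun i => d i X) T₀ x a X t with hG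
  set V : Fin n → ℝ := Set.indicator {i | d i X} fun i => y (some i) with hV
  have hpd : G.PosDef := posDef_gram _ _ _ _ _ _
  set v : Fin n → ℝ := fun i => w i X - thetaHat (fun i => d i X) T₀ x a X t i with hv
  set v' : Fin n → ℝ := fun i => w' i X - thetaHat (fun i => d i X) T₀ x a X t i with hv'
  have h1 : ∑ i, (w i X - w' i X) * y (some i) = (v - v') ⬝ᵥ V := by
    refine Finset.sum_congr rfl fun i _ => ?_
    by_cases hi : d i X
    · rw [hV, Set.indicator_of_mem (show i ∈ {i | d i X} from hi)]
      simp [hv, hv']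
    · rw [hV, Set.indicator_of_notMem (show i ∉ {i | d i X} from hi), (hw X).2.1 i hi,
        (hw' X).2.1 i hi]
      simp
  have h2 := dotProduct_sq_le hpd (v - v') V
  have h3 := sqrt_dotProduct_sub_le hpd.posSemidef v v'
  have h4 : √(v ⬝ᵥ G *ᵥ v) ≤ radius n T t := (hw X).2.2.2
  have h5 : √(v' ⬝ᵥ G *ᵥ v') ≤ radius n T t := (hw' X).2.2.2
  rw [h1]
  calc |(v - v') ⬝ᵥ V| ≤ √(((v - v') ⬝ᵥ G *ᵥ (v - v')) * (V ⬝ᵥ G⁻¹ *ᵥ V)) := Real.abs_le_sqrt h2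
    _ = √((v - v') ⬝ᵥ G *ᵥ (v - v')) * √(V ⬝ᵥ G⁻¹ *ᵥ V) :=
      Real.sqrt_mul' _ (dotProduct_inv_mulVec_nonneg hpd V)
    _ ≤ 2 * radius n T t * √(V ⬝ᵥ G⁻¹ *ᵥ V) := by
      gcongr
      linarith

/-- Telescoping with the matrix determinant lemma, starting from the identity matrix. -/
theorem sum_log_eq_log_det {anc : Fin n → Prop} {T₀ : ℕ} {x : ℕ → Obs n} {a : ℕ → Action n}
    {X : Node n} {t : ℕ} (ht : T₀ ≤ t) :
    ∑ s ∈ Finset.Ico T₀ t, (if X.bind (a s) = none then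
      Real.log (1 + regressor anc x s ⬝ᵥ (gram anc T₀ x a X s)⁻¹ *ᵥ regressor anc x s) else 0) =
      Real.log (gram anc T₀ x a X t).det := by
  induction t, ht using Nat.le_induction with
  | base => simp [gram]
  | succ t ht ih =>
    rw [Finset.sum_Ico_succ_top ht, ih]
    have hpd := posDef_gram anc T₀ x a X t
    split_ifs with h
    · have := dotProduct_inv_mulVec_nonneg hpd (regressor anc x t)
      rw [gram_succ ht h, det_add_vecMulVec hpd, Real.log_mul hpd.det_pos.ne' (by positivity)]
    · rw [gram_succ_of_ne ht h, add_zero]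

end Ellipsoid

/-! ### Optimism, the elliptical potential and the finite-time regret bound -/

section Regret

open Matrix

variable {n : ℕ} [NeZero n] {k : Kind} {M : Model n} {π : Policy n} {d : Fin n → Node n → Prop}
  {c₀ c₁ : ℝ} {T N : ℕ} {A : Set (Action n)}

/-- The bound on the gap at `X` in round `t` that follows from the size of the confidence
ellipsoid. -/
def width (d : Fin n → Node n → Prop) (T₀ T : ℕ) (π : Policy n) (x : ℕ → Obs n) (t : ℕ)
    (X : Node n) : ℝ :=
  if X ≠ some 0 ∧ X.bind (played π x t) = none then
    min 1 (2 * radius n T t * √(regressor (fun i => d i X) x t ⬝ᵥ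
      (gram (fun i => d i X) T₀ x (played π x) X t)⁻¹ *ᵥ regressor (fun i => d i X) x t))
  else 0

theorem width_mem_Icc (d : Fin n → Node n → Prop) (T₀ T : ℕ) (π : Policy n) (x : ℕ → Obs n)
    (t : ℕ) (X : Node n) : width d T₀ T π x t X ∈ Set.Icc (0 : ℝ) 1 := by
  unfold width
  have := radius_nonneg n T t
  split_ifs
  · exact ⟨by positivity, min_le_left _ _⟩
  · simp

theorem measurable_width (hπ : ∀ t b, MeasurableSet {h | π t h = b}) (T₀ t : ℕ) (X : Node n) :
    Measurable fun u => width (AncHat c₀ c₁ T N (obs k M π u)) T₀ T π (obs k M π u) t X := by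
  refine measurable_finite_choice (measurableSet_ancHat (k := k) (M := M) hπ c₀ c₁ T N)
    (f := fun d u => width d T₀ T π (obs k M π u) t X) fun d => ?_
  unfold width
  refine Measurable.ite ((MeasurableSet.const (X ≠ some 0)).inter
    (measurableSet_bind_played hπ X t)) ?_ measurable_const
  exact measurable_const.min (((measurable_dotProduct_inv (measurable_gram hπ _ T₀ X t)
    (measurable_regressor hπ _ t)).sqrt).const_mul _)

/-- The event that the true weights are candidates in round `t`. -/
def Confident (k : Kind) (M : Model n) (π : Policy n) (c₀ c₁ : ℝ) (T N t : ℕ)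
    (u : ℕ → Node n → ℝ × ℝ) : Prop :=
  GoodAnc M (AncHat c₀ c₁ T N (obs k M π u)) ∧
    IsCandidate k (AncHat c₀ c₁ T N (obs k M π u)) (2 * (n - 1) * N) T (obs k M π u)
      (played π (obs k M π u)) t M.weight

/-- **Optimism**: the regret of a round is at most the expected sum of the widths. -/
theorem regret_round_le (hπ : IsBLMLRUnknownSG k c₀ c₁ T N A π) (hA : IsActionSet A) {t : ℕ}
    (ht : 2 * (n - 1) * N ≤ t) (htT : t < T) {u : ℕ → Node n → ℝ × ℝ}
    (hu : Confident k M π c₀ c₁ T N t u) :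
    sSup (M.reward k '' A) - M.reward k (π t (history k M π u t)) ≤
      ∫ z, ∑ X, width (AncHat c₀ c₁ T N (obs k M π (Function.update u t z))) (2 * (n - 1) * N) T π
        (obs k M π (Function.update u t z)) t X ∂exoLaw M.noise := by
  obtain ⟨hd, hcand⟩ := hu
  set d := AncHat c₀ c₁ T N (obs k M π u) with hdd
  set h := history k M π u t with hh
  have hext : ∀ s < t, extend h s = obs k M π u s := by
    intro s hs
    rw [extend, dif_pos hs, hh, history_eq]
  have hanc : AncHat c₀ c₁ T N (extend h) = d := ancHat_congr fun s hs => hext s (hs.trans_le ht)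
  have hopt := hπ.optimistic t ht htT h (by rw [hanc]; exact hd.acyclic)
    ⟨M.weight, by rw [hanc]; exact (isCandidate_congr hext).2 hcand⟩
  rw [hanc] at hopt
  obtain ⟨hmem, w, hw, hmax⟩ := hopt
  have hw' := (isCandidate_congr hext).1 hw
  have hsup : sSup (M.reward k '' A) ≤
      expReward k w (fun _ => Measure.dirac 0) (π t h) := by
    refine csSup_le ⟨_, Set.mem_image_of_mem _ hA.null_mem⟩ ?_
    rintro _ ⟨b, hb, rfl⟩
    rw [← M.expReward_dirac]
    exact hmax b hb M.weight ((isCandidate_congr hext).2 hcand)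
  have hadm : Admissible k d w :=
    ⟨fun i X => (hw X).1 i, fun i X => (hw X).2.1 i, fun hk X => (hw X).2.2.1 hk⟩
  have hdiff := abs_expReward_sub_reward_le hd.acyclic hd.edge hadm (π t h)
  refine (sub_le_sub_right hsup _).trans ((le_abs_self _).trans (hdiff.trans ?_))
  have hagree : ∀ z, ∀ s < t, obs k M π (Function.update u t z) s = obs k M π u s :=
    fun z s hs => obs_update_of_lt u z hs
  have hanc' : ∀ z, AncHat c₀ c₁ T N (obs k M π (Function.update u t z)) = d := fun z =>
    ancHat_congr fun s hs => hagree z s (hs.trans_le ht)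
  have hplay : played π (obs k M π u) t = π t h := played_obs u t
  -- The expectation of the gap runs over fresh exogenous variables `z`, read here as those of round
  -- `t` itself; the past, and with it the ellipsoid, does not change.
  have hle : ∀ z X, M.gap (π t h) w X (propagate k M.weight (π t h) z) ≤
      width d (2 * (n - 1) * N) T π (obs k M π (Function.update u t z)) t X := by
    intro z X
    have hpl : played π (obs k M π (Function.update u t z)) t = π t h := by
      rw [played_congr (hagree z), hplay]
    rw [Model.gap, width, hpl]
    split_ifs
    · refine min_le_min le_rfl ?_
      rw [gram_congr (hagree z), regressor, obs_update_self, hplay]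
      exact abs_sum_le_of_isCandidate hw' hcand X _
    · exact le_rfl
  simp only [hanc']
  refine integral_mono_of_nonneg (.of_forall fun z => Finset.sum_nonneg fun X _ => M.gap_nonneg ..)
    (integrable_finsetSum _ fun X _ => ?_) (.of_forall fun z => Finset.sum_le_sum fun X _ => hle z X)
  refine Integrable.of_mem_Icc 0 1 ?_ (.of_forall fun z => width_mem_Icc ..)
  have hm := (measurable_width (k := k) (M := M) (c₀ := c₀) (c₁ := c₁) (T := T) (N := N)
    hπ.measurable (2 * (n - 1) * N) t X).comp (measurable_update u (a := t))
  simpa only [Function.comp_def, hanc'] using hm.aemeasurable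

/-- A union bound over the failure of the discovery and the scores of the nodes, for one fixed
round. With `L = log(1/δ)` each score fails with probability at most `exp(-4L) = δ⁴`. -/
theorem measure_not_confident_le (hπ : IsBLMLRUnknownSG k c₀ c₁ T N A π) (hc₀ : 0 < c₀)
    (hc₁ : 0 < c₁) (hN : (N : ℝ) = c₀ * √(T : ℝ)) (hN0 : 0 < N) (hθ : 0 < M.thetaMin)
    (hT : 32 * (c₁ / (M.kappa * M.thetaMin)) ^ 5 ≤ (T : ℝ)) (hT1 : 1 ≤ T) {t : ℕ}
    (ht : 2 * (n - 1) * N ≤ t) :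
    M.law.real {u | ¬ Confident k M π c₀ c₁ T N t u} ≤
      n ^ 2 * Real.exp (-(c₀ * c₁ ^ 2 * (T : ℝ) ^ (1 / 10 : ℝ))) +
        (n + 1) * (1 / (n * √(T : ℝ))) ^ 4 := by
  set L := Real.log (1 / (1 / (n * √(T : ℝ)))) with hL
  have hn1 : (1 : ℝ) ≤ n := by exact_mod_cast NeZero.one_le
  have hs1 : (1 : ℝ) ≤ √(T : ℝ) := Real.one_le_sqrt.2 (by exact_mod_cast hT1)
  have hnT : (1 : ℝ) ≤ n * √(T : ℝ) := one_le_mul_of_one_le_of_one_le hn1 hs1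
  have hL' : L = Real.log (n * √(T : ℝ)) := by rw [hL, one_div_one_div]
  have hL0 : 0 ≤ L := by rw [hL']; exact Real.log_nonneg hnT
  have hexp : Real.exp (-(4 * L)) = (1 / (n * √(T : ℝ))) ^ 4 := by
    rw [Real.exp_neg, hL', mul_comm, Real.exp_mul, Real.exp_log (by positivity), one_div, inv_pow]
    norm_cast
  set B : Node n → Set (ℕ → Node n → ℝ × ℝ) := fun X =>
    {u | X ≠ some 0 ∧ GoodAnc M (AncHat c₀ c₁ T N (obs k M π u)) ∧
      n * Real.log (1 + t * n) + 2 * L <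
      score M (fun i => AncHat c₀ c₁ T N (obs k M π u) i X) (2 * (n - 1) * N) (obs k M π u)
        (played π (obs k M π u)) X t ⬝ᵥ
      (gram (fun i => AncHat c₀ c₁ T N (obs k M π u) i X) (2 * (n - 1) * N)
        (obs k M π u) (played π (obs k M π u)) X t)⁻¹ *ᵥ
      (score M (fun i => AncHat c₀ c₁ T N (obs k M π u) i X) (2 * (n - 1) * N) (obs k M π u)
        (played π (obs k M π u)) X t)} with hB
  have hBle : ∀ X, M.law.real (B X) ≤ (1 / (n * √(T : ℝ))) ^ 4 := by
    intro X
    by_cases hX : X = some 0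
    · have : B X = ∅ := by
        refine Set.eq_empty_iff_forall_notMem.2 fun u hu => hu.1 hX
      rw [this, measureReal_empty]
      positivity
    · rw [← hexp]
      refine ENNReal.toReal_le_of_le_ofReal (Real.exp_pos _).le ?_
      refine (measure_mono fun u hu => ?_).trans
        (measure_score_gt_le (k := k) (M := M) (c₀ := c₀) (c₁ := c₁) (T := T) hπ.measurable hX ht L)
      exact ⟨hu.2.1, hu.2.2⟩
  have hsub : {u | ¬ Confident k M π c₀ c₁ T N t u} ⊆
      {u | ¬ GoodAnc M (AncHat c₀ c₁ T N (obs k M π u))} ∪ ⋃ X, B X := by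
    intro u hu
    by_contra hcon
    simp only [Set.mem_union, Set.mem_iUnion, not_or, not_exists] at hcon
    have hd : GoodAnc M (AncHat c₀ c₁ T N (obs k M π u)) := not_not.1 hcon.1
    refine hu ⟨hd, isCandidate_weight hd ?_ fun X hX => ?_⟩
    · have : 0 ≤ Real.log (1 + t * n) := Real.log_nonneg (by
        have : (0 : ℝ) ≤ t * n := by positivity
        linarith)
      rw [← hL]
      positivity
    · by_contra hlt
      exact hcon.2 X ⟨hX, hd, not_le.1 hlt⟩
  refine (measureReal_mono hsub (measure_ne_top _ _)).trans ?_
  refine (measureReal_union_le _ _).trans (add_le_add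
    (measure_not_goodAnc_le hπ hc₀ hc₁ hN hN0 hθ hT) ?_)
  refine (measureReal_iUnion_fintype_le _).trans ((Finset.sum_le_sum fun X _ => hBle X).trans ?_)
  simp

theorem measurableSet_confident (hπ : ∀ t b, MeasurableSet {h | π t h = b}) (t : ℕ) :
    MeasurableSet {u | Confident k M π c₀ c₁ T N t u} := by
  refine measurableSet_finite_choice (measurableSet_ancHat (k := k) (M := M) hπ c₀ c₁ T N)
    (p := fun d u => GoodAnc M d ∧ IsCandidate k d (2 * (n - 1) * N) T (obs k M π u)
      (played π (obs k M π u)) t M.weight) fun d => ?_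
  refine (MeasurableSet.const _).inter ?_
  change MeasurableSet {u | IsCandidate k d (2 * (n - 1) * N) T (obs k M π u)
    (played π (obs k M π u)) t M.weight}
  simp only [IsCandidate, Set.ofPred_forall]
  refine .iInter fun X => ?_
  simp only [Set.ofPred_and]
  refine .inter (.const _) (.inter (.const _) (.inter (.const _) ?_))
  refine measurableSet_le (Measurable.sqrt ?_) measurable_const
  have hG := measurable_gram (k := k) (M := M) hπ (fun i => d i X) (2 * (n - 1) * N) X t
  have hb : ∀ i, Measurable fun u => moment (fun i => d i X) (2 * (n - 1) * N) (obs k M π u)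
      (played π (obs k M π u)) X t i := by
    intro i
    simp only [moment, Finset.sum_apply, Finset.sum_filter]
    refine Finset.measurable_fun_sum _ fun s _ => ?_
    refine Measurable.ite (measurableSet_bind_played hπ X s) ?_ measurable_const
    exact (measurable_pi_iff.1 (measurable_obs hπ s) X).mul (measurable_regressor hπ _ s i)
  have hθ : ∀ i, Measurable fun u => M.weight i X - thetaHat (fun i => d i X) (2 * (n - 1) * N)
      (obs k M π u) (played π (obs k M π u)) X t i := fun i => by
    simp only [thetaHat, mulVec, dotProduct]
    exact measurable_const.sub (Finset.measurable_fun_sum _ fun j _ =>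
      (measurable_inv_of_entries hG i j).mul (hb j))
  simp only [mulVec, dotProduct]
  exact Finset.measurable_fun_sum _ fun i _ => (hθ i).mul
    (Finset.measurable_fun_sum _ fun j _ => (hG i j).mul (hθ j))

/-- The **elliptical potential lemma**. -/
theorem sum_width_le {T₀ : ℕ} {X : Node n} {u : ℕ → Node n → ℝ × ℝ}
    (hu : ∀ t, M.NoiseOk (u t)) (h : T₀ ≤ T) :
    ∑ t ∈ Finset.Ico T₀ T, width d T₀ T π (obs k M π u) t X ≤
      2 * radius n T T * √(2 * T * (n * Real.log (1 + T * n))) := by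
  set ρ := radius n T T with hρ
  have hn : 1 ≤ n := NeZero.one_le
  have hρ1 : 1 ≤ ρ := one_le_radius n T T hn
  set m : ℕ → ℝ := fun t => regressor (fun i => d i X) (obs k M π u) t ⬝ᵥ
    (gram (fun i => d i X) T₀ (obs k M π u) (played π (obs k M π u)) X t)⁻¹ *ᵥ
      regressor (fun i => d i X) (obs k M π u) t with hm
  have hm0 : ∀ t, 0 ≤ m t := fun t => dotProduct_inv_mulVec_nonneg (posDef_gram _ _ _ _ _ _) _
  have hsq : ∀ t ∈ Finset.Ico T₀ T, width d T₀ T π (obs k M π u) t X ^ 2 ≤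
      8 * ρ ^ 2 * (if X.bind (played π (obs k M π u) t) = none then Real.log (1 + m t) else 0) := by
    intro t ht
    have hlog : 0 ≤ Real.log (1 + m t) := Real.log_nonneg (by linarith [hm0 t])
    unfold width
    split_ifs with h1 h2 h2
    · have hr : radius n T t ≤ ρ := radius_mono n T (Finset.mem_Ico.1 ht).2.le
      have h3 := min_one_le_two_log (hm0 t)
      have h4 : 0 ≤ radius n T t := radius_nonneg n T t
      -- For `m t ≥ 1` the truncation at `1` and `ρ ≥ 1` are used. The factor `8` in `hsq` is this
      -- `4` times the `2` of `min_one_le_two_log`.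
      have h5 : min 1 (2 * radius n T t * √(m t)) ^ 2 ≤ 4 * ρ ^ 2 * min 1 (m t) := by
        rcases le_total 1 (m t) with h6 | h6
        · rw [min_eq_left h6]
          have h7 : min 1 (2 * radius n T t * √(m t)) ^ 2 ≤ 1 :=
            pow_le_one₀ (by positivity) (min_le_left _ _)
          nlinarith
        · rw [min_eq_right h6]
          calc min 1 (2 * radius n T t * √(m t)) ^ 2 ≤ (2 * radius n T t * √(m t)) ^ 2 :=
                pow_le_pow_left₀ (by positivity) (min_le_right _ _) 2
            _ = 4 * radius n T t ^ 2 * m t := by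
                rw [mul_pow, Real.sq_sqrt (hm0 t)]; ring
            _ ≤ 4 * ρ ^ 2 * m t := by
                have := hm0 t
                gcongr
      calc _ ≤ 4 * ρ ^ 2 * min 1 (m t) := h5
        _ ≤ 4 * ρ ^ 2 * (2 * Real.log (1 + m t)) := by gcongr
        _ = 8 * ρ ^ 2 * Real.log (1 + m t) := by ring
    · exact absurd h1.2 h2
    · simp only [ne_eq, OfNat.ofNat_ne_zero, not_false_eq_true, zero_pow]
      positivity
    · simp
  have hsum : ∑ t ∈ Finset.Ico T₀ T, width d T₀ T π (obs k M π u) t X ^ 2 ≤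
      8 * ρ ^ 2 * (n * Real.log (1 + T * n)) := by
    refine (Finset.sum_le_sum hsq).trans ?_
    rw [← Finset.mul_sum, sum_log_eq_log_det h]
    gcongr
    exact log_det_gram_le hu _ T₀ X T
  have hcs := sq_sum_le_card_mul_sum_sq (s := Finset.Ico T₀ T)
    (f := fun t => width d T₀ T π (obs k M π u) t X)
  have hcard : ((Finset.Ico T₀ T).card : ℝ) ≤ T := by
    rw [Nat.card_Ico]
    exact_mod_cast Nat.sub_le _ _
  have hlog0 : 0 ≤ Real.log (1 + T * n) := Real.log_nonneg (by
    have : (0 : ℝ) ≤ T * n := by positivity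
    linarith)
  refine le_of_sq_le_sq ?_ (by positivity)
  calc (∑ t ∈ Finset.Ico T₀ T, width d T₀ T π (obs k M π u) t X) ^ 2
      ≤ (Finset.Ico T₀ T).card * ∑ t ∈ Finset.Ico T₀ T, width d T₀ T π (obs k M π u) t X ^ 2 := hcs
    _ ≤ T * (8 * ρ ^ 2 * (n * Real.log (1 + T * n))) := by
        gcongr
    _ = (2 * ρ * √(2 * T * (n * Real.log (1 + T * n)))) ^ 2 := by
        rw [mul_pow, Real.sq_sqrt (by positivity)]
        ring

/-- The regret of one round. -/
def roundRegret (k : Kind) (M : Model n) (A : Set (Action n)) (π : Policy n) (t : ℕ)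
    (u : ℕ → Node n → ℝ × ℝ) : ℝ :=
  sSup (M.reward k '' A) - M.reward k (π t (history k M π u t))

theorem roundRegret_mem_Icc (hA : IsActionSet A) (hπ : ∀ t h, π t h ∈ A) (t : ℕ)
    (u : ℕ → Node n → ℝ × ℝ) : roundRegret k M A π t u ∈ Set.Icc (0 : ℝ) 1 := by
  have hle : sSup (M.reward k '' A) ≤ 1 := by
    refine csSup_le ⟨_, Set.mem_image_of_mem _ hA.null_mem⟩ ?_
    rintro _ ⟨b, _, rfl⟩
    exact (M.reward_mem_Icc k b).2
  have hbdd : BddAbove (M.reward k '' A) := by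
    refine ⟨1, ?_⟩
    rintro _ ⟨b, _, rfl⟩
    exact (M.reward_mem_Icc k b).2
  have h1 := le_csSup hbdd (Set.mem_image_of_mem (M.reward k) (hπ t (history k M π u t)))
  have h2 := (M.reward_mem_Icc k (π t (history k M π u t))).1
  exact ⟨sub_nonneg.2 h1, by unfold roundRegret; linarith⟩

theorem integrable_roundRegret (hA : IsActionSet A) (hπ : IsBLMLRUnknownSG k c₀ c₁ T N A π)
    (t : ℕ) : Integrable (roundRegret k M A π t) M.law := by
  refine Integrable.of_mem_Icc 0 1 (Measurable.aemeasurable ?_)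
    (.of_forall fun u => roundRegret_mem_Icc hA hπ.mem t u)
  have hp : ∀ b, MeasurableSet {u | π t (history k M π u t) = b} := fun b => by
    simpa only [played_obs] using measurableSet_played (k := k) (M := M) hπ.measurable t b
  exact measurable_const.sub (measurable_finite_choice hp
    (f := fun b _ => M.reward k b) fun _ => measurable_const)

theorem integrable_width (hπ : IsBLMLRUnknownSG k c₀ c₁ T N A π) (T₀ t : ℕ) (X : Node n) :
    Integrable (fun u => width (AncHat c₀ c₁ T N (obs k M π u)) T₀ T π (obs k M π u) t X) M.law :=
  Integrable.of_mem_Icc 0 1 (measurable_width hπ.measurable T₀ t X).aemeasurable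
    (.of_forall fun _ => width_mem_Icc ..)

/-- Optimism bounds the regret by widths with round `t` resampled, and these have the same integral
as the actual widths. Off the confident event the regret is at most `1`. -/
theorem integral_roundRegret_le (hA : IsActionSet A) (hπ : IsBLMLRUnknownSG k c₀ c₁ T N A π)
    {t : ℕ} (ht : 2 * (n - 1) * N ≤ t) (htT : t < T) :
    ∫ u, roundRegret k M A π t u ∂M.law ≤
      M.law.real {u | ¬ Confident k M π c₀ c₁ T N t u} +
        ∫ u, ∑ X, width (AncHat c₀ c₁ T N (obs k M π u)) (2 * (n - 1) * N) T π (obs k M π u) t X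
          ∂M.law := by
  classical
  set W : (ℕ → Node n → ℝ × ℝ) → ℝ := fun u =>
    ∑ X, width (AncHat c₀ c₁ T N (obs k M π u)) (2 * (n - 1) * N) T π (obs k M π u) t X with hW
  have hWi : Integrable W M.law := integrable_finsetSum _ fun X _ => integrable_width hπ _ t X
  have hWup : ∫ u, W u ∂M.law = ∫ u, ∫ z, W (Function.update u t z) ∂exoLaw M.noise ∂M.law :=
    integral_update (fun _ => exoLaw M.noise) hWi t
  have hWui : Integrable (fun u => ∫ z, W (Function.update u t z) ∂exoLaw M.noise) M.law :=
    integrable_integral_update (fun _ => exoLaw M.noise) hWi t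
  have hms := (measurableSet_confident (k := k) (M := M) (c₀ := c₀) (c₁ := c₁) (T := T) (N := N)
    hπ.measurable t).compl
  have hset : {u | ¬ Confident k M π c₀ c₁ T N t u} = {u | Confident k M π c₀ c₁ T N t u}ᶜ := rfl
  rw [hset, hWup, ← integral_indicator_one hms, ← integral_add ?_ hWui]
  · refine integral_mono (integrable_roundRegret hA hπ t)
      (((integrable_const 1).indicator hms).add hWui) fun u => ?_
    have hpos : 0 ≤ ∫ z, W (Function.update u t z) ∂exoLaw M.noise :=
      integral_nonneg fun z => Finset.sum_nonneg fun X _ => (width_mem_Icc ..).1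
    by_cases hu : Confident k M π c₀ c₁ T N t u
    · have := regret_round_le hπ hA ht htT hu
      rw [Set.indicator_of_notMem (by simpa using hu), zero_add]
      exact this
    · rw [Set.indicator_of_mem (by simpa using hu)]
      have := (roundRegret_mem_Icc (k := k) (M := M) hA hπ.mem t u).2
      simp only [Pi.one_apply]
      linarith
  · exact (integrable_const 1).indicator hms

theorem regret_le (hA : IsActionSet A) (hπ : IsBLMLRUnknownSG k c₀ c₁ T N A π) (hc₀ : 0 < c₀)
    (hc₁ : 0 < c₁) (hN : (N : ℝ) = c₀ * √(T : ℝ)) (hN0 : 0 < N) (hθ : 0 < M.thetaMin)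
    (hT : 32 * (c₁ / (M.kappa * M.thetaMin)) ^ 5 ≤ (T : ℝ)) (hT1 : 1 ≤ T) :
    regret k M A π T ≤ 2 * n * N +
      T * (n ^ 2 * Real.exp (-(c₀ * c₁ ^ 2 * (T : ℝ) ^ (1 / 10 : ℝ))) +
        (n + 1) * (1 / (n * √(T : ℝ))) ^ 4) +
      n * (2 * radius n T T * √(2 * T * (n * Real.log (1 + T * n)))) := by
  classical
  set p := n ^ 2 * Real.exp (-(c₀ * c₁ ^ 2 * (T : ℝ) ^ (1 / 10 : ℝ))) +
        (n + 1) * (1 / (n * √(T : ℝ))) ^ 4 with hp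
  have hp0 : 0 ≤ p := by positivity
  set T₀ := 2 * (n - 1) * N with hT₀
  set B := 2 * radius n T T * √(2 * T * (n * Real.log (1 + T * n))) with hB
  have hB0 : 0 ≤ B := by
    have := radius_nonneg n T T
    positivity
  have hT₀n : (T₀ : ℝ) ≤ 2 * n * N := by
    have : T₀ ≤ 2 * n * N := Nat.mul_le_mul_right _ (by omega)
    exact_mod_cast this
  have hone : ∀ t, ∫ u, roundRegret k M A π t u ∂M.law ≤ 1 := fun t => by
    have := integral_mono (integrable_roundRegret (M := M) hA hπ t) (integrable_const (1 : ℝ))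
      fun u => (roundRegret_mem_Icc (k := k) (M := M) hA hπ.mem t u).2
    simpa using this
  have hreg : regret k M A π T = ∑ t ∈ Finset.range T, ∫ u, roundRegret k M A π t u ∂M.law := by
    rw [← integral_finsetSum _ fun t _ => integrable_roundRegret hA hπ t]
    rfl
  rw [hreg]
  -- If the horizon ends within the discovery phase, the trivial bound of `1` per round suffices.
  rcases le_total T T₀ with hTT | hTT
  · have h1 : ∑ t ∈ Finset.range T, ∫ u, roundRegret k M A π t u ∂M.law ≤ T := by
      refine (Finset.sum_le_sum fun t _ => hone t).trans ?_
      simp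
    have h2 : (T : ℝ) ≤ T₀ := by exact_mod_cast hTT
    have h3 : 0 ≤ T * p := by positivity
    have h4 : 0 ≤ n * B := by positivity
    linarith
  rw [← Finset.sum_range_add_sum_Ico _ hTT]
  have h1 : ∑ t ∈ Finset.range T₀, ∫ u, roundRegret k M A π t u ∂M.law ≤ T₀ := by
    refine (Finset.sum_le_sum fun t _ => hone t).trans ?_
    simp
  have h2 : ∑ t ∈ Finset.Ico T₀ T, ∫ u, roundRegret k M A π t u ∂M.law ≤
      ∑ t ∈ Finset.Ico T₀ T, (p + ∫ u, ∑ X, width (AncHat c₀ c₁ T N (obs k M π u)) T₀ T π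
        (obs k M π u) t X ∂M.law) := by
    refine Finset.sum_le_sum fun t ht => ?_
    obtain ⟨ht1, ht2⟩ := Finset.mem_Ico.1 ht
    refine (integral_roundRegret_le hA hπ ht1 ht2).trans (add_le_add ?_ le_rfl)
    exact measure_not_confident_le hπ hc₀ hc₁ hN hN0 hθ hT hT1 ht1
  have h3 : ∑ t ∈ Finset.Ico T₀ T, ∫ u, ∑ X, width (AncHat c₀ c₁ T N (obs k M π u)) T₀ T π
        (obs k M π u) t X ∂M.law ≤ n * B := by
    rw [← integral_finsetSum _ fun t _ => integrable_finsetSum _ fun X _ =>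
      integrable_width hπ T₀ t X]
    have hae : ∀ᵐ u ∂M.law, ∑ t ∈ Finset.Ico T₀ T, ∑ X,
        width (AncHat c₀ c₁ T N (obs k M π u)) T₀ T π (obs k M π u) t X ≤ n * B := by
      filter_upwards [ae_forall_noiseOk M] with u hu
      rw [Finset.sum_comm, ← Finset.add_sum_erase _ _ (Finset.mem_univ (some 0 : Node n))]
      have h0 : ∑ t ∈ Finset.Ico T₀ T,
          width (AncHat c₀ c₁ T N (obs k M π u)) T₀ T π (obs k M π u) t (some 0) = 0 :=
        Finset.sum_eq_zero fun t _ => by simp [width]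
      rw [h0, zero_add]
      refine (Finset.sum_le_sum fun X _ => sum_width_le hu hTT).trans ?_
      rw [Finset.sum_const, Finset.card_erase_of_mem (Finset.mem_univ _), nsmul_eq_mul]
      simp [hB]
    have := integral_mono_ae (integrable_finsetSum _ fun t _ => integrable_finsetSum _ fun X _ =>
      integrable_width hπ T₀ t X) (integrable_const (n * B)) hae
    simpa using this
  rw [Finset.sum_add_distrib, Finset.sum_const, Nat.card_Ico, nsmul_eq_mul] at h2
  have h4 : ((T - T₀ : ℕ) : ℝ) * p ≤ T * p :=
    mul_le_mul_of_nonneg_right (by exact_mod_cast Nat.sub_le _ _) hp0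
  linarith

end Regret

/-! ### Collecting the powers of `n` and the terms of lower order in `T` -/

section Asymptotics

theorem rpow_five_halves (n : ℕ) : (n : ℝ) ^ (5 / 2 : ℝ) = (n : ℝ) ^ 2 * √(n : ℝ) := by
  rw [Real.sqrt_eq_rpow, ← Real.rpow_natCast, ← Real.rpow_add' n.cast_nonneg (by norm_num)]
  norm_num

theorem log_le_two_sqrt {x : ℝ} (hx : 1 ≤ x) : Real.log x ≤ 2 * √x := by
  have h := Real.log_le_sub_one_of_pos (Real.sqrt_pos.2 (by linarith : 0 < x))
  rw [Real.log_sqrt (by linarith)] at h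
  linarith

/-- The number of nodes gives a factor `n`, the radius `√n` and the determinant `√n`; the last `√n`
pays for the `log n` in `log(1 + Tn)`. -/
theorem radius_mul_sqrt_le {n T : ℕ} (hn : 1 ≤ n) (hT : 1 ≤ T) :
    n * (2 * radius n T T * √(2 * T * (n * Real.log (1 + T * n)))) ≤
      (n : ℝ) ^ (5 / 2 : ℝ) * (9 * √(T : ℝ) * Real.log T + 30 * √(T : ℝ)) := by
  have hn1 : (1 : ℝ) ≤ n := by exact_mod_cast hn
  have hT1 : (1 : ℝ) ≤ T := by exact_mod_cast hT
  have hsT : (1 : ℝ) ≤ √(T : ℝ) := Real.one_le_sqrt.2 hT1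
  have hsn : (1 : ℝ) ≤ √(n : ℝ) := Real.one_le_sqrt.2 hn1
  set l := Real.log (1 + T * n) with hl
  have hTn : (1 : ℝ) ≤ T * n := one_le_mul_of_one_le_of_one_le hT1 hn1
  have hl0 : 0 ≤ l := Real.log_nonneg (by linarith)
  have hlT : 0 ≤ Real.log T := Real.log_nonneg hT1
  have hL : Real.log (1 / (1 / (n * √(T : ℝ)))) ≤ l := by
    rw [one_div_one_div]
    refine Real.log_le_log (by positivity) ?_
    have : √(T : ℝ) ≤ T := Real.sqrt_le_self_iff.2 (Or.inr hT1)
    nlinarith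
  have hl1 : l ≤ 1 + Real.log T + 2 * √(n : ℝ) := by
    have h1 : l ≤ Real.log (2 * (T * n)) := Real.log_le_log (by linarith) (by linarith)
    rw [Real.log_mul two_ne_zero (by positivity), Real.log_mul (by positivity) (by positivity)] at h1
    have h2 := log_le_two_sqrt hn1
    have h3 := Real.log_two_lt_d9
    linarith
  have hrad : radius n T T ≤ √(n : ℝ) * (2 * √l + 1) := by
    have h1 : n * l + 2 * Real.log (1 / (1 / (n * √(T : ℝ)))) ≤ (√(n : ℝ) * (2 * √l)) ^ 2 := by
      rw [mul_pow, mul_pow, Real.sq_sqrt (by positivity), Real.sq_sqrt hl0]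
      nlinarith
    have h2 := Real.sqrt_le_sqrt h1
    rw [Real.sqrt_sq (by positivity)] at h2
    unfold radius
    linarith
  -- The factor `3/2` is a rational bound for `√2`.
  have hsq : √(2 * T * (n * l)) ≤ 3 / 2 * √(T : ℝ) * √(n : ℝ) * √l := by
    refine Real.sqrt_le_iff.2 ⟨by positivity, ?_⟩
    rw [mul_pow, mul_pow, mul_pow, Real.sq_sqrt (by positivity), Real.sq_sqrt (by positivity),
      Real.sq_sqrt hl0]
    have : 0 ≤ (T : ℝ) * (n * l) := by positivity
    nlinarith
  have hll : (2 * √l + 1) * √l ≤ 3 * l + 1 := by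
    have := Real.sq_sqrt hl0
    nlinarith [sq_nonneg (√l - 1)]
  have hsn2 := Real.sq_sqrt (show (0 : ℝ) ≤ n by positivity)
  calc (n : ℝ) * (2 * radius n T T * √(2 * T * (n * l)))
      ≤ n * (2 * (√(n : ℝ) * (2 * √l + 1)) * (3 / 2 * √(T : ℝ) * √(n : ℝ) * √l)) := by
        gcongr
    _ = 3 * n * √(T : ℝ) * √(n : ℝ) ^ 2 * ((2 * √l + 1) * √l) := by ring
    _ = 3 * n ^ 2 * √(T : ℝ) * ((2 * √l + 1) * √l) := by rw [hsn2]; ring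
    _ ≤ 3 * n ^ 2 * √(T : ℝ) * (3 * l + 1) := by gcongr
    _ ≤ 3 * n ^ 2 * √(T : ℝ) * (√(n : ℝ) * (3 * Real.log T + 10)) := by
        gcongr
        nlinarith
    _ = n ^ 2 * √(n : ℝ) * (9 * √(T : ℝ) * Real.log T + 30 * √(T : ℝ)) := by ring
    _ = _ := by rw [rpow_five_halves]

theorem isLittleO_sqrt_mul_log :
    (fun T : ℕ => √(T : ℝ)) =o[Filter.atTop] fun T : ℕ => √(T : ℝ) * Real.log T := by
  have h : (fun _ : ℕ => (1 : ℝ)) =o[Filter.atTop] fun T : ℕ => Real.log T :=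
    Asymptotics.isLittleO_const_left.2 (Or.inr
      (tendsto_norm_atTop_atTop.comp
        (Real.tendsto_log_atTop.comp tendsto_natCast_atTop_atTop)))
  simpa using (Asymptotics.isBigO_refl (fun T : ℕ => √(T : ℝ)) Filter.atTop).mul_isLittleO h

/-- With `p = T^{1/10}` the left side is `√T · p⁵ exp(-cp)`, and the second factor tends to zero. -/
theorem isBigO_mul_exp_neg {c : ℝ} (hc : 0 < c) :
    (fun T : ℕ => (T : ℝ) * Real.exp (-(c * (T : ℝ) ^ (1 / 10 : ℝ)))) =O[Filter.atTop]
      fun T : ℕ => √(T : ℝ) := by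
  have h1 := tendsto_rpow_mul_exp_neg_mul_atTop_nhds_zero 5 c hc
  have h2 : Filter.Tendsto (fun T : ℕ => (T : ℝ) ^ (1 / 10 : ℝ)) Filter.atTop Filter.atTop :=
    (tendsto_rpow_atTop (by norm_num)).comp tendsto_natCast_atTop_atTop
  have h3 := (h1.comp h2).isBigO_one ℝ
  have h4 := (Asymptotics.isBigO_refl (fun T : ℕ => √(T : ℝ)) Filter.atTop).mul h3
  refine (h4.congr_left fun T => ?_).congr_right fun T => mul_one _
  have h5 : ((T : ℝ) ^ (1 / 10 : ℝ)) ^ (5 : ℝ) = √(T : ℝ) := by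
    rw [← Real.rpow_mul T.cast_nonneg, Real.sqrt_eq_rpow]
    norm_num
  simp only [Function.comp_apply, h5]
  rw [← mul_assoc, Real.mul_self_sqrt T.cast_nonneg, neg_mul]

end Asymptotics

end

end CausalBandit

/-! ### The regret bound -/

theorem mainTheorem4 :
    ∃ C : ℝ, 0 < C ∧ ∀ c₀ c₁ : ℝ, 0 < c₀ → 0 < c₁ →
      ∃ g : ℕ → ℝ,
        g =o[Filter.atTop] (fun T : ℕ => √(T : ℝ) * Real.log (T : ℝ)) ∧
        ∀ (n : ℕ) [NeZero n] (k : CausalBandit.Kind) (M : CausalBandit.Model n)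
          (A : Set (CausalBandit.Action n)) (T N : ℕ) (π : CausalBandit.Policy n),
          CausalBandit.IsActionSet A →
          0 < N → (N : ℝ) = c₀ * √(T : ℝ) →
          0 < M.thetaMin →
          32 * (c₁ / (M.kappa * M.thetaMin)) ^ 5 ≤ (T : ℝ) →
          CausalBandit.IsBLMLRUnknownSG k c₀ c₁ T N A π →
          MeasureTheory.Integrable (CausalBandit.pseudoRegret k M A π T) M.law ∧
          CausalBandit.regret k M A π T ≤
            (n : ℝ) ^ (5 / 2 : ℝ) * (C * √(T : ℝ) * Real.log (T : ℝ) + g T) := by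
  -- In `g`, discovery contributes `2c₀√T`, the widths `30√T`, the failing scores `2√T`, and the
  -- failing tests the exponential term.
  refine ⟨9, by norm_num, fun c₀ c₁ hc₀ hc₁ => ⟨fun T => (2 * c₀ + 32) * √(T : ℝ) +
    (T : ℝ) * Real.exp (-(c₀ * c₁ ^ 2 * (T : ℝ) ^ (1 / 10 : ℝ))), ?_, ?_⟩⟩
  · exact (CausalBandit.isLittleO_sqrt_mul_log.const_mul_left _).add
      ((CausalBandit.isBigO_mul_exp_neg (by positivity)).trans_isLittleO
        CausalBandit.isLittleO_sqrt_mul_log)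
  · intro n _ k M A T N π hA hN0 hN hθ hT hπ
    refine ⟨MeasureTheory.integrable_finsetSum _ fun t _ =>
      CausalBandit.integrable_roundRegret hA hπ t, ?_⟩
    have hn : 1 ≤ n := NeZero.one_le
    have hn1 : (1 : ℝ) ≤ n := by exact_mod_cast hn
    have hNpos : (0 : ℝ) < N := by exact_mod_cast hN0
    have hT1 : 1 ≤ T := by
      rcases Nat.eq_zero_or_pos T with rfl | h
      · simp [hNpos.ne'] at hN
      · exact h
    have hT1' : (1 : ℝ) ≤ T := by exact_mod_cast hT1
    have hsT : (1 : ℝ) ≤ √(T : ℝ) := Real.one_le_sqrt.2 hT1'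
    have hsn : (1 : ℝ) ≤ √(n : ℝ) := Real.one_le_sqrt.2 hn1
    refine (CausalBandit.regret_le hA hπ hc₀ hc₁ hN hN0 hθ hT hT1).trans ?_
    have hmain := CausalBandit.radius_mul_sqrt_le hn hT1
    set E := Real.exp (-(c₀ * c₁ ^ 2 * (T : ℝ) ^ (1 / 10 : ℝ))) with hE
    have hE0 : 0 < E := Real.exp_pos _
    have h52 := CausalBandit.rpow_five_halves n
    have hn2 : (n : ℝ) ^ 2 ≤ (n : ℝ) ^ (5 / 2 : ℝ) := by
      rw [h52]
      exact le_mul_of_one_le_right (by positivity) hsn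
    have hnn : (n : ℝ) ≤ (n : ℝ) ^ (5 / 2 : ℝ) := le_trans (by nlinarith) hn2
    have h1 : 2 * (n : ℝ) * N ≤ (n : ℝ) ^ (5 / 2 : ℝ) * (2 * c₀ * √(T : ℝ)) := by
      rw [hN]
      calc 2 * (n : ℝ) * (c₀ * √(T : ℝ)) = n * (2 * c₀ * √(T : ℝ)) := by ring
        _ ≤ _ := by gcongr
    have h2 : (T : ℝ) * ((n : ℝ) ^ 2 * E) ≤ (n : ℝ) ^ (5 / 2 : ℝ) * (T * E) := by
      calc (T : ℝ) * ((n : ℝ) ^ 2 * E) = (n : ℝ) ^ 2 * (T * E) := by ring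
        _ ≤ _ := by gcongr
    have h3 : (T : ℝ) * ((n + 1) * (1 / (n * √(T : ℝ))) ^ 4) ≤
        (n : ℝ) ^ (5 / 2 : ℝ) * (2 * √(T : ℝ)) := by
      have hs4 : √(T : ℝ) ^ 4 = (T : ℝ) ^ 2 := by
        rw [show √(T : ℝ) ^ 4 = (√(T : ℝ) ^ 2) ^ 2 by ring, Real.sq_sqrt (by positivity)]
      have h4 : (1 / (n * √(T : ℝ))) ^ 4 ≤ 1 / (T : ℝ) := by
        rw [div_pow, one_pow, mul_pow, hs4]
        refine one_div_le_one_div_of_le (by positivity) ?_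
        have : (1 : ℝ) ≤ (n : ℝ) ^ 4 := one_le_pow₀ hn1
        nlinarith
      calc (T : ℝ) * ((n + 1) * (1 / (n * √(T : ℝ))) ^ 4)
          ≤ T * ((n + 1) * (1 / T)) := by gcongr
        _ = n + 1 := by field_simp
        _ ≤ n * 2 := by linarith
        _ ≤ (n : ℝ) ^ (5 / 2 : ℝ) * (2 * √(T : ℝ)) := by
          gcongr
          linarith
    linarith
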